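/- Let $(V,Y,\mathbf 1,\omega)$ be a vertex operator algebra over $\mathbb C$, let $W$ be a weak $V$-module (a space satisfying all axioms for a $V$-module except that no grading is required), let $U$ be a vector space and let $z\in\mathbb C^{\times}$. For $v\in V$ put $Y^{o}(v,x)=Y(e^{xL(1)}(-x^{-2})^{L(0)}v,x^{-1})$, and let $D_{P(z)}(W,U)\subset \mathrm{Hom}(W,U)$ be the subspace of all $f$ such that for each $v\in V$ there are $k,l\in\mathbb N$ with $$(x-z)^{k}x^{l}\langle u^{*},fY^{o}(v,x)w\rangle\in\mathbb C[x]\qquad\text{for all }u^{*}\in U^{*},\ w\in W .$$ Here $(x\pm z)^n$ is expanded in nonnegative powers of $z$, and $(\pm z+x)^n$ in nonnegative powers of $x$. For $v\in V$, $f\in D_{P(z)}(W,U)$ define series $Y^{L}_{P(z)}(v,x)f$, $Y^{R}_{P(z)}(v,x)f$ with coefficients in $\mathrm{Hom}(W,U)$ by $$(Y^{L}_{P(z)}(v,x)f)(w)=(z+x)^{-l}\big((x+z)^{l}f(Y^{o}(v,x+z)w)\big),\qquad (Y^{R}_{P(z)}(v,x)f)(w)=(-z+x)^{-k}\big((x-z)^{k}f(Y^{o}(v,x)w)\big),$$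 where $k,l\in\mathbb Z$ are any integers with $(x-z)^{k}x^{l}fY^{o}(v,x)w\in U[x]$ for all $w\in W$. Such integers exist, and the series do not depend on their choice. Then the coefficients of these series lie in $D_{P(z)}(W,U)$, and: 1. The pairs $(D_{P(z)}(W,U),Y^{L}_{P(z)})$ and $(D_{P(z)}(W,U),Y^{R}_{P(z)})$ are weak $V$-modules, and the two actions of $V$ commute: $Y^{L}_{P(z)}(u,x_1)Y^{R}_{P(z)}(v,x_2)=Y^{R}_{P(z)}(v,x_2)Y^{L}_{P(z)}(u,x_1)$ for $u,v\in V$. 2. With $Y_{P(z)}=Y^{L}_{P(z)}\otimes Y^{R}_{P(z)}$, that is, $Y_{P(z)}(u\otimes v,x)=Y^{L}_{P(z)}(u,x)Y^{R}_{P(z)}(v,x)$ (a well-defined product), the pair $(D_{P(z)}(W,U),Y_{P(z)})$ is a weak $V\otimes V$-module. 3. Let $V$ act on $U^{*}\otimes W$ through $W$, and put $D_{P(z)}(U^{*}\otimes W)=D_{P(z)}(U^{*}\otimes W,\mathbb C)\subset(U^{*}\otimes W)^{*}$, which carries the corresponding actions as in 1 and 2. Let $\eta:\mathrm{Hom}(W,U)\to(U^{*}\otimes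 W)^{*}$ be the map $\langle\eta(f),u^{*}\otimes w\rangle=\langle u^{*},f(w)\rangle$. Then $$\eta(D_{P(z)}(W,U))=\eta(\mathrm{Hom}(W,U))\cap D_{P(z)}(U^{*}\otimes W),$$ and $\eta$ restricts to an injective map $D_{P(z)}(W,U)\to D_{P(z)}(U^{*}\otimes W)$ that intertwines $Y^{L}_{P(z)}$, $Y^{R}_{P(z)}$ and $Y_{P(z)}$ and whose image is a weak $V\otimes V$-submodule. -/

import Mathlib

open scoped TensorProduct

noncomputable section

namespace RegularRep

universe u₁ u₂ u₃

/-! ## Vertex operator algebras and weak modules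

A formal distribution in `(End M)[[x, x⁻¹]]` is written `∑ v_n x^(-n-1)` and is recorded by its
modes `v_n`, a function `ℤ → End M`. -/

/-- The data of a vertex operator algebra: the modes `Y v n = v_n` of the vertex operators
`Y(v,x) = ∑ v_n x^(-n-1)`, the vacuum vector, the Virasoro element, the central charge (rank) and
the weight spaces, together with the truncation condition `Y(u,x)v ∈ V((x))`. -/
structure VertexData (V : Type u₁) [AddCommGroup V] [Module ℂ V] where
  Y : V →ₗ[ℂ] ℤ → Module.End ℂ V
  vac : V
  conf : V
  rank : ℂ
  grade : ℤ → Submodule ℂ V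
  trunc : ∀ u v : V, ∃ N : ℤ, ∀ n : ℤ, N ≤ n → Y u n v = 0

/-- The left side of the Jacobi identity in modes,
`∑_{i ≥ 0} (m choose i) (u_{l+i} v)_{m+n-i} w`, for a space `M` on which the modes of the elements
of `V` act by `Y`. -/
def jacobiLHS {V : Type u₁} [AddCommGroup V] [Module ℂ V] {M : Type u₂} [AddCommGroup M]
    [Module ℂ M] (A : VertexData V) (Y : V →ₗ[ℂ] ℤ → Module.End ℂ M) (u v : V) (l m n : ℤ)
    (w : M) : M :=
  ∑ᶠ i : ℕ, ((Ring.choose m i : ℤ) : ℂ) • Y (A.Y u (l + i) v) (m + n - i) w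

/-- The right side of the Jacobi identity in modes,
`∑_{i ≥ 0} (-1)^i (l choose i) (u_{m+l-i} v_{n+i} w - (-1)^l v_{n+l-i} u_{m+i} w)`. -/
def jacobiRHS {V : Type u₁} [AddCommGroup V] [Module ℂ V] {M : Type u₂} [AddCommGroup M]
    [Module ℂ M] (Y : V →ₗ[ℂ] ℤ → Module.End ℂ M) (u v : V) (l m n : ℤ) (w : M) : M :=
  ∑ᶠ i : ℕ, ((-1 : ℂ) ^ i * ((Ring.choose l i : ℤ) : ℂ)) •
    (Y u (m + l - i) (Y v (n + i) w) - ((-1 : ℂ) ^ l) • Y v (n + l - i) (Y u (m + i) w))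

/-- A vertex operator algebra `(V, Y, 1, ω)`. The Virasoro operators are `L(n) = ω_{n+1}`, and
`jacobi` is the Jacobi identity, stated for the coefficient of each monomial in the three formal
variables. -/
structure VertexOperatorAlgebra (V : Type u₁) [AddCommGroup V] [Module ℂ V]
    extends VertexData V where
  internal : DirectSum.IsInternal grade
  finite : ∀ n : ℤ, Module.Finite ℂ (grade n)
  lower : ∃ N : ℤ, ∀ n : ℤ, n < N → grade n = ⊥
  vac_mem : vac ∈ grade 0
  conf_mem : conf ∈ grade 2
  vacuum : ∀ (n : ℤ) (v : V), Y vac n v = if n = -1 then v else 0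
  creation : ∀ v : V, Y v (-1) vac = v ∧ ∀ n : ℤ, 0 ≤ n → Y v n vac = 0
  jacobi : ∀ (u v : V) (l m n : ℤ) (w : V),
    jacobiLHS toVertexData Y u v l m n w = jacobiRHS Y u v l m n w
  virasoro : ∀ (m n : ℤ) (w : V),
    Y conf (m + 1) (Y conf (n + 1) w) - Y conf (n + 1) (Y conf (m + 1) w) =
      ((m : ℂ) - n) • Y conf (m + n + 1) w +
        (if m + n = 0 then ((m : ℂ) ^ 3 - m) / 12 * rank else 0) • w
  weight : ∀ (n : ℤ) (v : V), v ∈ grade n → Y conf 1 v = (n : ℂ) • v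
  deriv : ∀ (v : V) (n : ℤ) (w : V), Y (Y conf 0 v) n w = (-(n : ℂ)) • Y v (n - 1) w

/-- A weak module: all axioms of a module for the vertex operator algebra, without a grading.
These are the truncation condition `Y(v,x)w ∈ M((x))`, `Y(1,x) = id`, the Jacobi identity, the
Virasoro relations with the central charge of the algebra, and `Y(L(-1)v,x) = (d/dx) Y(v,x)`. -/
structure WeakModule {V : Type u₁} [AddCommGroup V] [Module ℂ V] (A : VertexData V)
    (M : Type u₂) [AddCommGroup M] [Module ℂ M] where
  Y : V →ₗ[ℂ] ℤ → Module.End ℂ M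
  trunc : ∀ (v : V) (w : M), ∃ N : ℤ, ∀ n : ℤ, N ≤ n → Y v n w = 0
  vacuum : ∀ (n : ℤ) (w : M), Y A.vac n w = if n = -1 then w else 0
  jacobi : ∀ (u v : V) (l m n : ℤ) (w : M),
    jacobiLHS A Y u v l m n w = jacobiRHS Y u v l m n w
  virasoro : ∀ (m n : ℤ) (w : M),
    Y A.conf (m + 1) (Y A.conf (n + 1) w) - Y A.conf (n + 1) (Y A.conf (m + 1) w) =
      ((m : ℂ) - n) • Y A.conf (m + n + 1) w +
        (if m + n = 0 then ((m : ℂ) ^ 3 - m) / 12 * A.rank else 0) • w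
  deriv : ∀ (v : V) (n : ℤ) (w : M), Y (A.Y A.conf 0 v) n w = (-(n : ℂ)) • Y v (n - 1) w

/-- A subspace stable under all modes, i.e. a weak submodule. -/
def WeakModule.IsSubmodule {V : Type u₁} [AddCommGroup V] [Module ℂ V] {A : VertexData V}
    {M : Type u₂} [AddCommGroup M] [Module ℂ M] (T : WeakModule A M) (S : Submodule ℂ M) : Prop :=
  ∀ (v : V) (n : ℤ), ∀ w ∈ S, T.Y v n w ∈ S

/-! ## The tensor product of two vertex operator algebras -/

section Tensor

variable {V₁ : Type u₁} [AddCommGroup V₁] [Module ℂ V₁] {V₂ : Type u₂} [AddCommGroup V₂]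
  [Module ℂ V₂]

theorem tensor_support_finite (A : VertexData V₁) (B : VertexData V₂) (u a : V₁) (v b : V₂)
    (n : ℤ) : (Function.support fun i : ℤ => A.Y u i a ⊗ₜ[ℂ] B.Y v (n - 1 - i) b).Finite := by
  obtain ⟨N, hN⟩ := A.trunc u a
  obtain ⟨N', hN'⟩ := B.trunc v b
  refine (Set.finite_Icc (n - 1 - N') N).subset fun i hi => ?_
  rw [Function.mem_support] at hi
  refine ⟨?_, ?_⟩
  · by_contra h
    exact hi (by rw [hN' _ (by omega), TensorProduct.tmul_zero])
  · by_contra h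
    exact hi (by rw [hN _ (by omega), TensorProduct.zero_tmul])

/-- The coefficient of `x^(-n-1)` in `Y(u,x)a ⊗ Y(v,x)b`. -/
def tensorMode (A : VertexData V₁) (B : VertexData V₂) (n : ℤ) (u : V₁) (v : V₂) (a : V₁)
    (b : V₂) : V₁ ⊗[ℂ] V₂ :=
  ∑ᶠ i : ℤ, A.Y u i a ⊗ₜ[ℂ] B.Y v (n - 1 - i) b

/-- The bilinear map `(a, b) ↦ (u ⊗ v)_n (a ⊗ b)`. -/
def tensorModeBilin (A : VertexData V₁) (B : VertexData V₂) (n : ℤ) (u : V₁) (v : V₂) :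
    V₁ →ₗ[ℂ] V₂ →ₗ[ℂ] V₁ ⊗[ℂ] V₂ :=
  LinearMap.mk₂ ℂ (tensorMode A B n u v)
    (fun a a' b => by
      simp only [tensorMode]
      rw [← finsum_add_distrib (tensor_support_finite A B u a v b n)
        (tensor_support_finite A B u a' v b n)]
      simp only [map_add, TensorProduct.add_tmul])
    (fun c a b => by
      simp only [tensorMode]
      rw [smul_finsum' c (tensor_support_finite A B u a v b n)]
      simp only [map_smul, TensorProduct.smul_tmul'])
    (fun a b b' => by
      simp only [tensorMode]
      rw [← finsum_add_distrib (tensor_support_finite A B u a v b n)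
        (tensor_support_finite A B u a v b' n)]
      simp only [map_add, TensorProduct.tmul_add])
    (fun c a b => by
      simp only [tensorMode]
      rw [smul_finsum' c (tensor_support_finite A B u a v b n)]
      simp only [map_smul, TensorProduct.tmul_smul])

/-- The linear map `u ⊗ v ↦ (u ⊗ v)_n`. -/
def tensorModeHom (A : VertexData V₁) (B : VertexData V₂) (n : ℤ) :
    V₁ ⊗[ℂ] V₂ →ₗ[ℂ] Module.End ℂ (V₁ ⊗[ℂ] V₂) :=
  TensorProduct.lift <| LinearMap.mk₂ ℂ
    (fun u v => TensorProduct.lift (tensorModeBilin A B n u v))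
    (fun u u' v => by
      refine TensorProduct.ext' fun a b => ?_
      simp only [LinearMap.add_apply, TensorProduct.lift.tmul, tensorModeBilin,
        LinearMap.mk₂_apply, tensorMode]
      rw [← finsum_add_distrib (tensor_support_finite A B u a v b n)
        (tensor_support_finite A B u' a v b n)]
      simp only [map_add, Pi.add_apply, LinearMap.add_apply, TensorProduct.add_tmul])
    (fun c u v => by
      refine TensorProduct.ext' fun a b => ?_
      simp only [LinearMap.smul_apply, TensorProduct.lift.tmul, tensorModeBilin,
        LinearMap.mk₂_apply, tensorMode]
      rw [smul_finsum' c (tensor_support_finite A B u a v b n)]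
      simp only [map_smul, Pi.smul_apply, LinearMap.smul_apply, TensorProduct.smul_tmul'])
    (fun u v v' => by
      refine TensorProduct.ext' fun a b => ?_
      simp only [LinearMap.add_apply, TensorProduct.lift.tmul, tensorModeBilin,
        LinearMap.mk₂_apply, tensorMode]
      rw [← finsum_add_distrib (tensor_support_finite A B u a v b n)
        (tensor_support_finite A B u a v' b n)]
      simp only [map_add, Pi.add_apply, LinearMap.add_apply, TensorProduct.tmul_add])
    (fun c u v => by
      refine TensorProduct.ext' fun a b => ?_
      simp only [LinearMap.smul_apply, TensorProduct.lift.tmul, tensorModeBilin,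
        LinearMap.mk₂_apply, tensorMode]
      rw [smul_finsum' c (tensor_support_finite A B u a v b n)]
      simp only [map_smul, Pi.smul_apply, LinearMap.smul_apply, TensorProduct.tmul_smul])

theorem tensorModeHom_tmul (A : VertexData V₁) (B : VertexData V₂) (n : ℤ) (u a : V₁)
    (v b : V₂) : tensorModeHom A B n (u ⊗ₜ v) (a ⊗ₜ b) =
      ∑ᶠ i : ℤ, A.Y u i a ⊗ₜ[ℂ] B.Y v (n - 1 - i) b := rfl

theorem tensor_trunc (A : VertexData V₁) (B : VertexData V₂) (s t : V₁ ⊗[ℂ] V₂) :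
    ∃ N : ℤ, ∀ n : ℤ, N ≤ n → tensorModeHom A B n s t = 0 := by
  induction s using TensorProduct.induction_on with
  | zero => exact ⟨0, fun n _ => by simp⟩
  | add s s' hs hs' =>
    obtain ⟨N, hN⟩ := hs
    obtain ⟨N', hN'⟩ := hs'
    refine ⟨max N N', fun n hn => ?_⟩
    rw [map_add, LinearMap.add_apply, hN n (by omega), hN' n (by omega), add_zero]
  | tmul u v =>
    induction t using TensorProduct.induction_on with
    | zero => exact ⟨0, fun n _ => by simp⟩
    | add t t' ht ht' =>
      obtain ⟨N, hN⟩ := ht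
      obtain ⟨N', hN'⟩ := ht'
      refine ⟨max N N', fun n hn => ?_⟩
      rw [map_add, hN n (by omega), hN' n (by omega), add_zero]
    | tmul a b =>
      obtain ⟨N, hN⟩ := A.trunc u a
      obtain ⟨N', hN'⟩ := B.trunc v b
      refine ⟨N + N' + 1, fun n hn => ?_⟩
      rw [tensorModeHom_tmul]
      refine finsum_eq_zero_of_forall_eq_zero fun i => ?_
      rcases le_or_gt N i with h | h
      · rw [hN i h, TensorProduct.zero_tmul]
      · rw [hN' (n - 1 - i) (by omega), TensorProduct.tmul_zero]

/-- The tensor product: `Y(u ⊗ v, x) = Y(u,x) ⊗ Y(v,x)`, vacuum `1 ⊗ 1`, Virasoro element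
`ω ⊗ 1 + 1 ⊗ ω`, and the total grading. -/
def VertexData.tensor (A : VertexData V₁) (B : VertexData V₂) : VertexData (V₁ ⊗[ℂ] V₂) where
  Y := LinearMap.pi fun n => tensorModeHom A B n
  vac := A.vac ⊗ₜ B.vac
  conf := A.conf ⊗ₜ B.vac + A.vac ⊗ₜ B.conf
  rank := A.rank + B.rank
  grade := fun n => ⨆ p : ℤ, Submodule.map₂ (TensorProduct.mk ℂ V₁ V₂) (A.grade p)
    (B.grade (n - p))
  trunc := tensor_trunc A B

end Tensor

/-! ## The weak module `E ⊗ W` with action on the second factor -/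

section LeftTensor

variable {V : Type u₁} [AddCommGroup V] [Module ℂ V] {A : VertexData V}

theorem finite_support_of_le {M : Type u₂} [AddCommGroup M] {g : ℕ → M} (N : ℤ)
    (h : ∀ i : ℕ, N ≤ i → g i = 0) : (Function.support g).Finite := by
  refine (Set.finite_Iio N.toNat).subset fun i hi => ?_
  by_contra hlt
  rw [Set.mem_Iio, not_lt] at hlt
  exact hi (h i (by omega))

theorem jacobiLHS_support {M : Type u₂} [AddCommGroup M] [Module ℂ M] (A : VertexData V)
    (Y : V →ₗ[ℂ] ℤ → Module.End ℂ M) (u v : V) (l m n : ℤ) (w : M) :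
    (Function.support fun i : ℕ =>
      ((Ring.choose m i : ℤ) : ℂ) • Y (A.Y u (l + i) v) (m + n - i) w).Finite := by
  obtain ⟨N, hN⟩ := A.trunc u v
  refine finite_support_of_le (N - l) fun i hi => ?_
  rw [hN _ (by omega)]
  simp

theorem jacobiRHS_support {M : Type u₂} [AddCommGroup M] [Module ℂ M]
    (Y : V →ₗ[ℂ] ℤ → Module.End ℂ M)
    (hY : ∀ (v : V) (w : M), ∃ N : ℤ, ∀ n : ℤ, N ≤ n → Y v n w = 0) (u v : V) (l m n : ℤ) (w : M) :
    (Function.support fun i : ℕ => ((-1 : ℂ) ^ i * ((Ring.choose l i : ℤ) : ℂ)) •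
      (Y u (m + l - i) (Y v (n + i) w) -
        ((-1 : ℂ) ^ l) • Y v (n + l - i) (Y u (m + i) w))).Finite := by
  obtain ⟨N, hN⟩ := hY v w
  obtain ⟨N', hN'⟩ := hY u w
  refine finite_support_of_le (max (N - n) (N' - m)) fun i hi => ?_
  rw [hN _ (by omega), hN' _ (by omega)]
  simp

/-- The modes of `v` on `E ⊗ W`. -/
def leftTensorY (E : Type u₃) [AddCommGroup E] [Module ℂ E] {W : Type u₂} [AddCommGroup W]
    [Module ℂ W] (Y : V →ₗ[ℂ] ℤ → Module.End ℂ W) : V →ₗ[ℂ] ℤ → Module.End ℂ (E ⊗[ℂ] W) :=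
  LinearMap.pi fun n => (LinearMap.lTensorHom E) ∘ₗ (LinearMap.proj n ∘ₗ Y)

theorem leftTensorY_tmul (E : Type u₃) [AddCommGroup E] [Module ℂ E] {W : Type u₂}
    [AddCommGroup W] [Module ℂ W] (Y : V →ₗ[ℂ] ℤ → Module.End ℂ W) (v : V) (n : ℤ) (e : E)
    (w : W) : leftTensorY E Y v n (e ⊗ₜ w) = e ⊗ₜ Y v n w := rfl

theorem leftTensorY_trunc (E : Type u₃) [AddCommGroup E] [Module ℂ E] {W : Type u₂}
    [AddCommGroup W] [Module ℂ W] (M : WeakModule A W) (v : V) (t : E ⊗[ℂ] W) :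
    ∃ N : ℤ, ∀ n : ℤ, N ≤ n → leftTensorY E M.Y v n t = 0 := by
  induction t using TensorProduct.induction_on with
  | zero => exact ⟨0, fun n _ => by simp⟩
  | add t t' ht ht' =>
    obtain ⟨N, hN⟩ := ht
    obtain ⟨N', hN'⟩ := ht'
    refine ⟨max N N', fun n hn => ?_⟩
    rw [map_add, hN n (by omega), hN' n (by omega), add_zero]
  | tmul e w =>
    obtain ⟨N, hN⟩ := M.trunc v w
    exact ⟨N, fun n hn => by rw [leftTensorY_tmul, hN n hn, TensorProduct.tmul_zero]⟩

/-- For a vector space `E` and a weak module `W`, the weak module `E ⊗ W` on which the algebra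
acts through `W`: `Y(v,x)(e ⊗ w) = e ⊗ Y(v,x)w`. -/
def WeakModule.leftTensor (E : Type u₃) [AddCommGroup E] [Module ℂ E] {W : Type u₂}
    [AddCommGroup W] [Module ℂ W] (M : WeakModule A W) : WeakModule A (E ⊗[ℂ] W) where
  Y := leftTensorY E M.Y
  trunc := leftTensorY_trunc E M
  vacuum := fun n t => by
    induction t using TensorProduct.induction_on with
    | zero => simp
    | add t t' ht ht' => rw [map_add, ht, ht']; split_ifs <;> simp
    | tmul e w => rw [leftTensorY_tmul, M.vacuum]; split_ifs <;> simp
  jacobi := fun u v l m n t => by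
    induction t using TensorProduct.induction_on with
    | zero => simp [jacobiLHS, jacobiRHS]
    | add t t' ht ht' =>
      have h1 : jacobiLHS A (leftTensorY E M.Y) u v l m n (t + t') =
          jacobiLHS A (leftTensorY E M.Y) u v l m n t +
            jacobiLHS A (leftTensorY E M.Y) u v l m n t' := by
        unfold jacobiLHS
        rw [← finsum_add_distrib (jacobiLHS_support A _ u v l m n t)
          (jacobiLHS_support A _ u v l m n t')]
        simp only [map_add, smul_add]
      have h2 : jacobiRHS (leftTensorY E M.Y) u v l m n (t + t') =
          jacobiRHS (leftTensorY E M.Y) u v l m n t +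
            jacobiRHS (leftTensorY E M.Y) u v l m n t' := by
        unfold jacobiRHS
        rw [← finsum_add_distrib
          (jacobiRHS_support _ (leftTensorY_trunc E M) u v l m n t)
          (jacobiRHS_support _ (leftTensorY_trunc E M) u v l m n t')]
        refine finsum_congr fun i => ?_
        simp only [map_add, smul_add, smul_sub]
        abel
      rw [h1, h2, ht, ht']
    | tmul e w =>
      have h := congrArg (TensorProduct.mk ℂ E W e) (M.jacobi u v l m n w)
      have h1 : jacobiLHS A (leftTensorY E M.Y) u v l m n (e ⊗ₜ w) =
          TensorProduct.mk ℂ E W e (jacobiLHS A M.Y u v l m n w) := by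
        unfold jacobiLHS
        rw [map_finsum _ (jacobiLHS_support A M.Y u v l m n w)]
        simp only [leftTensorY_tmul, map_smul, TensorProduct.mk_apply]
      have h2 : jacobiRHS (leftTensorY E M.Y) u v l m n (e ⊗ₜ w) =
          TensorProduct.mk ℂ E W e (jacobiRHS M.Y u v l m n w) := by
        unfold jacobiRHS
        rw [map_finsum _ (jacobiRHS_support M.Y M.trunc u v l m n w)]
        simp only [leftTensorY_tmul, map_smul, map_sub, TensorProduct.mk_apply]
      rw [h1, h2, h]
  virasoro := fun m n t => by
    induction t using TensorProduct.induction_on with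
    | zero => simp
    | add t t' ht ht' =>
      simp only [map_add, smul_add]
      rw [add_sub_add_comm, ht, ht']
      abel
    | tmul e w =>
      simp only [leftTensorY_tmul]
      rw [← TensorProduct.tmul_sub, M.virasoro m n w, TensorProduct.tmul_add,
        TensorProduct.tmul_smul, TensorProduct.tmul_smul]
  deriv := fun v n t => by
    induction t using TensorProduct.induction_on with
    | zero => simp
    | add t t' ht ht' => rw [map_add, map_add, smul_add, ht, ht']
    | tmul e w => rw [leftTensorY_tmul, leftTensorY_tmul, M.deriv, TensorProduct.tmul_smul]

end LeftTensor

/-! ## Formal series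

An element `∑ G_e x^e` of `U[[x, x⁻¹]]` is recorded by its coefficients, a function
`G : ℤ → U`. -/

section Series

variable {U : Type u₁} [AddCommGroup U] [Module ℂ U]

/-- The product `(x - a)^k G(x)` with `(x - a)^k = ∑_{i ≥ 0} (k choose i) (-a)^i x^(k-i)`. It is
used for `k ≥ 0`, or for `G ∈ U((x⁻¹))`, when the sum is finite. -/
def mulAtInfty (a : ℂ) (k : ℤ) (G : ℤ → U) (e : ℤ) : U :=
  ∑ᶠ i : ℕ, (((Ring.choose k i : ℤ) : ℂ) * (-a) ^ i) • G (e - k + i)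

/-- The product `(-a + x)^k G(x)` with `(-a + x)^k = ∑_{i ≥ 0} (k choose i) (-a)^(k-i) x^i`, for
`a ≠ 0`. It is used for `G ∈ U((x))`, when the sum is finite. -/
def mulAtZero (a : ℂ) (k : ℤ) (G : ℤ → U) (e : ℤ) : U :=
  ∑ᶠ i : ℕ, (((Ring.choose k i : ℤ) : ℂ) * (-a) ^ (k - i)) • G (e - i)

/-- The series `G(x + a)`, obtained from `G(y)` by
`y^j = (x + a)^j = ∑_{i ≥ 0} (j choose i) a^i x^(j-i)`. It is used for `G ∈ U((x⁻¹))`, when the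
sum is finite. -/
def translate (a : ℂ) (G : ℤ → U) (e : ℤ) : U :=
  ∑ᶠ i : ℕ, (((Ring.choose (e + i) i : ℤ) : ℂ) * a ^ i) • G (e + i)

/-- The product `x^l G(x)`. -/
def mulX (l : ℤ) (G : ℤ → U) (e : ℤ) : U := G (e - l)

/-- The series `G(x)` lies in `U[x]`. -/
def IsPolynomial (G : ℤ → U) : Prop :=
  (∀ e : ℤ, e < 0 → G e = 0) ∧ (Function.support G).Finite

theorem IsPolynomial.add {G H : ℤ → U} (hG : IsPolynomial G) (hH : IsPolynomial H) :
    IsPolynomial fun e => G e + H e :=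
  ⟨fun e he => by simp only [hG.1 e he, hH.1 e he, add_zero],
    (hG.2.union hH.2).subset (Function.support_add G H)⟩

theorem IsPolynomial.smul {G : ℤ → U} (c : ℂ) (hG : IsPolynomial G) :
    IsPolynomial fun e => c • G e :=
  ⟨fun e he => by simp only [hG.1 e he, smul_zero],
    hG.2.subset (Function.support_const_smul_subset c G)⟩

theorem IsPolynomial.mulX {U : Type u₁} [AddCommGroup U] {G : ℤ → U} (hG : IsPolynomial G) (l : ℕ) :
    IsPolynomial (mulX (l : ℤ) G) :=
  ⟨fun e he => hG.1 _ (by omega),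
    hG.2.preimage (f := fun e : ℤ => e - l) (fun _ _ _ _ h => sub_left_injective h)⟩

theorem mulAtInfty_support (a : ℂ) (k : ℕ) (G : ℤ → U) (e : ℤ) :
    (Function.support fun i : ℕ =>
      (((Ring.choose (k : ℤ) i : ℤ) : ℂ) * (-a) ^ i) • G (e - k + i)).Finite := by
  refine finite_support_of_le (k + 1) fun i hi => ?_
  rw [Ring.choose_natCast, Nat.choose_eq_zero_of_lt (by omega)]
  simp

theorem mulAtInfty_add (a : ℂ) (k : ℕ) (G H : ℤ → U) (e : ℤ) :
    mulAtInfty a k (fun j => G j + H j) e = mulAtInfty a k G e + mulAtInfty a k H e := by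
  unfold mulAtInfty
  rw [← finsum_add_distrib (mulAtInfty_support a k G e) (mulAtInfty_support a k H e)]
  simp only [smul_add]

theorem mulAtInfty_smul (a c : ℂ) (k : ℕ) (G : ℤ → U) (e : ℤ) :
    mulAtInfty a k (fun j => c • G j) e = c • mulAtInfty a k G e := by
  unfold mulAtInfty
  rw [smul_finsum' c (mulAtInfty_support a k G e)]
  simp only [smul_comm c]

theorem mulAtInfty_eq_sum (a : ℂ) (k m : ℕ) (hm : k < m) (G : ℤ → U) (e : ℤ) :
    mulAtInfty a k G e =
      ∑ i ∈ Finset.range m, (((k.choose i : ℕ) : ℂ) * (-a) ^ i) • G (e - k + i) := by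
  unfold mulAtInfty
  rw [finsum_eq_sum_of_support_subset (s := Finset.range m)]
  · simp only [Ring.choose_natCast, Int.cast_natCast]
  · intro i hi
    by_contra h
    simp only [Finset.coe_range, Set.mem_Iio, not_lt] at h
    refine hi ?_
    simp only [Ring.choose_natCast, Nat.choose_eq_zero_of_lt (show k < i by omega)]
    simp

theorem mulAtInfty_succ (a : ℂ) (k : ℕ) (G : ℤ → U) (e : ℤ) :
    mulAtInfty a ((k + 1 : ℕ) : ℤ) G e =
      mulAtInfty a k G (e - 1) + (-a) • mulAtInfty a k G e := by
  rw [mulAtInfty_eq_sum a (k + 1) (k + 2) (by omega),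
    mulAtInfty_eq_sum a k (k + 2) (by omega), mulAtInfty_eq_sum a k (k + 1) (by omega),
    Finset.sum_range_succ', Finset.sum_range_succ' _ (k + 1), Finset.smul_sum,
    add_right_comm, ← Finset.sum_add_distrib]
  congr 1
  · refine Finset.sum_congr rfl fun i _ => ?_
    have h1 : e - ((k + 1 : ℕ) : ℤ) + ((i + 1 : ℕ) : ℤ) = e - k + i := by push_cast; ring
    have h2 : e - 1 - (k : ℤ) + ((i + 1 : ℕ) : ℤ) = e - k + i := by push_cast; ring
    rw [h1, h2, Nat.choose_succ_succ, smul_smul, ← add_smul]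
    congr 1
    push_cast
    ring
  · have h : e - ((k + 1 : ℕ) : ℤ) + ((0 : ℕ) : ℤ) = e - 1 - k + ((0 : ℕ) : ℤ) := by
      push_cast; ring
    rw [h]
    simp

theorem isPolynomial_mono {a : ℂ} {k l : ℕ} {G : ℤ → U}
    (h : IsPolynomial (mulX (l : ℤ) (mulAtInfty a k G))) (p q : ℕ) :
    IsPolynomial (mulX ((l + q : ℕ) : ℤ) (mulAtInfty a ((k + p : ℕ) : ℤ) G)) := by
  have h1 : IsPolynomial (mulX (l : ℤ) (mulAtInfty a ((k + p : ℕ) : ℤ) G)) := by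
    induction p with
    | zero => exact h
    | succ p ih =>
      have h2 := (ih.mulX 1).add (ih.smul (-a))
      have h3 : (mulX (l : ℤ) (mulAtInfty a ((k + (p + 1) : ℕ) : ℤ) G)) = fun e =>
          mulX ((1 : ℕ) : ℤ) (mulX (l : ℤ) (mulAtInfty a ((k + p : ℕ) : ℤ) G)) e +
            (-a) • mulX (l : ℤ) (mulAtInfty a ((k + p : ℕ) : ℤ) G) e := by
        funext e
        simp only [RegularRep.mulX]
        rw [← add_assoc, mulAtInfty_succ, sub_right_comm]
        simp
      rw [h3]
      exact h2
  have h2 := h1.mulX q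
  have h3 : mulX ((l + q : ℕ) : ℤ) (mulAtInfty a ((k + p : ℕ) : ℤ) G) =
      mulX (q : ℤ) (mulX (l : ℤ) (mulAtInfty a ((k + p : ℕ) : ℤ) G)) := by
    funext e
    simp only [RegularRep.mulX]
    congr 1
    push_cast
    ring
  rw [h3]
  exact h2

end Series

/-! ## The operators `Yᵒ(v,x)` -/

section Regular

variable {V : Type u₁} [AddCommGroup V] [Module ℂ V] (A : VertexOperatorAlgebra V)

/-- The projection of `V` onto its weight space of weight `h`. -/
def VertexOperatorAlgebra.component (h : ℤ) : V →ₗ[ℂ] V :=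
  (A.grade h).subtype ∘ₗ DirectSum.component ℂ ℤ (fun n => A.grade n) h ∘ₗ
    (LinearEquiv.ofBijective (DirectSum.coeLinearMap A.grade) A.internal).symm.toLinearMap

variable {A} {W : Type u₂} [AddCommGroup W] [Module ℂ W] (M : WeakModule A.toVertexData W)

/-- The coefficient of `x^e` in `Yᵒ(v,x)w = Y(e^{xL(1)} (-x⁻²)^{L(0)} v, x⁻¹)w`. For `v` of
weight `h` the series is `∑_{i ≥ 0} ((-1)^h / i!) x^(i-2h) Y(L(1)^i v, x⁻¹)w`, with
`Y(a, x⁻¹)w = ∑_m x^(m+1) a_m w` and `L(1) = ω_2`. -/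
def oppositeCoeff (v : V) (e : ℤ) (w : W) : W :=
  ∑ᶠ h : ℤ, ∑ᶠ i : ℕ, ((-1 : ℂ) ^ h / (i.factorial : ℂ)) •
    M.Y ((A.Y A.conf 2 ^ i) (A.component h v)) (e - i + 2 * h - 1) w

variable (z : ℂ) (U : Type u₃) [AddCommGroup U] [Module ℂ U]

/-- The space `D_{P(z)}(W,U)`: the linear maps `f : W → U` such that for each `v` there are
`k, l ∈ ℕ` with `(x-z)^k x^l ⟨u*, f Yᵒ(v,x)w⟩ ∈ ℂ[x]` for all `u* ∈ U*` and `w ∈ W`. -/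
def regularSpace : Submodule ℂ (W →ₗ[ℂ] U) where
  carrier := {f | ∀ v : V, ∃ k l : ℕ, ∀ (φ : Module.Dual ℂ U) (w : W),
    IsPolynomial (mulX (l : ℤ) (mulAtInfty z k fun e => φ (f (oppositeCoeff M v e w))))}
  add_mem' := by
    intro f g hf hg v
    obtain ⟨k, l, h⟩ := hf v
    obtain ⟨k', l', h'⟩ := hg v
    refine ⟨k + k', l + l', fun φ w => ?_⟩
    have h1 := isPolynomial_mono (h φ w) k' l'
    have h2 := isPolynomial_mono (h' φ w) k l
    rw [Nat.add_comm k' k, Nat.add_comm l' l] at h2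
    have h3 := h1.add h2
    simp only [mulX, ← mulAtInfty_add] at h3
    simp only [LinearMap.add_apply, map_add]
    exact h3
  zero_mem' := by
    intro v
    refine ⟨0, 0, fun φ w => ?_⟩
    have h : (mulX ((0 : ℕ) : ℤ) (mulAtInfty z ((0 : ℕ) : ℤ) fun e =>
        φ ((0 : W →ₗ[ℂ] U) (oppositeCoeff M v e w)))) = fun _ => 0 := by
      funext e
      simp [mulX, mulAtInfty]
    rw [h]
    exact ⟨fun _ _ => rfl, by simp⟩
  smul_mem' := by
    intro c f hf v
    obtain ⟨k, l, h⟩ := hf v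
    refine ⟨k, l, fun φ w => ?_⟩
    have h3 := (h φ w).smul c
    simp only [mulX, ← mulAtInfty_smul] at h3
    simp only [LinearMap.smul_apply, map_smul]
    exact h3

variable {U}

/-- The integers `k, l` satisfy `(x-z)^k x^l f Yᵒ(v,x)w ∈ U[x]` for each `w ∈ W`. -/
def Admissible (v : V) (f : W →ₗ[ℂ] U) (k l : ℤ) : Prop :=
  ∀ w : W, IsPolynomial (mulX l (mulAtInfty z k fun e => f (oppositeCoeff M v e w)))

/-- The maps `Y` are the modes of `Y^L_{P(z)}`: for each `v` and `f` and every pair of integers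
`k, l` as in `Admissible`,
`(Y^L(v,x)f)(w) = (z+x)^(-l) ((x+z)^l f(Yᵒ(v,x+z)w))`. Such a pair is required to exist. -/
def IsLeftAction (Y : V →ₗ[ℂ] ℤ → Module.End ℂ (regularSpace M z U)) : Prop :=
  ∀ (v : V) (f : regularSpace M z U),
    (∃ k l : ℤ, Admissible M z v f.1 k l) ∧
    ∀ k l : ℤ, Admissible M z v f.1 k l → ∀ (n : ℤ) (w : W),
      (Y v n f).1 w = mulAtZero (-z) (-l)
        (mulAtInfty (-z) l (translate z fun e => f.1 (oppositeCoeff M v e w))) (-n - 1)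

/-- The maps `Y` are the modes of `Y^R_{P(z)}`: for each `v` and `f` and every pair of integers
`k, l` as in `Admissible`, `(Y^R(v,x)f)(w) = (-z+x)^(-k) ((x-z)^k f(Yᵒ(v,x)w))`. Such a pair is
required to exist. -/
def IsRightAction (Y : V →ₗ[ℂ] ℤ → Module.End ℂ (regularSpace M z U)) : Prop :=
  ∀ (v : V) (f : regularSpace M z U),
    (∃ k l : ℤ, Admissible M z v f.1 k l) ∧
    ∀ k l : ℤ, Admissible M z v f.1 k l → ∀ (n : ℤ) (w : W),
      (Y v n f).1 w = mulAtZero z (-k)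
        (mulAtInfty z k fun e => f.1 (oppositeCoeff M v e w)) (-n - 1)

/-- The actions `YL` and `YR` of `V` commute: `YL(u,x₁) YR(v,x₂) = YR(v,x₂) YL(u,x₁)`. -/
def ActionsCommute {D : Type u₂} [AddCommGroup D] [Module ℂ D]
    (YL YR : V →ₗ[ℂ] ℤ → Module.End ℂ D) : Prop :=
  ∀ (u v : V) (m n : ℤ) (f : D), YL u m (YR v n f) = YR v n (YL u m f)

/-- `Y = YL ⊗ YR`, that is, `Y(u ⊗ v, x) = YL(u,x) YR(v,x)`; the sum that gives the coefficient of
`x^(-n-1)`, applied to a vector, is required to be finite. -/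
def IsTensorAction {D : Type u₂} [AddCommGroup D] [Module ℂ D]
    (YL YR : V →ₗ[ℂ] ℤ → Module.End ℂ D) (Y : V ⊗[ℂ] V →ₗ[ℂ] ℤ → Module.End ℂ D) : Prop :=
  ∀ (u v : V) (n : ℤ) (f : D),
    (Function.support fun i : ℤ => YL u i (YR v (n - 1 - i) f)).Finite ∧
    Y (u ⊗ₜ v) n f = ∑ᶠ i : ℤ, YL u i (YR v (n - 1 - i) f)

end Regular

/-- The canonical map `η : Hom(W,U) → (U* ⊗ W)*`, `⟨η(f), u* ⊗ w⟩ = ⟨u*, f(w)⟩`. -/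
def eta (W : Type u₂) [AddCommGroup W] [Module ℂ W] (U : Type u₃) [AddCommGroup U] [Module ℂ U] :
    (W →ₗ[ℂ] U) →ₗ[ℂ] Module.Dual ℂ (Module.Dual ℂ U ⊗[ℂ] W) where
  toFun f := TensorProduct.lift (LinearMap.mk₂ ℂ (fun (φ : Module.Dual ℂ U) (w : W) => φ (f w))
    (by simp) (by simp) (by simp) (by simp))
  map_add' f g := TensorProduct.ext' fun φ w => by simp
  map_smul' c f := TensorProduct.ext' fun φ w => by simp

end RegularRep

end

/-!
The weak `V`-module structures on `D = D_{P(z)}(W,U)` come from residues. The field `ℂ((x⁻¹))`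
(`Lau`) contains the integral powers of `x - c` for each `c`, and `Yᵒ(v,x)w` has finitely many
positive powers of `x`, so that `Res p(x) Yᵒ(v,x)w` (`WeakModule.opp`) makes sense for each `p` in
this field. In these terms `f` lies in `D` if and only if, for each `v`, the functional `p ↦ Res
p(x) f(Yᵒ(v,x) ·)` vanishes on the polynomials with zeros of high order at `0` and `z` (`IsKilled`,
`mem_regularSpace_iff`). On the rational functions with poles only at `0` and `z` it is then a sum
of functionals supported at `0` and at `z`. Polynomials `e_N` congruent to `1` modulo `(x-c)^N` and
to `0` modulo `(x-c')^N`, where `{c, c'} = {0, z}`, isolate the part at `c`, and the modes of the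
action attached to `c` are the eventual values of `Res (x-c)^n e_N(x) f(Yᵒ(v,x) ·)` (`localAct`).
Comparison of `e_N` with `(x-c')^k` times a Taylor polynomial of `(x-c')^(-k)` at `c` shows that the
point `c = 0` gives `Y^R_{P(z)}` and the point `c = z` gives `Y^L_{P(z)}`
(`isRightAction_localModule`, `isLeftAction_localModule`).

The module axioms reduce to properties of the opposite vertex operators. These satisfy a Jacobi
identity with the order of the operators reversed (`oppJacobi`), which follows from the Jacobi
identity of `W` and the formula for `e^{xL(1)} u_k v` (`VertexOperatorAlgebra.divRaise_mode`). By
continuity, its cases `l = 0` and `l = -1` extend to arbitrary test functions in `ℂ((x⁻¹))`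
(`opp_commutator`, `opp_normal`). Since `e_N² - e_N` and the derivatives of `e_N` vanish to high
order at both points, test functions `(x-c)^n e_N` turn them into the commutator formula and the
formula for `(u_{-1}v)_n`, which imply the Jacobi identity (`jacobi_of_comm_of_normal`). The two
actions commute because the product of `e_N` for `(c, c')` and `e_N` for `(c', c)` vanishes to high
order at both points (`actionsCommute_localModule`).

The product of two commuting actions is a module for the tensor product of the algebras
(`tensorModule`): locality is inherited from the factors, the formula for the modes of `(u ⊗ v)_l
(u' ⊗ v')` follows from those of the factors by the Leibniz rule, and the two together give the
Jacobi identity (`jacobi_of_locality`).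

Finally `η` is injective and carries `f(Yᵒ(v,x) ·)` to `η(f)(Yᵒ(v,x) ·)`. So it preserves and
reflects the condition that defines `D` (`isKilled_eta`), and it intertwines the actions once the
same polynomials `e_N` are used for `W` and for `U* ⊗ W` (`localAct_eta`).
-/

namespace RegularRep

noncomputable section

universe u₁ u₂ u₃

/-! ### Binomial coefficients -/

/-- The generalized binomial coefficient `m choose i`, as a complex number. -/
abbrev binom (m : ℤ) (i : ℕ) : ℂ := ((Ring.choose m i : ℤ) : ℂ)

theorem binom_zero_right (m : ℤ) : binom m 0 = 1 := by
  simp [binom]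

theorem binom_succ_succ (m : ℤ) (i : ℕ) : binom (m + 1) (i + 1) = binom m i + binom m (i + 1) := by
  simp only [binom]
  rw [Ring.choose_succ_succ, Int.cast_add]

theorem binom_natCast (n i : ℕ) : binom (n : ℤ) i = (n.choose i : ℂ) := by
  simp [binom, Ring.choose_natCast]

theorem binom_zero_left (i : ℕ) : binom 0 i = if i = 0 then 1 else 0 := by
  simp only [binom]
  rw [Ring.choose_zero_ite]
  split_ifs <;> simp

theorem binom_one_right (m : ℤ) : binom m 1 = m := by
  simp [binom]

theorem binom_neg (m : ℤ) (i : ℕ) : binom (-m) i = (-1) ^ i * binom (m + i - 1) i := by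
  simp only [binom]
  rw [Ring.choose_neg, Int.negOnePow_def, Units.smul_def]
  simp

theorem binom_neg_one (i : ℕ) : binom (-1) i = (-1) ^ i := by
  rw [binom_neg, show (1 : ℤ) + i - 1 = (i : ℕ) by ring, binom_natCast]
  simp

/-- The absorption identity `(i + 1) (m choose i + 1) = m (m - 1 choose i)`. -/
theorem succ_mul_binom_succ' (m : ℤ) (i : ℕ) :
    ((i : ℂ) + 1) * binom m (i + 1) = m * binom (m - 1) i := by
  have h := Ring.choose_smul_choose m (show 1 ≤ i + 1 by omega)
  rw [Nat.choose_one_right, Ring.choose_one_right] at h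
  simp only [binom]
  have h2 := congrArg (Int.cast : ℤ → ℂ) h
  push_cast at h2
  simp only [nsmul_eq_mul] at h2
  push_cast at h2
  exact h2

/-- The absorption identity `(i + 1) (m choose i + 1) = (m - i) (m choose i)`. -/
theorem succ_mul_binom_succ (m : ℤ) (i : ℕ) :
    ((i : ℂ) + 1) * binom m (i + 1) = (m - i) * binom m i := by
  have h := Ring.choose_smul_choose m (show i ≤ i + 1 by omega)
  rw [Nat.choose_succ_self_right] at h
  have h2 := congrArg (Int.cast : ℤ → ℂ) h
  simp only [nsmul_eq_mul, Nat.add_sub_cancel_left, Ring.choose_one_right] at h2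
  push_cast at h2
  simp only [binom]
  rw [h2]
  ring

theorem binom_sub_mul (m : ℤ) (i : ℕ) : binom m i * (m - i) = m * binom (m - 1) i := by
  rw [← succ_mul_binom_succ', succ_mul_binom_succ]
  ring

/-- The Chu–Vandermonde identity. -/
theorem binom_add (m n : ℤ) (k : ℕ) :
    binom (m + n) k = ∑ p ∈ Finset.HasAntidiagonal.antidiagonal k, binom m p.1 * binom n p.2 := by
  simp only [binom]
  rw [Ring.add_choose_eq k (Commute.all m n)]
  push_cast
  rfl

/-- A form of the Chu–Vandermonde identity,
`∑_{i+d=j} (-1)^i (m choose i) (N-i choose d) = (N-m choose j)`. -/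
theorem sum_binom_mul_binom_sub (m N : ℤ) (j : ℕ) :
    ∑ p ∈ Finset.HasAntidiagonal.antidiagonal j, (-1) ^ p.1 * binom m p.1 * binom (N - p.1) p.2 =
      binom (N - m) j := by
  rw [show N - m = -(m - N) by ring, binom_neg, show m - N + j - 1 = m + (j - N - 1) by ring,
    binom_add, Finset.mul_sum]
  refine Finset.sum_congr rfl fun p hp => ?_
  have hp' : p.1 + p.2 = j := Finset.HasAntidiagonal.mem_antidiagonal.1 hp
  rw [show N - (p.1 : ℤ) = -(p.1 - N) by ring, binom_neg,
    show (p.1 : ℤ) - N + p.2 - 1 = j - N - 1 by rw [← hp']; push_cast; ring, ← hp', pow_add]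
  ring

/-! ### One half of the Jacobi identity

`∑_{i ≥ 0} (-1)^i (l choose i) a(m+l-i, n+i)` is the coefficient extracted from
`(x₁ - x₂)^l ∑ a(m,n) x₁^(-m-1) x₂^(-n-1)` when `(x₁ - x₂)^l` is expanded in nonnegative powers
of `x₂`. -/

section Half

variable {X : Type u₂} [AddCommGroup X] [Module ℂ X]

/-- The sum `∑_{i ≥ 0} (-1)^i (l choose i) a(m+l-i, n+i)`. -/
def halfSum (a : ℤ → ℤ → X) (l m n : ℤ) : X :=
  ∑ᶠ i : ℕ, ((-1 : ℂ) ^ i * binom l i) • a (m + l - i) (n + i)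

/-- The family `a(m,n)` vanishes for `n ≥ N`. -/
def TruncSnd (N : ℤ) (a : ℤ → ℤ → X) : Prop := ∀ m n, N ≤ n → a m n = 0

theorem halfSum_eq_sum {a : ℤ → ℤ → X} {N : ℤ} (ha : TruncSnd N a) (l m n : ℤ) {K : ℕ}
    (hK : N ≤ n + K) :
    halfSum a l m n =
      ∑ i ∈ Finset.range K, ((-1 : ℂ) ^ i * binom l i) • a (m + l - i) (n + i) := by
  refine finsum_eq_sum_of_support_subset _ fun i hi => ?_
  rw [Finset.coe_range, Set.mem_Iio]
  by_contra h
  exact hi (by dsimp only; rw [ha _ _ (by omega), smul_zero])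

theorem halfSum_support {a : ℤ → ℤ → X} {N : ℤ} (ha : TruncSnd N a) (l m n : ℤ) :
    (Function.support fun i : ℕ => ((-1 : ℂ) ^ i * binom l i) • a (m + l - i) (n + i)).Finite :=
  finite_support_of_le (N - n) fun i hi => by rw [ha _ _ (by omega), smul_zero]

theorem halfSum_zero (a : ℤ → ℤ → X) (m n : ℤ) : halfSum a 0 m n = a m n := by
  unfold halfSum
  rw [finsum_eq_single _ 0]
  · simp [binom_zero_left]
  · intro i hi
    simp [binom_zero_left, hi]

/-- Multiplication by `x₁ - x₂`. -/
theorem halfSum_succ {a : ℤ → ℤ → X} {N : ℤ} (ha : TruncSnd N a) (l m n : ℤ) :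
    halfSum a (l + 1) m n = halfSum a l (m + 1) n - halfSum a l m (n + 1) := by
  obtain ⟨K, hK⟩ : ∃ K : ℕ, N ≤ n + K := ⟨(N - n).toNat, by omega⟩
  rw [halfSum_eq_sum ha (l + 1) m n (K := K + 1) (by push_cast; omega),
    halfSum_eq_sum ha l (m + 1) n (K := K + 1) (by push_cast; omega),
    halfSum_eq_sum ha l m (n + 1) (K := K) (by omega), Finset.sum_range_succ',
    Finset.sum_range_succ' _ K, add_sub_right_comm (∑ i ∈ _, _), ← Finset.sum_sub_distrib]
  congr 1
  · refine Finset.sum_congr rfl fun i _ => ?_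
    rw [show m + (l + 1) - ((i + 1 : ℕ) : ℤ) = m + l - i by push_cast; ring,
      show m + 1 + l - ((i + 1 : ℕ) : ℤ) = m + l - i by push_cast; ring,
      show n + ((i + 1 : ℕ) : ℤ) = n + 1 + i by push_cast; ring, ← sub_smul, binom_succ_succ]
    congr 1
    ring
  · rw [binom_zero_right, binom_zero_right, show m + (l + 1) = m + 1 + l by ring]

end Half

/-! ### Reduction of the Jacobi identity -/

section Jacobi

variable {V : Type u₁} [AddCommGroup V] [Module ℂ V] {A : VertexData V}
  {M : Type u₂} [AddCommGroup M] [Module ℂ M] {Y : V →ₗ[ℂ] ℤ → Module.End ℂ M}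

/-- The truncation condition for the modes `Y`. -/
def TruncModes (Y : V →ₗ[ℂ] ℤ → Module.End ℂ M) : Prop :=
  ∀ (v : V) (w : M), ∃ N : ℤ, ∀ n : ℤ, N ≤ n → Y v n w = 0

theorem TruncModes.exists_truncSnd (hY : TruncModes Y) (u v : V) (w : M) :
    ∃ N, TruncSnd N fun m n => Y u m (Y v n w) := by
  obtain ⟨N, hN⟩ := hY v w
  exact ⟨N, fun m n hn => by simp only [hN n hn, map_zero]⟩

theorem jacobiRHS_eq_halfSum (hY : TruncModes Y) (u v : V) (l m n : ℤ) (w : M) :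
    jacobiRHS Y u v l m n w = halfSum (fun p q => Y u p (Y v q w)) l m n -
      (-1 : ℂ) ^ l • halfSum (fun p q => Y v p (Y u q w)) l n m := by
  obtain ⟨N, hN⟩ := hY.exists_truncSnd u v w
  obtain ⟨N', hN'⟩ := hY.exists_truncSnd v u w
  unfold jacobiRHS halfSum
  rw [smul_finsum' _ (halfSum_support hN' l n m), ← finsum_sub_distrib (halfSum_support hN l m n)]
  · refine finsum_congr fun i => ?_
    rw [smul_sub, smul_comm ((-1 : ℂ) ^ l)]
  · refine (halfSum_support hN' l n m).subset (Function.support_const_smul_subset _ _)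

theorem jacobiRHS_succ (hY : TruncModes Y) (u v : V) (l m n : ℤ) (w : M) :
    jacobiRHS Y u v (l + 1) m n w =
      jacobiRHS Y u v l (m + 1) n w - jacobiRHS Y u v l m (n + 1) w := by
  obtain ⟨N, hN⟩ := hY.exists_truncSnd u v w
  obtain ⟨N', hN'⟩ := hY.exists_truncSnd v u w
  simp only [jacobiRHS_eq_halfSum hY]
  rw [halfSum_succ hN, halfSum_succ hN', zpow_add_one₀ (by norm_num)]
  module

theorem jacobiLHS_eq_sum (Y : V →ₗ[ℂ] ℤ → Module.End ℂ M) {u v : V} {N : ℤ}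
    (hN : ∀ n : ℤ, N ≤ n → A.Y u n v = 0) (l m n : ℤ) (w : M) {K : ℕ} (hK : N ≤ l + K) :
    jacobiLHS A Y u v l m n w =
      ∑ i ∈ Finset.range K, binom m i • Y (A.Y u (l + i) v) (m + n - i) w := by
  refine finsum_eq_sum_of_support_subset _ fun i hi => ?_
  rw [Finset.coe_range, Set.mem_Iio]
  by_contra h
  exact hi (by dsimp only; rw [hN _ (by omega)]; simp)

theorem jacobiLHS_succ (A : VertexData V) (Y : V →ₗ[ℂ] ℤ → Module.End ℂ M) (u v : V) (l m n : ℤ)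
    (w : M) :
    jacobiLHS A Y u v (l + 1) m n w =
      jacobiLHS A Y u v l (m + 1) n w - jacobiLHS A Y u v l m (n + 1) w := by
  obtain ⟨N, hN⟩ := A.trunc u v
  obtain ⟨K, hK⟩ : ∃ K : ℕ, N ≤ l + K := ⟨(N - l).toNat, by omega⟩
  rw [jacobiLHS_eq_sum Y hN (l + 1) m n w (K := K) (by omega),
    jacobiLHS_eq_sum Y hN l (m + 1) n w (K := K + 1) (by push_cast; omega),
    jacobiLHS_eq_sum Y hN l m (n + 1) w (K := K + 1) (by push_cast; omega),
    ← Finset.sum_sub_distrib, Finset.sum_range_succ', ← add_zero (∑ i ∈ _, _)]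
  congr 1
  · refine Finset.sum_congr rfl fun i _ => ?_
    rw [show l + 1 + (i : ℤ) = l + ((i + 1 : ℕ) : ℤ) by push_cast; ring,
      show m + 1 + n - ((i + 1 : ℕ) : ℤ) = m + n - i by push_cast; ring,
      show m + (n + 1) - ((i + 1 : ℕ) : ℤ) = m + n - i by push_cast; ring, ← sub_smul,
      binom_succ_succ]
    congr 1
    ring
  · rw [binom_zero_right, binom_zero_right, show m + 1 + n = m + (n + 1) by ring, sub_self]

theorem jacobiLHS_zero (A : VertexData V) (Y : V →ₗ[ℂ] ℤ → Module.End ℂ M) (u v : V) (l n : ℤ)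
    (w : M) : jacobiLHS A Y u v l 0 n w = Y (A.Y u l v) n w := by
  unfold jacobiLHS
  rw [finsum_eq_single _ 0]
  · simp
  · intro i hi
    have := binom_zero_left i
    simp only [binom, hi, if_false] at this
    rw [this, zero_smul]

/-- The Jacobi identity at `l` for the powers `m` follows from its case `m = 0` and from the
Jacobi identity at `l + 1`. -/
theorem jacobi_of_zero (hY : TruncModes Y) {u v : V} {l : ℤ} {w : M}
    (h0 : ∀ n, jacobiLHS A Y u v l 0 n w = jacobiRHS Y u v l 0 n w)
    (h1 : ∀ m n, jacobiLHS A Y u v (l + 1) m n w = jacobiRHS Y u v (l + 1) m n w) (m n : ℤ) :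
    jacobiLHS A Y u v l m n w = jacobiRHS Y u v l m n w := by
  have key : ∀ m n, jacobiLHS A Y u v l (m + 1) n w - jacobiLHS A Y u v l m (n + 1) w =
      jacobiRHS Y u v l (m + 1) n w - jacobiRHS Y u v l m (n + 1) w := fun m n => by
    rw [← jacobiLHS_succ, ← jacobiRHS_succ hY, h1]
  induction m using Int.induction_on generalizing n with
  | zero => exact h0 n
  | succ m ih =>
    have := key m n
    rw [ih] at this
    exact sub_left_injective this
  | pred m ih =>
    have := key (-m - 1) (n - 1)
    rw [sub_add_cancel, sub_add_cancel, ih] at this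
    exact sub_right_injective this

theorem jacobi_of_nonneg (hY : TruncModes Y) {u v : V} {w : M} {l : ℤ}
    (h : ∀ m n, jacobiLHS A Y u v l m n w = jacobiRHS Y u v l m n w) (k : ℕ) (m n : ℤ) :
    jacobiLHS A Y u v (l + k) m n w = jacobiRHS Y u v (l + k) m n w := by
  induction k generalizing m n with
  | zero => simpa using h m n
  | succ k ih =>
    rw [Nat.cast_succ, ← add_assoc, jacobiLHS_succ, jacobiRHS_succ hY, ih, ih]

/-- The right side of the Jacobi identity for `L(-1)u`: the derivative with respect to `x₁`. -/
theorem jacobiRHS_deriv (hY : TruncModes Y) {u u' v : V} (hu : ∀ n w, Y u' n w =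
    (-(n : ℂ)) • Y u (n - 1) w) (l n : ℤ) (w : M) :
    jacobiRHS Y u' v l 0 n w = (-(l : ℂ)) • jacobiRHS Y u v (l - 1) 0 n w := by
  have e1 : halfSum (fun p q => Y u' p (Y v q w)) l 0 n =
      (-(l : ℂ)) • halfSum (fun p q => Y u p (Y v q w)) (l - 1) 0 n := by
    obtain ⟨N, hN⟩ := hY.exists_truncSnd u v w
    unfold halfSum
    rw [smul_finsum' _ (halfSum_support hN (l - 1) 0 n)]
    refine finsum_congr fun i => ?_
    dsimp only
    rw [hu, smul_smul, smul_smul, show 0 + (l - 1) - (i : ℤ) = 0 + l - i - 1 by ring]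
    congr 1
    have := binom_sub_mul l i
    push_cast
    linear_combination (-(-1 : ℂ) ^ i) * this
  have e2 : halfSum (fun p q => Y v p (Y u' q w)) l n 0 =
      (l : ℂ) • halfSum (fun p q => Y v p (Y u q w)) (l - 1) n 0 := by
    obtain ⟨N, hN⟩ := hY.exists_truncSnd v u w
    obtain ⟨N', hN'⟩ := hY.exists_truncSnd v u' w
    obtain ⟨K, hK⟩ : ∃ K : ℕ, N ≤ K ∧ N' ≤ K := ⟨(max N N').toNat, by omega, by omega⟩
    rw [halfSum_eq_sum hN (l - 1) n 0 (K := K) (by omega),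
      halfSum_eq_sum hN' l n 0 (K := K + 1) (by push_cast; omega), Finset.sum_range_succ',
      Finset.smul_sum]
    simp only [hu, map_smul]
    rw [Nat.cast_zero, add_zero, Int.cast_zero, neg_zero, zero_smul, smul_zero, add_zero]
    refine Finset.sum_congr rfl fun i _ => ?_
    rw [smul_smul, smul_smul, show 0 + ((i + 1 : ℕ) : ℤ) - 1 = 0 + i by push_cast; ring,
      show n + l - ((i + 1 : ℕ) : ℤ) = n + (l - 1) - i by push_cast; ring]
    congr 1
    have := succ_mul_binom_succ' l i
    push_cast
    linear_combination ((-1 : ℂ) ^ i) * this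
  rw [jacobiRHS_eq_halfSum hY, jacobiRHS_eq_halfSum hY, e1, e2, zpow_sub_one₀ (by norm_num)]
  module

/-- The Jacobi identity follows from its cases `l = 0` (the commutator formula) and
`l = -1, m = 0` (the formula for `(u_{-1}v)_n`), as `L(-1)` lowers `l`. -/
theorem jacobi_of_comm_of_normal (hY : TruncModes Y)
    (dA : ∀ (u : V) (n : ℤ) (v : V), A.Y (A.Y A.conf 0 u) n v = (-(n : ℂ)) • A.Y u (n - 1) v)
    (dY : ∀ (u : V) (n : ℤ) (w : M), Y (A.Y A.conf 0 u) n w = (-(n : ℂ)) • Y u (n - 1) w)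
    (h0 : ∀ u v m n w, jacobiLHS A Y u v 0 m n w = jacobiRHS Y u v 0 m n w)
    (h1 : ∀ u v n w, jacobiLHS A Y u v (-1) 0 n w = jacobiRHS Y u v (-1) 0 n w)
    (u v : V) (l m n : ℤ) (w : M) :
    jacobiLHS A Y u v l m n w = jacobiRHS Y u v l m n w := by
  rcases le_or_gt 0 l with hl | hl
  · have := jacobi_of_nonneg hY (h0 u v · · w) l.toNat m n
    rwa [zero_add, Int.toNat_of_nonneg hl] at this
  · obtain ⟨k, rfl⟩ : ∃ k : ℕ, l = -1 - k := ⟨(-1 - l).toNat, by omega⟩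
    clear hl
    induction k generalizing u v m n w with
    | zero =>
      simp only [Nat.cast_zero, sub_zero]
      exact jacobi_of_zero hY (h1 u v · w) (by simpa using (h0 u v · · w)) m n
    | succ k ih =>
      refine jacobi_of_zero hY (fun n => ?_) (fun m n => ?_) m n
      · have h := ih (A.Y A.conf 0 u) v 0 n w
        rw [jacobiRHS_deriv hY (dY u), jacobiLHS_zero, dA, map_smul, Pi.smul_apply,
          LinearMap.smul_apply] at h
        have hk : (-(((-1 - k : ℤ)) : ℂ)) ≠ 0 := by
          push_cast
          have : ((k + 1 : ℕ) : ℂ) ≠ 0 := Nat.cast_ne_zero.2 (by omega)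
          intro h0
          apply this
          push_cast
          linear_combination h0
        rw [jacobiLHS_zero, show (-1 - ((k + 1 : ℕ) : ℤ)) = -1 - (k : ℤ) - 1 by push_cast; ring]
        exact smul_right_injective M hk h
      · have := ih u v m n w
        rwa [show (-1 - ((k + 1 : ℕ) : ℤ)) + 1 = -1 - (k : ℤ) by push_cast; ring]

end Jacobi

/-! ### Laurent series in `x⁻¹` -/

/-- The field `ℂ((t))`, where `t = x⁻¹`: the Laurent series at infinity in the variable `x`. It is
a type synonym, so that its `ℂ`-module structure is the one of its `ℂ`-algebra structure. -/
def Lau : Type := LaurentSeries ℂ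

instance : Field Lau := inferInstanceAs (Field (LaurentSeries ℂ))

instance : Algebra ℂ Lau := (HahnSeries.instAlgebra : Algebra ℂ (HahnSeries ℤ ℂ))

namespace Lau

/-- The coefficient of `t^n`. -/
def coeff (p : Lau) (n : ℤ) : ℂ := HahnSeries.coeff p n

/-- The monomial `a t^n`. -/
def single (n : ℤ) (a : ℂ) : Lau := (HahnSeries.single n a : HahnSeries ℤ ℂ)

/-- The least exponent of `t` in `p`. -/
def order (p : Lau) : ℤ := HahnSeries.order (p : HahnSeries ℤ ℂ)

theorem ext {p q : Lau} (h : ∀ n, p.coeff n = q.coeff n) : p = q := HahnSeries.ext (funext h)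

theorem coeff_zero (n : ℤ) : (0 : Lau).coeff n = 0 := rfl

theorem coeff_add (p q : Lau) (n : ℤ) : (p + q).coeff n = p.coeff n + q.coeff n := rfl

theorem coeff_sub (p q : Lau) (n : ℤ) : (p - q).coeff n = p.coeff n - q.coeff n := by
  rw [eq_sub_iff_add_eq, ← coeff_add, sub_add_cancel]

theorem coeff_smul (c : ℂ) (p : Lau) (n : ℤ) : (c • p).coeff n = c * p.coeff n := rfl

theorem coeff_sum {ι : Type*} (s : Finset ι) (p : ι → Lau) (n : ℤ) :
    (∑ i ∈ s, p i).coeff n = ∑ i ∈ s, (p i).coeff n :=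
  map_sum ({ toFun := fun p => p.coeff n, map_zero' := rfl, map_add' := fun _ _ => rfl } :
    Lau →+ ℂ) p s

/-- The coefficient of `t^n`, as a linear map. -/
def coeffLin (n : ℤ) : Lau →ₗ[ℂ] ℂ where
  toFun p := p.coeff n
  map_add' p q := coeff_add p q n
  map_smul' c p := coeff_smul c p n

theorem coeff_single_same (n : ℤ) (a : ℂ) : (single n a).coeff n = a :=
  HahnSeries.coeff_single_same _ _

theorem coeff_single (n m : ℤ) (a : ℂ) : (single n a).coeff m = if m = n then a else 0 := by
  split_ifs with h
  · rw [h]; exact HahnSeries.coeff_single_same _ _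
  · exact HahnSeries.coeff_single_of_ne h

theorem coeff_single_of_ne {n m : ℤ} (h : m ≠ n) (a : ℂ) : (single n a).coeff m = 0 :=
  HahnSeries.coeff_single_of_ne h

theorem single_add (n : ℤ) (a b : ℂ) : single n (a + b) = single n a + single n b :=
  ext fun m => by
    simp only [coeff_add, coeff_single]
    split_ifs <;> simp

theorem single_mul_single (n m : ℤ) (a b : ℂ) :
    single n a * single m b = single (n + m) (a * b) := HahnSeries.single_mul_single

theorem single_zero_one : single 0 1 = 1 := rfl

theorem single_zpow (n m : ℤ) : single n 1 ^ m = single (n * m) 1 := by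
  have h : ∀ k : ℤ, single 1 1 ^ k = single k 1 := fun k => (RatFunc.single_zpow k).symm
  rw [← h n, ← h (n * m), ← zpow_mul]

theorem order_mul {p q : Lau} (hp : p ≠ 0) (hq : q ≠ 0) : (p * q).order = p.order + q.order :=
  HahnSeries.order_mul hp hq

theorem order_one : (1 : Lau).order = 0 := HahnSeries.order_one

/-- The series with given coefficients. -/
def mk (f : ℤ → ℂ) (N : ℤ) (hf : ∀ n < N, f n = 0) : Lau :=
  (HahnSeries.ofSuppBddBelow f ⟨N, fun n hn => by
    by_contra h
    exact hn (hf n (not_le.1 h))⟩ : HahnSeries ℤ ℂ)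

theorem coeff_mk (f : ℤ → ℂ) (N : ℤ) (hf : ∀ n < N, f n = 0) (n : ℤ) :
    (mk f N hf).coeff n = f n := rfl

theorem coeff_eq_zero_of_lt_order {p : Lau} {n : ℤ} (h : n < p.order) : p.coeff n = 0 :=
  HahnSeries.coeff_eq_zero_of_lt_order h

end Lau

/-- The element `x - c` of `ℂ((x⁻¹))`. -/
def lin (c : ℂ) : Lau := Lau.single (-1) 1 - c • (1 : Lau)

theorem lin_zero : lin 0 = Lau.single (-1) 1 := by rw [lin, zero_smul, sub_zero]

theorem lin_eq_sub (c c' : ℂ) : lin c' = lin c - (c' - c) • (1 : Lau) := by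
  simp only [lin]
  module

theorem lin_zero_zpow (n : ℤ) : lin 0 ^ n = Lau.single (-n) 1 := by
  rw [lin_zero, Lau.single_zpow, neg_one_mul]

/-- The series in `t^N ℂ[[t]]`. -/
def deep (N : ℤ) : Submodule ℂ Lau where
  carrier := {p | ∀ n < N, p.coeff n = 0}
  add_mem' hp hq n hn := by rw [Lau.coeff_add, hp n hn, hq n hn, add_zero]
  zero_mem' n _ := rfl
  smul_mem' c p hp n hn := by rw [Lau.coeff_smul, hp n hn, mul_zero]

theorem deep_antitone {N N' : ℤ} (h : N ≤ N') : deep N' ≤ deep N :=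
  fun _ hp n hn => hp n (by omega)

theorem order_mem_deep (p : Lau) : p ∈ deep p.order :=
  fun _ hn => HahnSeries.coeff_eq_zero_of_lt_order hn

theorem mul_mem_deep {N N' : ℤ} {p q : Lau} (hp : p ∈ deep N) (hq : q ∈ deep N') :
    p * q ∈ deep (N + N') := by
  intro n hn
  refine HahnSeries.coeff_mul.trans ?_
  refine Finset.sum_eq_zero fun ij hij => ?_
  have h := (Finset.mem_antidiagonal.1 hij).2.2
  rcases lt_or_ge ij.1 N with h1 | h1
  · exact mul_eq_zero_of_left (hp _ h1) _
  · exact mul_eq_zero_of_right _ (hq ij.2 (by omega))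

theorem single_mem_deep (n : ℤ) (a : ℂ) : Lau.single n a ∈ deep n :=
  fun _ hm => Lau.coeff_single_of_ne hm.ne _

theorem one_mem_deep : (1 : Lau) ∈ deep 0 := single_mem_deep 0 1

theorem lin_mem_deep (c : ℂ) : lin c ∈ deep (-1) := by
  refine sub_mem (single_mem_deep _ _) ?_
  exact Submodule.smul_mem _ _ (deep_antitone (by norm_num) one_mem_deep)

theorem coeff_lin (c : ℂ) : (lin c).coeff (-1) = 1 := by
  rw [lin, Lau.coeff_sub, Lau.coeff_single_same, Lau.coeff_smul, one_mem_deep (-1) (by norm_num)]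
  simp

theorem lin_ne_zero (c : ℂ) : lin c ≠ 0 := fun h => by
  have := coeff_lin c
  rw [h, Lau.coeff_zero] at this
  exact zero_ne_one this

theorem order_lin (c : ℂ) : (lin c).order = -1 := by
  refine le_antisymm (HahnSeries.order_le_of_coeff_ne_zero (ne_of_eq_of_ne (coeff_lin c) one_ne_zero)) ?_
  by_contra h
  have h1 := lin_mem_deep c _ (not_le.1 h)
  exact lin_ne_zero c (HahnSeries.coeff_order_eq_zero.1 h1)

theorem inv_lin_mem_deep (c : ℂ) : (lin c)⁻¹ ∈ deep 1 := by
  have h := Lau.order_mul (lin_ne_zero c) (inv_ne_zero (lin_ne_zero c))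
  rw [mul_inv_cancel₀ (lin_ne_zero c), Lau.order_one, order_lin] at h
  have := order_mem_deep (lin c)⁻¹
  rwa [show (lin c)⁻¹.order = 1 by omega] at this

theorem lin_zpow_mem_deep (c : ℂ) (k : ℤ) : lin c ^ k ∈ deep (-k) := by
  induction k using Int.induction_on with
  | zero => simpa using one_mem_deep
  | succ k ih =>
    rw [zpow_add_one₀ (lin_ne_zero c), show (-((k : ℤ) + 1)) = -k + -1 by ring]
    exact mul_mem_deep ih (lin_mem_deep c)
  | pred k ih =>
    rw [zpow_sub_one₀ (lin_ne_zero c), show (-(-(k : ℤ) - 1)) = -(-k) + 1 by ring]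
    exact mul_mem_deep ih (inv_lin_mem_deep c)

/-- The binomial expansion of `(x - c')^k = ((x - c) - (c' - c))^k` in decreasing powers of
`x - c`. -/
theorem lin_zpow_sub_sum_mem_deep (c c' : ℂ) (k : ℤ) (I : ℕ) :
    lin c' ^ k - ∑ i ∈ Finset.range I, (binom k i * (-(c' - c)) ^ i) • lin c ^ (k - i) ∈
      deep (I - k) := by
  have step : ∀ k : ℤ, lin c' * ∑ i ∈ Finset.range I,
      (binom k i * (-(c' - c)) ^ i) • lin c ^ (k - i) - ∑ i ∈ Finset.range I,
      (binom (k + 1) i * (-(c' - c)) ^ i) • lin c ^ (k + 1 - i) ∈ deep (I - k - 1) := fun k => by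
    rcases I with _ | I
    · simp
    · have h : lin c' * ∑ i ∈ Finset.range (I + 1),
          (binom k i * (-(c' - c)) ^ i) • lin c ^ (k - i) - ∑ i ∈ Finset.range (I + 1),
          (binom (k + 1) i * (-(c' - c)) ^ i) • lin c ^ (k + 1 - i) =
          (binom k I * (-(c' - c)) ^ (I + 1)) • lin c ^ (k - I) := by
        have e : ∀ j : ℤ, lin c' * lin c ^ j = lin c ^ (j + 1) + (-(c' - c)) • lin c ^ j :=
          fun j => by
            rw [lin_eq_sub c c', sub_mul, zpow_add_one₀ (lin_ne_zero c), smul_mul_assoc, one_mul,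
              neg_smul, sub_eq_add_neg, mul_comm]
        simp only [Finset.mul_sum, mul_smul_comm, e, smul_add, Finset.sum_add_distrib]
        rw [Finset.sum_range_succ' _ I, Finset.sum_range_succ (fun i => _ • (-(c' - c)) • _) I,
          Finset.sum_range_succ' _ I, binom_zero_right, binom_zero_right]
        have e2 : ∑ i ∈ Finset.range I, (binom (k + 1) (i + 1) * (-(c' - c)) ^ (i + 1)) •
            lin c ^ (k + 1 - ((i + 1 : ℕ) : ℤ)) = ∑ i ∈ Finset.range I,
            (binom k (i + 1) * (-(c' - c)) ^ (i + 1)) • lin c ^ (k - ((i + 1 : ℕ) : ℤ) + 1) +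
            ∑ i ∈ Finset.range I,
            (binom k i * (-(c' - c)) ^ i) • (-(c' - c)) • lin c ^ (k - i) := by
          rw [← Finset.sum_add_distrib]
          refine Finset.sum_congr rfl fun i _ => ?_
          rw [binom_succ_succ, show k + 1 - ((i + 1 : ℕ) : ℤ) = k - i by push_cast; ring,
            show k - ((i + 1 : ℕ) : ℤ) + 1 = k - i by push_cast; ring, smul_smul, ← add_smul]
          congr 1
          ring
        rw [e2, Nat.cast_zero, sub_zero, sub_zero, smul_smul, pow_succ, mul_assoc]
        abel
      rw [h]
      refine Submodule.smul_mem _ _ ?_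
      have := lin_zpow_mem_deep c (k - I)
      rwa [show -(k - (I : ℤ)) = ((I + 1 : ℕ) : ℤ) - k - 1 by push_cast; ring] at this
  induction k using Int.induction_on with
  | zero =>
    rcases I with _ | I
    · simpa using one_mem_deep
    · rw [Finset.sum_range_succ', Finset.sum_eq_zero]
      · simp [binom_zero_right]
      · intro i _
        rw [binom_zero_left, if_neg (Nat.succ_ne_zero i), zero_mul, zero_smul]
  | succ k ih =>
    have h := mul_mem_deep (lin_mem_deep c') ih
    rw [show (-1 : ℤ) + (I - k) = I - k - 1 by ring] at h
    have h2 := add_mem h (step k)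
    rw [mul_sub, sub_add_sub_cancel, mul_comm, ← zpow_add_one₀ (lin_ne_zero c')] at h2
    rwa [show (I : ℤ) - (k + 1) = I - k - 1 by ring]
  | pred k ih =>
    have h2 := step (-k - 1)
    rw [sub_add_cancel, show (I : ℤ) - (-k - 1) - 1 = I - (-k) by ring] at h2
    have h3 := mul_mem_deep (inv_lin_mem_deep c') (sub_mem ih h2)
    rw [sub_sub_sub_cancel_right, mul_sub, inv_mul_cancel_left₀ (lin_ne_zero c'), mul_comm,
      ← zpow_sub_one₀ (lin_ne_zero c')] at h3
    rwa [show (I : ℤ) - (-k - 1) = 1 + (I - (-k)) by ring]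

/-! ### Continuous linear maps on `ℂ((x⁻¹))` -/

section Cont

variable {X : Type u₂} [AddCommGroup X] [Module ℂ X]

/-- A linear map is continuous for the `t`-adic topology of `ℂ((t))` and the discrete topology of
the target. -/
def IsCont (φ : Lau →ₗ[ℂ] X) : Prop := ∃ N : ℤ, ∀ p ∈ deep N, φ p = 0

theorem sub_sum_single_mem_deep (p : Lau) (N : ℤ) :
    p - ∑ n ∈ Finset.Ico p.order N, p.coeff n • Lau.single n (1 : ℂ) ∈ deep N := by
  intro n hn
  rw [Lau.coeff_sub, Lau.coeff_sum]
  simp only [Lau.coeff_smul, Lau.coeff_single, mul_ite, mul_one,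
    mul_zero]
  rw [Finset.sum_ite_eq]
  split_ifs with h
  · exact sub_self _
  · rw [order_mem_deep p n, sub_self]
    by_contra h2
    exact h (Finset.mem_Ico.2 ⟨not_lt.1 h2, hn⟩)

/-- A continuous linear map that vanishes on the powers of `t` is zero. -/
theorem IsCont.eq_zero {φ : Lau →ₗ[ℂ] X} (hφ : IsCont φ)
    (h : ∀ n : ℤ, φ (Lau.single n 1) = 0) : φ = 0 := by
  obtain ⟨N, hN⟩ := hφ
  refine LinearMap.ext fun p => ?_
  have := hN _ (sub_sum_single_mem_deep p N)
  rw [map_sub, map_sum, sub_eq_zero] at this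
  rw [this]
  simp [h]

theorem IsCont.ext {φ ψ : Lau →ₗ[ℂ] X} (hφ : IsCont φ) (hψ : IsCont ψ)
    (h : ∀ n : ℤ, φ (Lau.single n 1) = ψ (Lau.single n 1)) : φ = ψ := by
  obtain ⟨N, hN⟩ := hφ
  obtain ⟨N', hN'⟩ := hψ
  refine sub_eq_zero.1 (IsCont.eq_zero ⟨max N N', fun p hp => ?_⟩ fun n => ?_)
  · rw [LinearMap.sub_apply, hN p (deep_antitone (le_max_left _ _) hp),
      hN' p (deep_antitone (le_max_right _ _) hp), sub_zero]
  · rw [LinearMap.sub_apply, h, sub_self]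

theorem IsCont.add {φ ψ : Lau →ₗ[ℂ] X} (hφ : IsCont φ) (hψ : IsCont ψ) : IsCont (φ + ψ) := by
  obtain ⟨N, hN⟩ := hφ
  obtain ⟨N', hN'⟩ := hψ
  refine ⟨max N N', fun p hp => ?_⟩
  rw [LinearMap.add_apply, hN p (deep_antitone (le_max_left _ _) hp),
      hN' p (deep_antitone (le_max_right _ _) hp), add_zero]

theorem IsCont.smul {φ : Lau →ₗ[ℂ] X} (hφ : IsCont φ) (c : ℂ) : IsCont (c • φ) := by
  obtain ⟨N, hN⟩ := hφ
  exact ⟨N, fun p hp => by rw [LinearMap.smul_apply, hN p hp, smul_zero]⟩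

theorem IsCont.sub {φ ψ : Lau →ₗ[ℂ] X} (hφ : IsCont φ) (hψ : IsCont ψ) : IsCont (φ - ψ) := by
  have := hφ.add (hψ.smul (-1))
  rwa [neg_one_smul, ← sub_eq_add_neg] at this

theorem IsCont.sum {ι : Type*} (s : Finset ι) {φ : ι → Lau →ₗ[ℂ] X} (h : ∀ i ∈ s, IsCont (φ i)) :
    IsCont (∑ i ∈ s, φ i) :=
  Finset.sum_induction _ _ (fun _ _ => IsCont.add) ⟨0, fun _ _ => rfl⟩ h

theorem IsCont.comp_mul {φ : Lau →ₗ[ℂ] X} (hφ : IsCont φ) (q : Lau) :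
    IsCont (φ ∘ₗ LinearMap.mulLeft ℂ q) := by
  obtain ⟨N, hN⟩ := hφ
  refine ⟨N - q.order, fun p hp => hN _ ?_⟩
  have := mul_mem_deep (order_mem_deep q) hp
  rwa [add_sub_cancel] at this

/-- The pairing `∑ p_n a_n` of `p = ∑ p_n t^n` with a family `a` that vanishes for large `n`. -/
def pairing (a : ℤ → X) (p : Lau) : X := ∑ᶠ n : ℤ, p.coeff n • a n

theorem pairing_support {a : ℤ → X} {N : ℤ} (ha : ∀ n, N ≤ n → a n = 0) (p : Lau) :
    (Function.support fun n : ℤ => p.coeff n • a n).Finite := by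
  refine (Set.finite_Ico p.order N).subset fun n hn => ?_
  rw [Function.mem_support] at hn
  refine ⟨?_, ?_⟩
  · by_contra h
    exact hn (by rw [order_mem_deep p n (not_le.1 h), zero_smul])
  · by_contra h
    exact hn (by rw [ha n (not_lt.1 h), smul_zero])

theorem pairing_add_right {a : ℤ → X} {N : ℤ} (ha : ∀ n, N ≤ n → a n = 0) (p q : Lau) :
    pairing a (p + q) = pairing a p + pairing a q := by
  unfold pairing
  rw [← finsum_add_distrib (pairing_support ha p) (pairing_support ha q)]
  simp only [Lau.coeff_add, add_smul]

theorem pairing_smul_right {a : ℤ → X} {N : ℤ} (ha : ∀ n, N ≤ n → a n = 0) (c : ℂ) (p : Lau) :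
    pairing a (c • p) = c • pairing a p := by
  unfold pairing
  rw [smul_finsum' c (pairing_support ha p)]
  simp only [Lau.coeff_smul, mul_smul]

theorem pairing_add_left {a b : ℤ → X} {N N' : ℤ} (ha : ∀ n, N ≤ n → a n = 0)
    (hb : ∀ n, N' ≤ n → b n = 0) (p : Lau) :
    pairing (a + b) p = pairing a p + pairing b p := by
  unfold pairing
  rw [← finsum_add_distrib (pairing_support ha p) (pairing_support hb p)]
  simp only [Pi.add_apply, smul_add]

theorem pairing_smul_left {a : ℤ → X} {N : ℤ} (ha : ∀ n, N ≤ n → a n = 0) (c : ℂ) (p : Lau) :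
    pairing (c • a) p = c • pairing a p := by
  unfold pairing
  rw [smul_finsum' c (pairing_support ha p)]
  simp only [Pi.smul_apply, smul_comm c]

theorem pairing_eq_zero {a : ℤ → X} {N : ℤ} (ha : ∀ n, N ≤ n → a n = 0) {p : Lau}
    (hp : p ∈ deep N) : pairing a p = 0 := by
  refine finsum_eq_zero_of_forall_eq_zero fun n => ?_
  rcases lt_or_ge n N with h | h
  · rw [hp n h, zero_smul]
  · rw [ha n h, smul_zero]

theorem pairing_single (a : ℤ → X) (n : ℤ) (c : ℂ) :
    pairing a (Lau.single n c) = c • a n := by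
  unfold pairing
  rw [finsum_eq_single _ n, Lau.coeff_single_same]
  intro m hm
  rw [Lau.coeff_single_of_ne hm, zero_smul]

end Cont

/-! ### The derivation `d/dx` -/

/-- The linear map `d/dx = -t² d/dt` on `ℂ((t))`. -/
def dxLin : Lau →ₗ[ℂ] Lau where
  toFun p := Lau.mk (fun n => -((n : ℂ) - 1) * p.coeff (n - 1)) (p.order + 1) fun n hn => by
    rw [Lau.coeff_eq_zero_of_lt_order (by omega), mul_zero]
  map_add' p q := Lau.ext fun n => by
    simp only [Lau.coeff_mk, Lau.coeff_add]
    ring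
  map_smul' c p := Lau.ext fun n => by
    simp only [Lau.coeff_mk, Lau.coeff_smul, RingHom.id_apply]
    ring

theorem coeff_dxLin (p : Lau) (n : ℤ) :
    (dxLin p).coeff n = -((n : ℂ) - 1) * p.coeff (n - 1) := rfl

theorem dxLin_single (n : ℤ) (c : ℂ) :
    dxLin (Lau.single n c) = Lau.single (n + 1) (-(n : ℂ) * c) := by
  refine Lau.ext fun m => ?_
  rw [coeff_dxLin, Lau.coeff_single, Lau.coeff_single]
  by_cases h : m = n + 1
  · subst h
    simp
  · rw [if_neg h, if_neg (by omega), mul_zero]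

theorem dxLin_mem_deep {N : ℤ} {p : Lau} (hp : p ∈ deep N) : dxLin p ∈ deep (N + 1) :=
  fun n hn => by rw [coeff_dxLin, hp _ (by omega), mul_zero]

theorem isCont_coeff (n : ℤ) : IsCont (Lau.coeffLin n) :=
  ⟨n + 1, fun _ hp => hp n (by omega)⟩

theorem IsCont.comp_dxLin {X : Type u₂} [AddCommGroup X] [Module ℂ X] {φ : Lau →ₗ[ℂ] X}
    (hφ : IsCont φ) : IsCont (φ ∘ₗ dxLin) := by
  obtain ⟨N, hN⟩ := hφ
  exact ⟨N - 1, fun p hp => hN _ (by simpa using dxLin_mem_deep hp)⟩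

theorem dxLin_mul (p q : Lau) : dxLin (p * q) = p * dxLin q + q * dxLin p := by
  have h : ∀ (n : ℤ) (q : Lau),
      Lau.coeffLin n ∘ₗ dxLin ∘ₗ LinearMap.mulLeft ℂ q =
      Lau.coeffLin n ∘ₗ LinearMap.mulLeft ℂ (dxLin q) +
      Lau.coeffLin n ∘ₗ LinearMap.mulLeft ℂ q ∘ₗ dxLin := by
    intro n q
    have c1 : ∀ q, IsCont (Lau.coeffLin n ∘ₗ dxLin ∘ₗ
        LinearMap.mulLeft ℂ q) := fun q => ((isCont_coeff n).comp_dxLin).comp_mul q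
    have c2 : ∀ q, IsCont (Lau.coeffLin n ∘ₗ
        LinearMap.mulLeft ℂ (dxLin q) + Lau.coeffLin n ∘ₗ
        LinearMap.mulLeft ℂ q ∘ₗ dxLin) := fun q =>
      ((isCont_coeff n).comp_mul _).add (((isCont_coeff n).comp_mul q).comp_dxLin)
    refine IsCont.ext (c1 q) (c2 q) fun m => ?_
    have h2 := IsCont.ext (c1 (Lau.single m 1)) (c2 (Lau.single m 1)) fun k => by
      simp only [LinearMap.comp_apply, LinearMap.add_apply, LinearMap.mulLeft_apply,
        Lau.single_mul_single, dxLin_single, ← map_add]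
      congr 1
      rw [show m + 1 + k = m + k + 1 by ring, show m + (k + 1) = m + k + 1 by ring, ← Lau.single_add]
      congr 1
      push_cast
      ring
    have h3 := congrArg (fun φ => φ q) h2
    simp only [LinearMap.comp_apply, LinearMap.add_apply, LinearMap.mulLeft_apply] at h3 ⊢
    rw [mul_comm q, h3, mul_comm (dxLin q), mul_comm q, add_comm]
  refine Lau.ext fun n => ?_
  have := congrArg (fun φ => φ q) (h n p)
  simp only [LinearMap.comp_apply, LinearMap.add_apply, LinearMap.mulLeft_apply] at this
  rw [mul_comm q, add_comm]
  exact this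

/-- The derivation `d/dx` of `ℂ((x⁻¹))`. -/
def dx : Derivation ℂ Lau Lau := Derivation.mk' dxLin fun p q => by
  simp only [smul_eq_mul]
  exact dxLin_mul p q

theorem dx_mem_deep {N : ℤ} {p : Lau} (hp : p ∈ deep N) : dx p ∈ deep (N + 1) :=
  dxLin_mem_deep hp

theorem dx_single (n : ℤ) (c : ℂ) :
    dx (Lau.single n c) = Lau.single (n + 1) (-(n : ℂ) * c) := dxLin_single n c

theorem dx_lin (c : ℂ) : dx (lin c) = 1 := by
  rw [lin, map_sub, Derivation.map_smul, Derivation.map_one_eq_zero, smul_zero, sub_zero, dx_single]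
  simpa using Lau.single_zero_one

theorem dx_lin_zpow (c : ℂ) (n : ℤ) : dx (lin c ^ n) = (n : ℂ) • lin c ^ (n - 1) := by
  rw [Derivation.leibniz_zpow, dx_lin, smul_eq_mul, mul_one, Int.cast_smul_eq_zsmul]

/-- The divided power `(1/i!) (d/dx)^i`. -/
def hasse (i : ℕ) : Lau →ₗ[ℂ] Lau := (i.factorial : ℂ)⁻¹ • (dx : Lau →ₗ[ℂ] Lau) ^ i

theorem hasse_zero (p : Lau) : hasse 0 p = p := by simp [hasse]

theorem succ_smul_hasse_succ (i : ℕ) (p : Lau) :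
    ((i : ℂ) + 1) • hasse (i + 1) p = dx (hasse i p) := by
  simp only [hasse, LinearMap.smul_apply, pow_succ', Module.End.mul_apply, Derivation.coeFn_coe,
    Derivation.map_smul, smul_smul]
  congr 1
  rw [Nat.factorial_succ]
  have h1 : ((i.factorial : ℕ) : ℂ) ≠ 0 := Nat.cast_ne_zero.2 (Nat.factorial_ne_zero i)
  have h2 : (i : ℂ) + 1 ≠ 0 := Nat.cast_add_one_ne_zero i
  push_cast
  field_simp

theorem hasse_succ (i : ℕ) (p : Lau) :
    hasse (i + 1) p = ((i : ℂ) + 1)⁻¹ • dx (hasse i p) := by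
  rw [← succ_smul_hasse_succ, inv_smul_smul₀ (Nat.cast_add_one_ne_zero i)]

theorem hasse_lin_zpow (c : ℂ) (n : ℤ) (i : ℕ) :
    hasse i (lin c ^ n) = binom n i • lin c ^ (n - i) := by
  induction i with
  | zero => simp [hasse_zero, binom_zero_right]
  | succ i ih =>
    rw [hasse_succ, ih, Derivation.map_smul, dx_lin_zpow, smul_smul, smul_smul]
    have := succ_mul_binom_succ n i
    congr 1
    · rw [mul_assoc, inv_mul_eq_iff_eq_mul₀ (Nat.cast_add_one_ne_zero i), this]
      push_cast
      ring
    · congr 1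
      push_cast
      ring

theorem hasse_mem_deep {N : ℤ} {p : Lau} (hp : p ∈ deep N) (i : ℕ) : hasse i p ∈ deep (N + i) := by
  induction i with
  | zero => simpa [hasse_zero] using hp
  | succ i ih =>
    rw [hasse_succ, Nat.cast_succ, ← add_assoc]
    exact Submodule.smul_mem _ _ (dx_mem_deep ih)

/-! ### Weight spaces and the operators `L(1)^a / a!` -/

section Weight

variable {V : Type u₁} [AddCommGroup V] [Module ℂ V] {A : VertexData V}
  {M : Type u₂} [AddCommGroup M] [Module ℂ M]

theorem jacobiRHS_zero {Y : V →ₗ[ℂ] ℤ → Module.End ℂ M} (hY : TruncModes Y) (u v : V) (m n : ℤ)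
    (w : M) : jacobiRHS Y u v 0 m n w = Y u m (Y v n w) - Y v n (Y u m w) := by
  rw [jacobiRHS_eq_halfSum hY, halfSum_zero, halfSum_zero, zpow_zero, one_smul]

theorem jacobiLHS_natCast (A : VertexData V) (Y : V →ₗ[ℂ] ℤ → Module.End ℂ M) (u v : V) (l : ℤ)
    (m : ℕ) (n : ℤ) (w : M) : jacobiLHS A Y u v l m n w =
      ∑ i ∈ Finset.range (m + 1), binom m i • Y (A.Y u (l + i) v) (m + n - i) w := by
  refine finsum_eq_sum_of_support_subset _ fun i hi => ?_
  rw [Finset.coe_range, Set.mem_Iio]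
  by_contra h
  refine hi ?_
  have := binom_natCast m i
  rw [Nat.choose_eq_zero_of_lt (by omega)] at this
  dsimp only [binom] at this ⊢
  rw [this, Nat.cast_zero, zero_smul]

variable (B : VertexOperatorAlgebra V)

theorem VertexOperatorAlgebra.truncModes : TruncModes B.Y := B.trunc

theorem VertexOperatorAlgebra.commutator (u v w : V) (m : ℕ) (n : ℤ) :
    B.Y u m (B.Y v n w) - B.Y v n (B.Y u m w) =
      ∑ i ∈ Finset.range (m + 1), binom m i • B.Y (B.Y u i v) (m + n - i) w := by
  rw [← jacobiRHS_zero B.truncModes, ← B.jacobi, jacobiLHS_natCast]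
  simp only [zero_add]

theorem VertexOperatorAlgebra.induction_grade {P : V → Prop} (h0 : P 0)
    (hadd : ∀ u v, P u → P v → P (u + v)) (hg : ∀ h : ℤ, ∀ v ∈ B.grade h, P v) (v : V) : P v := by
  have hv : v ∈ ⨆ h, B.grade h := by
    rw [B.internal.submodule_iSup_eq_top]
    trivial
  exact Submodule.iSup_induction B.grade (motive := P) hv hg h0 hadd

theorem VertexOperatorAlgebra.component_of_mem {h : ℤ} {v : V} (hv : v ∈ B.grade h) (h' : ℤ) :
    B.component h' v = if h = h' then v else 0 := by
  have e : (LinearEquiv.ofBijective (DirectSum.coeLinearMap B.grade) B.internal).symm v =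
      DirectSum.lof ℂ ℤ (fun n => B.grade n) h ⟨v, hv⟩ := by
    rw [LinearEquiv.symm_apply_eq]
    exact (DirectSum.coeLinearMap_lof B.grade h ⟨v, hv⟩).symm
  simp only [VertexOperatorAlgebra.component, LinearMap.comp_apply, LinearEquiv.coe_coe, e]
  split_ifs with hh
  · subst hh
    rw [DirectSum.component.lof_self]
    rfl
  · rw [DirectSum.component.of, dif_neg hh]
    rfl

theorem VertexOperatorAlgebra.component_mem (h : ℤ) (v : V) : B.component h v ∈ B.grade h :=
  Subtype.property _

theorem VertexOperatorAlgebra.component_support (v : V) :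
    (Function.support fun h => B.component h v).Finite := by
  induction v using B.induction_grade with
  | h0 => simp
  | hadd u v hu hv =>
    simp only [map_add]
    exact (hu.union hv).subset (Function.support_add _ _)
  | hg h v hv =>
    refine (Set.finite_singleton h).subset fun h' hh => ?_
    rw [Function.mem_support, B.component_of_mem hv] at hh
    by_contra hne
    exact hh (if_neg fun e => hne e.symm)

theorem VertexOperatorAlgebra.sum_component (v : V) : ∑ᶠ h, B.component h v = v := by
  induction v using B.induction_grade with
  | h0 => simp
  | hadd u v hu hv =>
    simp only [map_add]
    rw [finsum_add_distrib (B.component_support u) (B.component_support v), hu, hv]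
  | hg h v hv =>
    rw [finsum_eq_single _ h, B.component_of_mem hv, if_pos rfl]
    intro h' hh
    rw [B.component_of_mem hv, if_neg hh.symm]

/-- The eigenvectors of `L(0)` are homogeneous. -/
theorem VertexOperatorAlgebra.mem_grade_of_weight {n : ℤ} {v : V}
    (hv : B.Y B.conf 1 v = (n : ℂ) • v) : v ∈ B.grade n := by
  have comm : ∀ (h : ℤ) (v : V), B.component h (B.Y B.conf 1 v) = (h : ℂ) • B.component h v := by
    intro h v
    induction v using B.induction_grade with
    | h0 => simp
    | hadd u v hu hv => rw [map_add, map_add, map_add, hu, hv, smul_add]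
    | hg h' v hv =>
      rw [B.weight h' v hv, map_smul, B.component_of_mem hv]
      split_ifs with hh
      · rw [hh]
      · simp
  have hz : ∀ h, h ≠ n → B.component h v = 0 := fun h hh => by
    have := comm h v
    rw [hv, map_smul, ← sub_eq_zero, ← sub_smul] at this
    refine (smul_eq_zero.1 this).resolve_left ?_
    exact fun e => hh (Int.cast_injective (sub_eq_zero.1 e)).symm
  rw [← B.sum_component v, finsum_eq_single _ n hz]
  exact B.component_mem n v

theorem VertexOperatorAlgebra.mode_mem_grade {h h' : ℤ} {u v : V} (hu : u ∈ B.grade h)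
    (hv : v ∈ B.grade h') (n : ℤ) : B.Y u n v ∈ B.grade (h + h' - n - 1) := by
  refine B.mem_grade_of_weight ?_
  have := B.commutator B.conf u v 1 n
  rw [Finset.sum_range_succ, Finset.sum_range_one, Nat.cast_one, Nat.cast_zero,
    binom_zero_right, binom_one_right, B.weight h u hu, B.weight h' v hv, B.deriv, sub_zero,
    map_smul, map_smul, Pi.smul_apply, LinearMap.smul_apply, add_sub_cancel_left,
    sub_eq_iff_eq_add] at this
  rw [this]
  push_cast
  module

/-- `[L(1), u_n] = (2h - n - 2) u_{n+1} + (L(1)u)_n` for `u` of weight `h`. -/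
theorem VertexOperatorAlgebra.raise_mode {h : ℤ} {u : V} (hu : u ∈ B.grade h) (n : ℤ) (v : V) :
    B.Y B.conf 2 (B.Y u n v) = B.Y u n (B.Y B.conf 2 v) +
      (2 * (h : ℂ) - n - 2) • B.Y u (n + 1) v + B.Y (B.Y B.conf 2 u) n v := by
  have := B.commutator B.conf u v 2 n
  have h2 : binom 2 2 = 1 := by
    rw [show (2 : ℤ) = ((2 : ℕ) : ℤ) from rfl, binom_natCast]
    simp
  rw [Finset.sum_range_succ, Finset.sum_range_succ, Finset.sum_range_one, Nat.cast_ofNat,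
    Nat.cast_zero, Nat.cast_one, binom_zero_right, binom_one_right, h2, B.weight h u hu, B.deriv,
    map_smul, Pi.smul_apply, LinearMap.smul_apply, show (2 : ℤ) + n - 0 - 1 = n + 1 by ring,
    show (2 : ℤ) + n - 1 = n + 1 by ring, show (2 : ℤ) + n - 2 = n by ring,
    sub_eq_iff_eq_add] at this
  rw [this]
  push_cast
  module

theorem VertexOperatorAlgebra.raise_mem_grade {h : ℤ} {v : V} (hv : v ∈ B.grade h) :
    B.Y B.conf 2 v ∈ B.grade (h - 1) := by
  have := B.mode_mem_grade B.conf_mem hv 2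
  rwa [show 2 + h - 2 - 1 = h - 1 by ring] at this

/-- The operator `L(1)^a / a!`. -/
def VertexOperatorAlgebra.divRaise (a : ℕ) : V →ₗ[ℂ] V :=
  (a.factorial : ℂ)⁻¹ • B.Y B.conf 2 ^ a

theorem VertexOperatorAlgebra.divRaise_zero (v : V) : B.divRaise 0 v = v := by
  simp [VertexOperatorAlgebra.divRaise]

theorem VertexOperatorAlgebra.raise_divRaise (a : ℕ) (v : V) :
    B.Y B.conf 2 (B.divRaise a v) = ((a : ℂ) + 1) • B.divRaise (a + 1) v := by
  simp only [VertexOperatorAlgebra.divRaise, LinearMap.smul_apply, pow_succ', Module.End.mul_apply,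
    map_smul, smul_smul]
  congr 1
  rw [Nat.factorial_succ]
  have h1 : ((a.factorial : ℕ) : ℂ) ≠ 0 := Nat.cast_ne_zero.2 (Nat.factorial_ne_zero a)
  have h2 : (a : ℂ) + 1 ≠ 0 := Nat.cast_add_one_ne_zero a
  push_cast
  field_simp

theorem VertexOperatorAlgebra.divRaise_mem_grade {h : ℤ} {v : V} (hv : v ∈ B.grade h) (a : ℕ) :
    B.divRaise a v ∈ B.grade (h - a) := by
  refine Submodule.smul_mem _ _ ?_
  induction a with
  | zero => simpa using hv
  | succ a ih =>
    rw [pow_succ', Module.End.mul_apply, Nat.cast_succ, ← sub_sub]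
    exact B.raise_mem_grade ih

theorem VertexOperatorAlgebra.exists_divRaise_eq_zero {h : ℤ} {v : V} (hv : v ∈ B.grade h) :
    ∃ K : ℕ, ∀ a, K ≤ a → B.divRaise a v = 0 := by
  obtain ⟨N, hN⟩ := B.lower
  refine ⟨(h - N + 1).toNat, fun a ha => ?_⟩
  have := B.divRaise_mem_grade hv a
  rwa [hN _ (by omega), Submodule.mem_bot] at this

theorem smul_sum_antidiagonal_succ (F : ℕ → ℕ → V) (n : ℕ) :
    ((n : ℂ) + 1) • ∑ p ∈ Finset.HasAntidiagonal.antidiagonal (n + 1), F p.1 p.2 =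
      ∑ p ∈ Finset.HasAntidiagonal.antidiagonal n,
        (((p.1 : ℂ) + 1) • F (p.1 + 1) p.2 + ((p.2 : ℂ) + 1) • F p.1 (p.2 + 1)) := by
  have h : ((n : ℂ) + 1) • ∑ p ∈ Finset.HasAntidiagonal.antidiagonal (n + 1), F p.1 p.2 =
      ∑ p ∈ Finset.HasAntidiagonal.antidiagonal (n + 1), (p.1 : ℂ) • F p.1 p.2 +
      ∑ p ∈ Finset.HasAntidiagonal.antidiagonal (n + 1), (p.2 : ℂ) • F p.1 p.2 := by
    rw [Finset.smul_sum, ← Finset.sum_add_distrib]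
    refine Finset.sum_congr rfl fun p hp => ?_
    have hp' : p.1 + p.2 = n + 1 := Finset.HasAntidiagonal.mem_antidiagonal.1 hp
    rw [← add_smul]
    congr 1
    exact_mod_cast hp'.symm
  rw [h, Finset.Nat.sum_antidiagonal_succ, Finset.Nat.sum_antidiagonal_succ', Finset.sum_add_distrib]
  simp

/-- The coefficient of `x^e` in `e^{xL(1)} u_k e^{-xL(1)}`, for `u` of weight `h`: the operator
`∑_{a+d=e} (2h-2-k-a choose d) (L(1)^a u / a!)_{k+d}`. -/
def VertexOperatorAlgebra.conjMode (h : ℤ) (u : V) (k : ℤ) (e : ℕ) (v : V) : V :=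
  ∑ p ∈ Finset.HasAntidiagonal.antidiagonal e,
    binom (2 * h - 2 - k - p.1) p.2 • B.Y (B.divRaise p.1 u) (k + p.2) v

/-- The differential equation `(d/dx) M(x) = [L(1), M(x)]` for `M(x) = e^{xL(1)} u_k e^{-xL(1)}`. -/
theorem VertexOperatorAlgebra.raise_conjMode {h : ℤ} {u : V} (hu : u ∈ B.grade h) (k : ℤ) (e : ℕ)
    (v : V) : B.Y B.conf 2 (B.conjMode h u k e v) =
      B.conjMode h u k e (B.Y B.conf 2 v) + ((e : ℂ) + 1) • B.conjMode h u k (e + 1) v := by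
  have key : ∑ p ∈ Finset.HasAntidiagonal.antidiagonal e,
      ((p.1 : ℂ) + 1) • (binom (2 * h - 2 - k - p.1) p.2 - binom (2 * h - 2 - k - p.1 - 1) p.2) •
        B.Y (B.divRaise (p.1 + 1) u) (k + p.2) v =
      ∑ p ∈ Finset.HasAntidiagonal.antidiagonal e,
        (p.1 : ℂ) • binom (2 * h - 2 - k - p.1) p.2 •
          B.Y (B.divRaise p.1 u) (k + p.2 + 1) v := by
    rcases e with _ | e
    · simp [binom_zero_right]
    · rw [Finset.Nat.sum_antidiagonal_succ', Finset.Nat.sum_antidiagonal_succ]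
      dsimp only
      rw [binom_zero_right, binom_zero_right, Nat.cast_zero, Nat.cast_zero, sub_self, zero_smul,
        zero_smul, smul_zero, zero_add, zero_add]
      refine Finset.sum_congr rfl fun p _ => ?_
      have hb := binom_succ_succ (2 * h - 2 - k - p.1 - 1) p.2
      rw [sub_add_cancel] at hb
      rw [hb, add_sub_cancel_right, Nat.cast_succ, Nat.cast_succ, Nat.cast_succ, ← sub_sub,
        ← add_assoc]
  unfold VertexOperatorAlgebra.conjMode
  rw [smul_sum_antidiagonal_succ (fun a d => binom (2 * h - 2 - k - a) d •
    B.Y (B.divRaise a u) (k + d) v), map_sum, ← Finset.sum_add_distrib, ← sub_eq_zero,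
    ← Finset.sum_sub_distrib]
  rw [← sub_eq_zero, ← Finset.sum_sub_distrib] at key
  rw [← key]
  refine Finset.sum_congr rfl fun p _ => ?_
  rw [map_smul, B.raise_mode (B.divRaise_mem_grade hu p.1), B.raise_divRaise]
  have hb := succ_mul_binom_succ (2 * h - 2 - k - p.1) p.2
  simp only [map_smul, Pi.smul_apply, LinearMap.smul_apply, Nat.cast_succ, ← sub_sub, ← add_assoc]
  push_cast at hb ⊢
  have e1 : ((p.2 : ℂ) + 1) • binom (2 * h - 2 - k - p.1) (p.2 + 1) •
      B.Y (B.divRaise p.1 u) (k + p.2 + 1) v = ((2 * (h : ℂ) - 2 - k - p.1 - p.2) *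
      binom (2 * h - 2 - k - p.1) p.2) • B.Y (B.divRaise p.1 u) (k + p.2 + 1) v := by
    rw [smul_smul, hb]
  rw [e1]
  module

/-- The formula for `e^{xL(1)} u_k v`. -/
theorem VertexOperatorAlgebra.divRaise_mode {h : ℤ} {u : V} (hu : u ∈ B.grade h) (k : ℤ) (v : V)
    (c : ℕ) : B.divRaise c (B.Y u k v) =
      ∑ p ∈ Finset.HasAntidiagonal.antidiagonal c, B.conjMode h u k p.1 (B.divRaise p.2 v) := by
  induction c with
  | zero =>
    simp [VertexOperatorAlgebra.conjMode, B.divRaise_zero, binom_zero_right]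
  | succ c ih =>
    have hc : (c : ℂ) + 1 ≠ 0 := Nat.cast_add_one_ne_zero c
    refine smul_right_injective V hc ?_
    dsimp only
    rw [← B.raise_divRaise, ih, map_sum,
      smul_sum_antidiagonal_succ (fun e b => B.conjMode h u k e (B.divRaise b v))]
    refine Finset.sum_congr rfl fun p _ => ?_
    rw [B.raise_conjMode hu, B.raise_divRaise, add_comm]
    congr 1
    simp only [VertexOperatorAlgebra.conjMode, map_smul, Finset.smul_sum]
    exact Finset.sum_congr rfl fun q _ => smul_comm _ _ _

end Weight

/-! ### The operators `Res_x p(x) Yᵒ(v,x)` -/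

section Opposite

variable {V : Type u₁} [AddCommGroup V] [Module ℂ V] {B : VertexOperatorAlgebra V}
  {W : Type u₂} [AddCommGroup W] [Module ℂ W] (M : WeakModule B.toVertexData W)

theorem WeakModule.truncModes {A : VertexData V} (M : WeakModule A W) : TruncModes M.Y := M.trunc

/-- For homogeneous `v` the double sum in the definition of `Yᵒ(v,x)` is a finite sum over the
vectors `L(1)^a v / a!`. -/
theorem oppositeCoeff_of_mem {h : ℤ} {v : V} (hv : v ∈ B.grade h) {K : ℕ}
    (hK : ∀ a, K ≤ a → B.divRaise a v = 0) (e : ℤ) (w : W) :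
    oppositeCoeff M v e w =
      (-1 : ℂ) ^ h • ∑ a ∈ Finset.range K, M.Y (B.divRaise a v) (e - a + 2 * h - 1) w := by
  have hd : ∀ a : ℕ, ((-1 : ℂ) ^ h / (a.factorial : ℂ)) • M.Y ((B.Y B.conf 2 ^ a) v)
      (e - a + 2 * h - 1) w = (-1 : ℂ) ^ h • M.Y (B.divRaise a v) (e - a + 2 * h - 1) w := by
    intro a
    rw [VertexOperatorAlgebra.divRaise, LinearMap.smul_apply, map_smul, Pi.smul_apply,
      LinearMap.smul_apply, smul_smul, div_eq_mul_inv]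
  unfold oppositeCoeff
  rw [finsum_eq_single _ h]
  · simp only [B.component_of_mem hv, if_true, hd]
    rw [finsum_eq_sum_of_support_subset (s := Finset.range K), Finset.smul_sum]
    intro a ha
    rw [Finset.coe_range, Set.mem_Iio]
    by_contra hlt
    exact ha (by dsimp only; rw [hK a (by omega)]; simp)
  · intro h' hh
    simp [B.component_of_mem hv, if_neg hh.symm]

theorem oppositeCoeff_inner_support (v : V) (e h : ℤ) (w : W) :
    (Function.support fun i : ℕ => ((-1 : ℂ) ^ h / (i.factorial : ℂ)) •
      M.Y ((B.Y B.conf 2 ^ i) (B.component h v)) (e - i + 2 * h - 1) w).Finite := by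
  obtain ⟨K, hK⟩ := B.exists_divRaise_eq_zero (B.component_mem h v)
  refine (Finset.range K).finite_toSet.subset fun i hi => ?_
  rw [Finset.coe_range, Set.mem_Iio]
  by_contra hlt
  refine hi ?_
  have h1 := hK i (by omega)
  rw [VertexOperatorAlgebra.divRaise, LinearMap.smul_apply, smul_eq_zero] at h1
  dsimp only
  rw [h1.resolve_left (inv_ne_zero (Nat.cast_ne_zero.2 (Nat.factorial_ne_zero i)))]
  simp

theorem oppositeCoeff_outer_support (v : V) (e : ℤ) (w : W) :
    (Function.support fun h : ℤ => ∑ᶠ i : ℕ, ((-1 : ℂ) ^ h / (i.factorial : ℂ)) •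
      M.Y ((B.Y B.conf 2 ^ i) (B.component h v)) (e - i + 2 * h - 1) w).Finite := by
  refine (B.component_support v).subset fun h hh hz => hh ?_
  dsimp only at hz ⊢
  simp [hz]

theorem oppositeCoeff_add_left (u v : V) (e : ℤ) (w : W) :
    oppositeCoeff M (u + v) e w = oppositeCoeff M u e w + oppositeCoeff M v e w := by
  unfold oppositeCoeff
  rw [← finsum_add_distrib (oppositeCoeff_outer_support M u e w)
    (oppositeCoeff_outer_support M v e w)]
  refine finsum_congr fun h => ?_
  rw [← finsum_add_distrib (oppositeCoeff_inner_support M u e h w)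
    (oppositeCoeff_inner_support M v e h w)]
  simp only [map_add, Pi.add_apply, LinearMap.add_apply, smul_add]

theorem oppositeCoeff_smul_left (c : ℂ) (v : V) (e : ℤ) (w : W) :
    oppositeCoeff M (c • v) e w = c • oppositeCoeff M v e w := by
  unfold oppositeCoeff
  rw [smul_finsum' c (oppositeCoeff_outer_support M v e w)]
  refine finsum_congr fun h => ?_
  rw [smul_finsum' c (oppositeCoeff_inner_support M v e h w)]
  simp only [map_smul, Pi.smul_apply, LinearMap.smul_apply, smul_comm c]

theorem oppositeCoeff_zero_left (e : ℤ) (w : W) : oppositeCoeff M 0 e w = 0 := by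
  have := oppositeCoeff_smul_left M 0 0 e w
  rwa [zero_smul, zero_smul] at this

theorem oppositeCoeff_add_right (v : V) (e : ℤ) (w w' : W) :
    oppositeCoeff M v e (w + w') = oppositeCoeff M v e w + oppositeCoeff M v e w' := by
  unfold oppositeCoeff
  rw [← finsum_add_distrib (oppositeCoeff_outer_support M v e w)
    (oppositeCoeff_outer_support M v e w')]
  refine finsum_congr fun h => ?_
  rw [← finsum_add_distrib (oppositeCoeff_inner_support M v e h w)
    (oppositeCoeff_inner_support M v e h w')]
  simp only [map_add, smul_add]

theorem oppositeCoeff_smul_right (c : ℂ) (v : V) (e : ℤ) (w : W) :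
    oppositeCoeff M v e (c • w) = c • oppositeCoeff M v e w := by
  unfold oppositeCoeff
  rw [smul_finsum' c (oppositeCoeff_outer_support M v e w)]
  refine finsum_congr fun h => ?_
  rw [smul_finsum' c (oppositeCoeff_inner_support M v e h w)]
  simp only [map_smul, smul_comm c]

/-- A finite set of vectors is annihilated by the modes from some index on. -/
theorem TruncModes.exists_uniform {Y : V →ₗ[ℂ] ℤ → Module.End ℂ W} (hY : TruncModes Y) (v : ℕ → V)
    (K : ℕ) (w : W) : ∃ N : ℤ, ∀ a < K, ∀ n, N ≤ n → Y (v a) n w = 0 := by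
  induction K with
  | zero => exact ⟨0, fun a ha => absurd ha (Nat.not_lt_zero a)⟩
  | succ K ih =>
    obtain ⟨N, hN⟩ := ih
    obtain ⟨N', hN'⟩ := hY (v K) w
    refine ⟨max N N', fun a ha n hn => ?_⟩
    rcases Nat.lt_succ_iff_lt_or_eq.1 ha with h | rfl
    · exact hN a h n (by omega)
    · exact hN' n (by omega)

theorem oppositeCoeff_trunc (v : V) (w : W) :
    ∃ N : ℤ, ∀ e, N ≤ e → oppositeCoeff M v e w = 0 := by
  induction v using B.induction_grade with
  | h0 => exact ⟨0, fun e _ => oppositeCoeff_zero_left M e w⟩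
  | hadd u v hu hv =>
    obtain ⟨N, hN⟩ := hu
    obtain ⟨N', hN'⟩ := hv
    refine ⟨max N N', fun e he => ?_⟩
    rw [oppositeCoeff_add_left, hN e (by omega), hN' e (by omega), add_zero]
  | hg h v hv =>
    obtain ⟨K, hK⟩ := B.exists_divRaise_eq_zero hv
    obtain ⟨N, hN⟩ := M.truncModes.exists_uniform (fun a => B.divRaise a v) K w
    refine ⟨N + K - 2 * h + 1, fun e he => ?_⟩
    rw [oppositeCoeff_of_mem M hv hK, Finset.sum_eq_zero, smul_zero]
    intro a ha
    have := Finset.mem_range.1 ha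
    exact hN a this _ (by omega)

theorem oppositeCoeff_shift_trunc (v : V) (w : W) :
    ∃ N : ℤ, ∀ n, N ≤ n → oppositeCoeff M v (n - 1) w = 0 := by
  obtain ⟨N, hN⟩ := oppositeCoeff_trunc M v w
  exact ⟨N + 1, fun n hn => hN _ (by omega)⟩

/-- The operator `Res_x p(x) Yᵒ(v,x)` on `W`, for a Laurent series `p` in `x⁻¹`. Applied to a
vector `w` it is a finite sum, because `Yᵒ(v,x)w` has finitely many positive powers of `x`. -/
def WeakModule.opp : V →ₗ[ℂ] Lau →ₗ[ℂ] Module.End ℂ W :=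
  LinearMap.mk₂ ℂ
    (fun v p =>
      { toFun := fun w => pairing (fun n => oppositeCoeff M v (n - 1) w) p
        map_add' := fun w w' => by
          obtain ⟨N, hN⟩ := oppositeCoeff_shift_trunc M v w
          obtain ⟨N', hN'⟩ := oppositeCoeff_shift_trunc M v w'
          rw [← pairing_add_left hN hN']
          congr 1
          funext n
          exact oppositeCoeff_add_right M v (n - 1) w w'
        map_smul' := fun c w => by
          obtain ⟨N, hN⟩ := oppositeCoeff_shift_trunc M v w
          rw [RingHom.id_apply, ← pairing_smul_left hN]
          congr 1
          funext n
          exact oppositeCoeff_smul_right M c v (n - 1) w })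
    (fun u v p => LinearMap.ext fun w => by
      obtain ⟨N, hN⟩ := oppositeCoeff_shift_trunc M u w
      obtain ⟨N', hN'⟩ := oppositeCoeff_shift_trunc M v w
      refine Eq.trans ?_ (pairing_add_left hN hN' p)
      change pairing _ p = _
      congr 1
      funext n
      exact oppositeCoeff_add_left M u v (n - 1) w)
    (fun c v p => LinearMap.ext fun w => by
      obtain ⟨N, hN⟩ := oppositeCoeff_shift_trunc M v w
      refine Eq.trans ?_ (pairing_smul_left hN c p)
      change pairing _ p = _
      congr 1
      funext n
      exact oppositeCoeff_smul_left M c v (n - 1) w)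
    (fun v p q => LinearMap.ext fun w => by
      obtain ⟨N, hN⟩ := oppositeCoeff_shift_trunc M v w
      exact pairing_add_right hN p q)
    (fun c v p => LinearMap.ext fun w => by
      obtain ⟨N, hN⟩ := oppositeCoeff_shift_trunc M v w
      exact pairing_smul_right hN c p)

theorem WeakModule.opp_apply (v : V) (p : Lau) (w : W) :
    M.opp v p w = pairing (fun n => oppositeCoeff M v (n - 1) w) p := rfl

theorem WeakModule.opp_single (v : V) (n : ℤ) (w : W) :
    M.opp v (Lau.single n 1) w = oppositeCoeff M v (n - 1) w := by
  rw [M.opp_apply, pairing_single, one_smul]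

theorem WeakModule.opp_lin_zero_zpow (v : V) (n : ℤ) (w : W) :
    M.opp v (lin 0 ^ n) w = oppositeCoeff M v (-n - 1) w := by
  rw [lin_zero_zpow, M.opp_single]

/-- `Res_x p(x) Yᵒ(v,x)w = 0` if `p` is divisible by a high power of `x⁻¹`. -/
theorem WeakModule.exists_opp_eq_zero (v : V) (w : W) :
    ∃ N : ℤ, ∀ p ∈ deep N, M.opp v p w = 0 := by
  obtain ⟨N, hN⟩ := oppositeCoeff_shift_trunc M v w
  exact ⟨N, fun p hp => pairing_eq_zero hN hp⟩

/-! ### The Jacobi identity for the opposite operators -/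

theorem sum_range_antidiagonal {X : Type*} [AddCommMonoid X] (F : ℕ → ℕ → X) {I D C : ℕ}
    (hI : ∀ i d, I ≤ i → F i d = 0) (hD : ∀ i d, D ≤ d → F i d = 0) (hC : I + D ≤ C) :
    ∑ j ∈ Finset.range C, ∑ p ∈ Finset.HasAntidiagonal.antidiagonal j, F p.1 p.2 =
      ∑ i ∈ Finset.range I, ∑ d ∈ Finset.range D, F i d := by
  rw [← Finset.sum_product', ← Finset.sum_fiberwise_of_maps_to (s := Finset.range I ×ˢ Finset.range D)
    (t := Finset.range C) (g := fun p => p.1 + p.2)]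
  · refine Finset.sum_congr rfl fun j _ => (Finset.sum_subset ?_ ?_).symm
    · intro p hp
      exact Finset.HasAntidiagonal.mem_antidiagonal.2 (Finset.mem_filter.1 hp).2
    · intro p hp hp'
      have h1 := Finset.HasAntidiagonal.mem_antidiagonal.1 hp
      simp only [Finset.mem_filter, Finset.mem_product, Finset.mem_range, h1, and_true, not_and,
        not_lt] at hp'
      rcases lt_or_ge p.1 I with h | h
      · exact hD _ _ (hp' h)
      · exact hI _ _ h
  · intro p hp
    simp only [Finset.mem_product, Finset.mem_range] at hp ⊢
    omega

/-- The opposite operators of `u_k v`, in terms of the vectors `L(1)^a u / a!` and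
`L(1)^b v / b!`. -/
theorem oppositeCoeff_mode {h h' : ℤ} {u v : V} (hu : u ∈ B.grade h) (hv : v ∈ B.grade h')
    {K K' J : ℕ} (hK : ∀ a, K ≤ a → B.divRaise a u = 0) (hK' : ∀ a, K' ≤ a → B.divRaise a v = 0)
    {k : ℤ} (hJ : ∀ a b (d : ℕ), J ≤ d → B.Y (B.divRaise a u) (k + d) (B.divRaise b v) = 0)
    (e : ℤ) (w : W) :
    oppositeCoeff M (B.Y u k v) e w = (-1 : ℂ) ^ (h + h' - k - 1) •
      ∑ a ∈ Finset.range K, ∑ b ∈ Finset.range K', ∑ d ∈ Finset.range J,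
        binom (2 * h - 2 - k - a) d • M.Y (B.Y (B.divRaise a u) (k + d) (B.divRaise b v))
          (e - (a + b + d) + 2 * (h + h' - k - 1) - 1) w := by
  have hzero : ∀ a b d : ℕ, K ≤ a ∨ K' ≤ b ∨ J ≤ d →
      B.Y (B.divRaise a u) (k + d) (B.divRaise b v) = 0 := by
    rintro a b d (ha | hb | hd)
    · rw [hK a ha, map_zero, Pi.zero_apply, LinearMap.zero_apply]
    · rw [hK' b hb, map_zero]
    · exact hJ a b d hd
  have hdm : ∀ c, B.divRaise c (B.Y u k v) = ∑ p ∈ Finset.HasAntidiagonal.antidiagonal c,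
      ∑ q ∈ Finset.HasAntidiagonal.antidiagonal p.1,
        binom (2 * h - 2 - k - q.1) q.2 •
          B.Y (B.divRaise q.1 u) (k + q.2) (B.divRaise p.2 v) := B.divRaise_mode hu k v
  have hvan : ∀ c, K + J + K' ≤ c → B.divRaise c (B.Y u k v) = 0 := fun c hc => by
    rw [hdm]
    refine Finset.sum_eq_zero fun p hp => Finset.sum_eq_zero fun q hq => ?_
    have h1 := Finset.HasAntidiagonal.mem_antidiagonal.1 hp
    have h2 := Finset.HasAntidiagonal.mem_antidiagonal.1 hq
    rw [hzero _ _ _ (by omega), smul_zero]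
  rw [oppositeCoeff_of_mem M (B.mode_mem_grade hu hv k) hvan]
  congr 1
  obtain ⟨F, hF⟩ : ∃ F : ℕ → ℕ → W, ∀ i b, F i b =
      ∑ q ∈ Finset.HasAntidiagonal.antidiagonal i, binom (2 * h - 2 - k - q.1) q.2 •
        M.Y (B.Y (B.divRaise q.1 u) (k + q.2) (B.divRaise b v))
          (e - (q.1 + b + q.2) + 2 * (h + h' - k - 1) - 1) w := ⟨_, fun _ _ => rfl⟩
  have step : ∀ c : ℕ, M.Y (B.divRaise c (B.Y u k v)) (e - c + 2 * (h + h' - k - 1) - 1) w =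
      ∑ p ∈ Finset.HasAntidiagonal.antidiagonal c, F p.1 p.2 := fun c => by
    simp only [hF]
    rw [hdm, map_sum, Finset.sum_apply, LinearMap.sum_apply]
    refine Finset.sum_congr rfl fun p hp => ?_
    rw [map_sum, Finset.sum_apply, LinearMap.sum_apply]
    refine Finset.sum_congr rfl fun q hq => ?_
    have h1 := Finset.HasAntidiagonal.mem_antidiagonal.1 hp
    have h2 := Finset.HasAntidiagonal.mem_antidiagonal.1 hq
    rw [map_smul, Pi.smul_apply, LinearMap.smul_apply,
      show (c : ℤ) = q.1 + p.2 + q.2 by rw [← h1, ← h2]; push_cast; ring]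
  rw [Finset.sum_congr rfl fun c _ => step c, sum_range_antidiagonal F (I := K + J) (D := K')
    ?_ ?_ le_rfl, Finset.sum_comm, Finset.sum_comm (s := Finset.range K)]
  · refine Finset.sum_congr rfl fun b _ => ?_
    simp only [hF]
    exact sum_range_antidiagonal (fun a d => binom (2 * h - 2 - k - a) d •
      M.Y (B.Y (B.divRaise a u) (k + d) (B.divRaise b v))
        (e - (a + b + d) + 2 * (h + h' - k - 1) - 1) w) (I := K) (D := J)
      (fun a d ha => by rw [hzero _ _ _ (Or.inl ha)]; simp)
      (fun a d hd => by rw [hzero _ _ _ (Or.inr (Or.inr hd))]; simp) le_rfl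
  · intro i b hi
    rw [hF]
    refine Finset.sum_eq_zero fun q hq => ?_
    have h2 := Finset.HasAntidiagonal.mem_antidiagonal.1 hq
    rw [hzero _ _ _ (by omega)]
    simp
  · intro i b hb
    rw [hF]
    refine Finset.sum_eq_zero fun q hq => ?_
    rw [hzero _ _ _ (by omega)]
    simp

/-- The left side of the opposite Jacobi identity, `∑_{i ≥ 0} (m choose i) (u_{l+i} v)ᵒ_{m+n-i} w`,
where `vᵒ_n = Res x^n Yᵒ(v,x)`. -/
def oppJacobiLHS (u v : V) (l m n : ℤ) (w : W) : W :=
  ∑ᶠ i : ℕ, binom m i • oppositeCoeff M (B.Y u (l + i) v) (-(m + n - i) - 1) w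

/-- The right side of the opposite Jacobi identity,
`∑_{i ≥ 0} (-1)^i (l choose i) (vᵒ_{n+i} uᵒ_{m+l-i} w - (-1)^l uᵒ_{m+i} vᵒ_{n+l-i} w)`. In comparison
with `jacobiRHS`, the order of the operators is reversed. -/
def oppJacobiRHS (u v : V) (l m n : ℤ) (w : W) : W :=
  ∑ᶠ i : ℕ, ((-1 : ℂ) ^ i * binom l i) •
    (oppositeCoeff M v (-(n + i) - 1) (oppositeCoeff M u (-(m + l - i) - 1) w) -
      (-1 : ℂ) ^ l •
        oppositeCoeff M u (-(m + i) - 1) (oppositeCoeff M v (-(n + l - i) - 1) w))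

/-- The left side of the opposite Jacobi identity is a combination of left sides of the Jacobi identity
of `W` for the vectors `L(1)^a u / a!` and `L(1)^b v / b!`. -/
theorem oppJacobiLHS_of_mem {h h' : ℤ} {u v : V} (hu : u ∈ B.grade h) (hv : v ∈ B.grade h')
    {K K' : ℕ} (hK : ∀ a, K ≤ a → B.divRaise a u = 0) (hK' : ∀ a, K' ≤ a → B.divRaise a v = 0)
    (l m n : ℤ) (w : W) :
    oppJacobiLHS M u v l m n w = (-(-1 : ℂ) ^ (h + h' + l)) •
      ∑ a ∈ Finset.range K, ∑ b ∈ Finset.range K',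
        jacobiLHS B.toVertexData M.Y (B.divRaise a u) (B.divRaise b v) l (2 * h - 2 - l - a - m)
          (2 * h' - 2 - l - b - n) w := by
  obtain ⟨N, hN⟩ : ∃ N : ℤ, ∀ a b, ∀ d, N ≤ d → B.Y (B.divRaise a u) d (B.divRaise b v) = 0 := by
    have h1 : ∀ b, ∃ N : ℤ, ∀ a < K, ∀ d, N ≤ d → B.Y (B.divRaise a u) d (B.divRaise b v) = 0 :=
      fun b => B.truncModes.exists_uniform (fun a => B.divRaise a u) K _
    choose N hN using h1
    obtain ⟨N', hN'⟩ : ∃ N' : ℤ, ∀ b < K', N b ≤ N' := by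
      refine ⟨∑ b ∈ Finset.range K', |N b|, fun b hb => (le_abs_self _).trans ?_⟩
      exact Finset.single_le_sum (f := fun b => |N b|) (fun _ _ => abs_nonneg _)
        (Finset.mem_range.2 hb)
    refine ⟨N', fun a b d hd => ?_⟩
    rcases lt_or_ge a K with ha | ha
    · rcases lt_or_ge b K' with hb | hb
      · exact hN b a ha d ((hN' b hb).trans hd)
      · rw [hK' b hb, map_zero]
    · rw [hK a ha, map_zero, Pi.zero_apply, LinearMap.zero_apply]
  obtain ⟨J, hJ⟩ : ∃ J : ℕ, N ≤ l + J := ⟨(N - l).toNat, by omega⟩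
  have huv : ∀ i : ℕ, J ≤ i → B.Y u (l + i) v = 0 := fun i hi => by
    have := hN 0 0 (l + i) (by omega)
    rwa [B.divRaise_zero, B.divRaise_zero] at this
  unfold oppJacobiLHS
  rw [finsum_eq_sum_of_support_subset (s := Finset.range J)]
  swap
  · intro i hi
    rw [Finset.coe_range, Set.mem_Iio]
    by_contra hlt
    exact hi (by dsimp only; rw [huv i (by omega), oppositeCoeff_zero_left, smul_zero])
  have step : ∀ i : ℕ, binom m i • oppositeCoeff M (B.Y u (l + i) v) (-(m + n - i) - 1) w =
      (-(-1 : ℂ) ^ (h + h' + l)) • ∑ a ∈ Finset.range K, ∑ b ∈ Finset.range K',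
        ∑ d ∈ Finset.range J, ((-1 : ℂ) ^ i * binom m i * binom (2 * h - 2 - l - a - i) d) •
          M.Y (B.Y (B.divRaise a u) (l + ((i + d : ℕ) : ℤ)) (B.divRaise b v))
            (2 * h - 2 - l - a - m + (2 * h' - 2 - l - b - n) - ((i + d : ℕ) : ℤ)) w := fun i => by
    rw [oppositeCoeff_mode M hu hv hK hK' (k := l + i) (J := J)
      (fun a b d hd => hN a b _ (by omega)), smul_smul]
    have hs : binom m i * (-1 : ℂ) ^ (h + h' - (l + i) - 1) =
        -(-1 : ℂ) ^ (h + h' + l) * ((-1 : ℂ) ^ i * binom m i) := by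
      have h1 : (-1 : ℂ) ^ (h + h' - (l + i) - 1) = -(-1 : ℂ) ^ (h + h' + l) * (-1 : ℂ) ^ i := by
        rw [show h + h' - (l + i) - 1 = (h + h' + l + i) - 2 * (l + i) - 1 by ring,
          zpow_sub_one₀ (by norm_num), zpow_sub₀ (by norm_num), zpow_mul, zpow_add₀ (by norm_num)]
        norm_num
      rw [h1]
      ring
    rw [hs, mul_smul]
    simp only [Finset.smul_sum]
    refine Finset.sum_congr rfl fun a _ => Finset.sum_congr rfl fun b _ =>
      Finset.sum_congr rfl fun d _ => ?_
    rw [smul_smul ((-1 : ℂ) ^ i * binom m i), show 2 * h - 2 - (l + i) - (a : ℤ) = 2 * h - 2 - l - a - i by ring,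
      show l + (i : ℤ) + d = l + ((i + d : ℕ) : ℤ) by push_cast; ring]
    congr 4
    push_cast
    ring_nf
  rw [Finset.sum_congr rfl fun i _ => step i, ← Finset.smul_sum, Finset.sum_comm]
  congr 1
  refine Finset.sum_congr rfl fun a _ => ?_
  rw [Finset.sum_comm]
  refine Finset.sum_congr rfl fun b _ => ?_
  rw [jacobiLHS_eq_sum M.Y (hN a b) l _ _ w (K := J + J) (by push_cast; omega)]
  have hz : ∀ j : ℕ, J ≤ j → B.Y (B.divRaise a u) (l + (j : ℤ)) (B.divRaise b v) = 0 :=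
    fun j hj => hN a b _ (by omega)
  rw [← sum_range_antidiagonal (fun i d => ((-1 : ℂ) ^ i * binom m i *
    binom (2 * h - 2 - l - a - i) d) •
          M.Y (B.Y (B.divRaise a u) (l + ((i + d : ℕ) : ℤ)) (B.divRaise b v))
            (2 * h - 2 - l - a - m + (2 * h' - 2 - l - b - n) - ((i + d : ℕ) : ℤ)) w)
    (fun i d hi => by rw [hz _ (by omega)]; simp) (fun i d hi => by rw [hz _ (by omega)]; simp)
    le_rfl]
  refine Finset.sum_congr rfl fun j _ => ?_
  rw [← sum_binom_mul_binom_sub, Finset.sum_smul]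
  refine Finset.sum_congr rfl fun p hp => ?_
  rw [Finset.HasAntidiagonal.mem_antidiagonal.1 hp]

/-- The product of two opposite operators. -/
theorem oppositeCoeff_oppositeCoeff_of_mem {h h' : ℤ} {u v : V} (hu : u ∈ B.grade h)
    (hv : v ∈ B.grade h') {K K' : ℕ} (hK : ∀ a, K ≤ a → B.divRaise a u = 0)
    (hK' : ∀ a, K' ≤ a → B.divRaise a v = 0) (e e' : ℤ) (w : W) :
    oppositeCoeff M v e (oppositeCoeff M u e' w) = ((-1 : ℂ) ^ h * (-1 : ℂ) ^ h') •
      ∑ a ∈ Finset.range K, ∑ b ∈ Finset.range K', M.Y (B.divRaise b v) (e - b + 2 * h' - 1)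
        (M.Y (B.divRaise a u) (e' - a + 2 * h - 1) w) := by
  rw [oppositeCoeff_of_mem M hv hK', oppositeCoeff_of_mem M hu hK, Finset.sum_comm]
  simp only [map_smul, map_sum, ← Finset.smul_sum, smul_smul]
  rw [mul_comm]

/-- The right side of the opposite Jacobi identity is the same combination of right sides of the Jacobi
identity of `W`. -/
theorem oppJacobiRHS_of_mem {h h' : ℤ} {u v : V} (hu : u ∈ B.grade h) (hv : v ∈ B.grade h')
    {K K' : ℕ} (hK : ∀ a, K ≤ a → B.divRaise a u = 0) (hK' : ∀ a, K' ≤ a → B.divRaise a v = 0)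
    (l m n : ℤ) (w : W) :
    oppJacobiRHS M u v l m n w = (-(-1 : ℂ) ^ (h + h' + l)) •
      ∑ a ∈ Finset.range K, ∑ b ∈ Finset.range K',
        jacobiRHS M.Y (B.divRaise a u) (B.divRaise b v) l (2 * h - 2 - l - a - m)
          (2 * h' - 2 - l - b - n) w := by
  have hsupp : ∀ p : ℕ × ℕ, _ := fun p => jacobiRHS_support M.Y M.trunc (B.divRaise p.1 u)
    (B.divRaise p.2 v) l (2 * h - 2 - l - p.1 - m) (2 * h' - 2 - l - p.2 - n) w
  have hprod := Finset.sum_product (Finset.range K) (Finset.range K') fun p : ℕ × ℕ =>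
    jacobiRHS M.Y (B.divRaise p.1 u) (B.divRaise p.2 v) l (2 * h - 2 - l - p.1 - m)
      (2 * h' - 2 - l - p.2 - n) w
  rw [← hprod]
  unfold oppJacobiRHS jacobiRHS
  rw [← finsum_sum_comm _ _ (fun p _ => hsupp p), smul_finsum' _ ?_]
  · refine finsum_congr fun i => ?_
    rw [Finset.sum_product]
    simp only [← Finset.smul_sum]
    rw [smul_comm]
    congr 1
    rw [oppositeCoeff_oppositeCoeff_of_mem M hu hv hK hK',
      oppositeCoeff_oppositeCoeff_of_mem M hv hu hK' hK,
      Finset.sum_comm (s := Finset.range K') (t := Finset.range K)]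
    simp only [Finset.sum_sub_distrib, ← Finset.smul_sum]
    have hs : (-1 : ℂ) ^ l * (-1 : ℂ) ^ l = 1 := by
      rw [← zpow_add₀ (by norm_num), Even.neg_one_zpow ⟨l, rfl⟩]
    have e1 : ∑ a ∈ Finset.range K, ∑ b ∈ Finset.range K',
        M.Y (B.divRaise b v) (-(n + i) - 1 - b + 2 * h' - 1)
          (M.Y (B.divRaise a u) (-(m + l - i) - 1 - a + 2 * h - 1) w) =
        ∑ a ∈ Finset.range K, ∑ b ∈ Finset.range K',
        M.Y (B.divRaise b v) (2 * h' - 2 - l - b - n + l - i)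
          (M.Y (B.divRaise a u) (2 * h - 2 - l - a - m + i) w) := by
      refine Finset.sum_congr rfl fun a _ => Finset.sum_congr rfl fun b _ => ?_
      rw [show -(n + (i : ℤ)) - 1 - b + 2 * h' - 1 = 2 * h' - 2 - l - b - n + l - i by ring,
        show -(m + l - (i : ℤ)) - 1 - a + 2 * h - 1 = 2 * h - 2 - l - a - m + i by ring]
    have e2 : ∑ a ∈ Finset.range K, ∑ b ∈ Finset.range K',
        M.Y (B.divRaise a u) (-(m + i) - 1 - a + 2 * h - 1)
          (M.Y (B.divRaise b v) (-(n + l - i) - 1 - b + 2 * h' - 1) w) =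
        ∑ a ∈ Finset.range K, ∑ b ∈ Finset.range K',
        M.Y (B.divRaise a u) (2 * h - 2 - l - a - m + l - i)
          (M.Y (B.divRaise b v) (2 * h' - 2 - l - b - n + i) w) := by
      refine Finset.sum_congr rfl fun a _ => Finset.sum_congr rfl fun b _ => ?_
      rw [show -(m + (i : ℤ)) - 1 - a + 2 * h - 1 = 2 * h - 2 - l - a - m + l - i by ring,
        show -(n + l - (i : ℤ)) - 1 - b + 2 * h' - 1 = 2 * h' - 2 - l - b - n + i by ring]
    rw [e1, e2, zpow_add₀ (by norm_num), zpow_add₀ (by norm_num), smul_sub, smul_smul, smul_smul,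
      show -((-1 : ℂ) ^ h * (-1) ^ h' * (-1) ^ l) * (-1) ^ l = -((-1 : ℂ) ^ h * (-1) ^ h') by
        linear_combination (-((-1 : ℂ) ^ h * (-1) ^ h')) * hs]
    module
  · refine (Set.Finite.biUnion (Finset.range K ×ˢ Finset.range K').finite_toSet
      fun p _ => hsupp p).subset fun i hi => ?_
    by_contra hcon
    refine hi (Finset.sum_eq_zero fun p hp => ?_)
    by_contra hne
    exact hcon (Set.mem_biUnion hp hne)

/-- The Jacobi identity for the opposite operators of homogeneous vectors. -/
theorem oppJacobi_of_mem {h h' : ℤ} {u v : V} (hu : u ∈ B.grade h) (hv : v ∈ B.grade h')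
    (l m n : ℤ) (w : W) : oppJacobiLHS M u v l m n w = oppJacobiRHS M u v l m n w := by
  obtain ⟨K, hK⟩ := B.exists_divRaise_eq_zero hu
  obtain ⟨K', hK'⟩ := B.exists_divRaise_eq_zero hv
  rw [oppJacobiLHS_of_mem M hu hv hK hK', oppJacobiRHS_of_mem M hu hv hK hK']
  simp only [M.jacobi]

theorem oppJacobiLHS_support (u v : V) (l m n : ℤ) (w : W) :
    (Function.support fun i : ℕ =>
      binom m i • oppositeCoeff M (B.Y u (l + i) v) (-(m + n - i) - 1) w).Finite := by
  obtain ⟨N, hN⟩ := B.trunc u v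
  refine finite_support_of_le (N - l) fun i hi => ?_
  rw [hN _ (by omega), oppositeCoeff_zero_left, smul_zero]

theorem oppositeCoeff_zero_right (v : V) (e : ℤ) : oppositeCoeff M v e 0 = 0 := by
  have := oppositeCoeff_smul_right M 0 v e 0
  rwa [zero_smul, zero_smul] at this

theorem oppJacobiRHS_support (u v : V) (l m n : ℤ) (w : W) :
    (Function.support fun i : ℕ => ((-1 : ℂ) ^ i * binom l i) •
    (oppositeCoeff M v (-(n + i) - 1) (oppositeCoeff M u (-(m + l - i) - 1) w) -
      (-1 : ℂ) ^ l •
        oppositeCoeff M u (-(m + i) - 1) (oppositeCoeff M v (-(n + l - i) - 1) w))).Finite := by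
  obtain ⟨N, hN⟩ := oppositeCoeff_trunc M u w
  obtain ⟨N', hN'⟩ := oppositeCoeff_trunc M v w
  refine finite_support_of_le (max (N + m + l + 1) (N' + n + l + 1)) fun i hi => ?_
  rw [hN _ (by omega), hN' _ (by omega), oppositeCoeff_zero_right, oppositeCoeff_zero_right,
    smul_zero, sub_zero, smul_zero]

/-- The Jacobi identity for the opposite operators. -/
theorem oppJacobi (u v : V) (l m n : ℤ) (w : W) :
    oppJacobiLHS M u v l m n w = oppJacobiRHS M u v l m n w := by
  induction u using B.induction_grade with
  | h0 => simp [oppJacobiLHS, oppJacobiRHS, oppositeCoeff_zero_left, oppositeCoeff_zero_right]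
  | hadd u u' hu hu' =>
    have h1 : oppJacobiLHS M (u + u') v l m n w =
        oppJacobiLHS M u v l m n w + oppJacobiLHS M u' v l m n w := by
      unfold oppJacobiLHS
      rw [← finsum_add_distrib (oppJacobiLHS_support M u v l m n w)
        (oppJacobiLHS_support M u' v l m n w)]
      simp only [map_add, Pi.add_apply, LinearMap.add_apply, oppositeCoeff_add_left, smul_add]
    have h2 : oppJacobiRHS M (u + u') v l m n w =
        oppJacobiRHS M u v l m n w + oppJacobiRHS M u' v l m n w := by
      unfold oppJacobiRHS
      rw [← finsum_add_distrib (oppJacobiRHS_support M u v l m n w)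
        (oppJacobiRHS_support M u' v l m n w)]
      refine finsum_congr fun i => ?_
      simp only [oppositeCoeff_add_left, oppositeCoeff_add_right]
      module
    rw [h1, h2, hu, hu']
  | hg h u hu =>
    induction v using B.induction_grade with
    | h0 => simp [oppJacobiLHS, oppJacobiRHS, oppositeCoeff_zero_left, oppositeCoeff_zero_right]
    | hadd v v' hv hv' =>
      have h1 : oppJacobiLHS M u (v + v') l m n w =
          oppJacobiLHS M u v l m n w + oppJacobiLHS M u v' l m n w := by
        unfold oppJacobiLHS
        rw [← finsum_add_distrib (oppJacobiLHS_support M u v l m n w)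
          (oppJacobiLHS_support M u v' l m n w)]
        simp only [map_add, oppositeCoeff_add_left, smul_add]
      have h2 : oppJacobiRHS M u (v + v') l m n w =
          oppJacobiRHS M u v l m n w + oppJacobiRHS M u v' l m n w := by
        unfold oppJacobiRHS
        rw [← finsum_add_distrib (oppJacobiRHS_support M u v l m n w)
          (oppJacobiRHS_support M u v' l m n w)]
        refine finsum_congr fun i => ?_
        simp only [oppositeCoeff_add_left, oppositeCoeff_add_right]
        module
      rw [h1, h2, hv, hv']
    | hg h' v hv => exact oppJacobi_of_mem M hu hv l m n w

end Opposite

/-! ### The opposite operators with test functions -/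

section GeomSum

variable {X : Type u₂} [AddCommGroup X] [Module ℂ X]

/-- The sum `∑_{i ≥ 0} β(p (x-c)^i, q (x-c)^(-1-i))`, which is the residue in both variables of
`p(x₁) q(x₂) (x₂ - x₁)⁻¹`, expanded in nonnegative powers of `x₁ - c`. -/
def geomSum (c : ℂ) (β : Lau →ₗ[ℂ] Lau →ₗ[ℂ] X) (p q : Lau) : X :=
  ∑ᶠ i : ℕ, β (p * lin c ^ i) (q * lin c ^ (-1 - (i : ℤ)))

/-- The bilinear map `β` vanishes when its second argument is divisible by a fixed power of
`x⁻¹`. -/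
def IsContSnd (β : Lau →ₗ[ℂ] Lau →ₗ[ℂ] X) : Prop := ∃ N : ℤ, ∀ p, ∀ q ∈ deep N, β p q = 0

variable {β : Lau →ₗ[ℂ] Lau →ₗ[ℂ] X}

theorem geomSum_term_eq_zero {N N' : ℤ} (hβ : ∀ p, ∀ q ∈ deep N, β p q = 0) (c : ℂ) (p : Lau)
    {q : Lau} (hq : q ∈ deep N') {i : ℕ} (hi : N ≤ N' + 1 + i) :
    β (p * lin c ^ i) (q * lin c ^ (-1 - (i : ℤ))) = 0 := by
  refine hβ _ _ (deep_antitone ?_ (mul_mem_deep hq (lin_zpow_mem_deep c _)))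
  omega

theorem geomSum_support (hβ : IsContSnd β) (c : ℂ) (p q : Lau) : (Function.support fun i : ℕ =>
    β (p * lin c ^ i) (q * lin c ^ (-1 - (i : ℤ)))).Finite := by
  obtain ⟨N, hN⟩ := hβ
  exact finite_support_of_le (N - q.order - 1) fun i hi =>
    geomSum_term_eq_zero hN c p (order_mem_deep q) (by omega)

theorem geomSum_eq_zero {N : ℤ} (hβ : ∀ p, ∀ q ∈ deep N, β p q = 0) (c : ℂ) (p : Lau)
    {q : Lau} (hq : q ∈ deep N) : geomSum c β p q = 0 :=
  finsum_eq_zero_of_forall_eq_zero fun i => geomSum_term_eq_zero hβ c p hq (by omega)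

/-- The sum `geomSum`, as a bilinear map. -/
def geomSumHom (c : ℂ) (hβ : IsContSnd β) : Lau →ₗ[ℂ] Lau →ₗ[ℂ] X :=
  LinearMap.mk₂ ℂ (geomSum c β)
    (fun p p' q => by
      unfold geomSum
      rw [← finsum_add_distrib (geomSum_support hβ c p q) (geomSum_support hβ c p' q)]
      simp only [add_mul, map_add, LinearMap.add_apply])
    (fun a p q => by
      unfold geomSum
      rw [smul_finsum' _ (geomSum_support hβ c p q)]
      simp only [smul_mul_assoc, map_smul, LinearMap.smul_apply])
    (fun p q q' => by
      unfold geomSum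
      rw [← finsum_add_distrib (geomSum_support hβ c p q) (geomSum_support hβ c p q')]
      simp only [add_mul, map_add])
    (fun a p q => by
      unfold geomSum
      rw [smul_finsum' _ (geomSum_support hβ c p q)]
      simp only [smul_mul_assoc, map_smul])

theorem geomSumHom_apply (c : ℂ) (hβ : IsContSnd β) (p q : Lau) :
    geomSumHom c hβ p q = geomSum c β p q := rfl

/-- The telescoping identity that characterizes `geomSum`. -/
theorem geomSum_lin_mul (hβ : IsContSnd β) (c : ℂ) (p q : Lau) :
    geomSum c β p (lin c * q) - geomSum c β (lin c * p) q = β p q := by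
  obtain ⟨N, hN⟩ := hβ
  obtain ⟨K, hK⟩ : ∃ K : ℕ, N ≤ q.order + K := ⟨(N - q.order).toNat, by omega⟩
  have e1 : ∀ i : ℕ, β (p * lin c ^ i) (lin c * q * lin c ^ (-1 - (i : ℤ))) =
      β (p * lin c ^ i) (q * lin c ^ (-(i : ℤ))) := fun i => by
    rw [mul_comm (lin c) q, mul_assoc, ← zpow_one_add₀ (lin_ne_zero c)]
    congr 3
    ring
  have e2 : ∀ i : ℕ, β (lin c * p * lin c ^ i) (q * lin c ^ (-1 - (i : ℤ))) =
      β (p * lin c ^ (i + 1)) (q * lin c ^ (-((i + 1 : ℕ) : ℤ))) := fun i => by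
    rw [mul_comm (lin c) p, mul_assoc, ← pow_succ']
    congr 3
    push_cast
    ring
  have h1 : geomSum c β p (lin c * q) = ∑ i ∈ Finset.range (K + 1),
      β (p * lin c ^ i) (lin c * q * lin c ^ (-1 - (i : ℤ))) := by
    refine finsum_eq_sum_of_support_subset _ fun i hi => ?_
    rw [Finset.coe_range, Set.mem_Iio]
    by_contra h
    exact hi (geomSum_term_eq_zero hN c p (mul_mem_deep (lin_mem_deep c) (order_mem_deep q))
      (by omega))
  have h2 : geomSum c β (lin c * p) q = ∑ i ∈ Finset.range K,
      β (lin c * p * lin c ^ i) (q * lin c ^ (-1 - (i : ℤ))) := by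
    refine finsum_eq_sum_of_support_subset _ fun i hi => ?_
    rw [Finset.coe_range, Set.mem_Iio]
    by_contra h
    exact hi (geomSum_term_eq_zero hN c _ (order_mem_deep q) (by omega))
  rw [h1, h2]
  simp only [e1, e2]
  rw [Finset.sum_range_succ']
  simp

/-- The sum `geomSum` does not depend on the point `c`. -/
theorem geomSum_eq (hβ : IsContSnd β) (c c' : ℂ) (p q : Lau) :
    geomSum c β p q = geomSum c' β p q := by
  obtain ⟨D, hD⟩ : ∃ D, D = geomSumHom c hβ - geomSumHom c' hβ := ⟨_, rfl⟩
  have hshift : ∀ p q, D p (lin c * q) = D (lin c * p) q := fun p q => by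
    have h1 := geomSum_lin_mul hβ c p q
    have h2 : geomSum c' β p (lin c * q) - geomSum c' β (lin c * p) q = β p q := by
      rw [← geomSum_lin_mul hβ c' p q]
      simp only [← geomSumHom_apply _ hβ, lin_eq_sub c c', sub_mul, map_sub, smul_mul_assoc,
        one_mul, map_smul, LinearMap.sub_apply, LinearMap.smul_apply]
      abel
    simp only [hD, LinearMap.sub_apply, geomSumHom_apply]
    rw [sub_eq_iff_eq_add] at h1 h2
    rw [h1, h2]
    abel
  -- The two sums satisfy the same telescoping identity, so powers of `x - c` can be moved in their
  -- difference until the second argument is divisible by a high power of `x⁻¹`.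
  have hpow : ∀ (k : ℕ) p q, D p q = D (lin c ^ k * p) (lin c ^ (-(k : ℤ)) * q) := fun k => by
    induction k with
    | zero => simp
    | succ k ih =>
      intro p q
      rw [ih, pow_succ', mul_assoc, ← hshift, ← mul_assoc (lin c), ← zpow_one_add₀ (lin_ne_zero c)]
      congr 3
      push_cast
      ring
  obtain ⟨N, hN⟩ := id hβ
  rw [← sub_eq_zero, ← geomSumHom_apply c hβ, ← geomSumHom_apply c' hβ, ← LinearMap.sub_apply,
    ← LinearMap.sub_apply, ← hD, hpow (N - q.order).toNat, hD, LinearMap.sub_apply, LinearMap.sub_apply, geomSumHom_apply, geomSumHom_apply]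
  have hq : lin c ^ (-((N - q.order).toNat : ℤ)) * q ∈ deep N :=
    deep_antitone (by omega) (mul_mem_deep (lin_zpow_mem_deep c _) (order_mem_deep q))
  rw [geomSum_eq_zero hN c _ hq, geomSum_eq_zero hN c' _ hq, sub_zero]

theorem isCont_geomSumHom (c : ℂ) (hβ : IsContSnd β) (p : Lau) : IsCont (geomSumHom c hβ p) := by
  obtain ⟨N, hN⟩ := hβ
  exact ⟨N, fun q hq => geomSum_eq_zero hN c p hq⟩

theorem isCont_geomSumHom_flip (c : ℂ) (hβ : IsContSnd β) (hβ' : ∀ q, IsCont (β.flip q)) (q : Lau) :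
    IsCont ((geomSumHom c hβ).flip q) := by
  obtain ⟨N, hN⟩ := hβ
  choose M hM using hβ'
  obtain ⟨K, hK⟩ : ∃ K : ℕ, N ≤ q.order + 1 + K := ⟨(N - q.order - 1).toNat, by omega⟩
  refine ⟨∑ i ∈ Finset.range K, |M (q * lin c ^ (-1 - (i : ℤ)))| + K, fun p hp => ?_⟩
  refine finsum_eq_zero_of_forall_eq_zero fun i => ?_
  rcases lt_or_ge i K with h | h
  · refine hM _ _ (deep_antitone ?_ (mul_mem_deep hp (lin_zpow_mem_deep c i)))
    have := Finset.single_le_sum (f := fun i : ℕ => |M (q * lin c ^ (-1 - (i : ℤ)))|)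
      (fun _ _ => abs_nonneg _) (Finset.mem_range.2 h)
    have := le_abs_self (M (q * lin c ^ (-1 - (i : ℤ))))
    omega
  · exact geomSum_term_eq_zero hN c p (order_mem_deep q) (by omega)

theorem IsCont.comp_hasse {φ : Lau →ₗ[ℂ] X} (hφ : IsCont φ) (i : ℕ) : IsCont (φ ∘ₗ hasse i) := by
  obtain ⟨N, hN⟩ := hφ
  exact ⟨N, fun p hp => hN _ (deep_antitone (by omega) (hasse_mem_deep hp i))⟩

end GeomSum

section OppTest

variable {V : Type u₁} [AddCommGroup V] [Module ℂ V] {B : VertexOperatorAlgebra V}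
  {W : Type u₂} [AddCommGroup W] [Module ℂ W] (M : WeakModule B.toVertexData W)

theorem isCont_opp (v : V) (w : W) : IsCont ((M.opp v).flip w) := M.exists_opp_eq_zero v w

/-- The bilinear map `(p, q) ↦ Res p(x₁) Yᵒ(u,x₁) (Res q(x₂) Yᵒ(v,x₂)w)`. -/
def WeakModule.oppOpp (u v : V) (w : W) : Lau →ₗ[ℂ] Lau →ₗ[ℂ] W :=
  LinearMap.mk₂ ℂ (fun p q => M.opp u p (M.opp v q w)) (by simp) (by simp) (by simp) (by simp)

theorem WeakModule.oppOpp_apply (u v : V) (w : W) (p q : Lau) :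
    M.oppOpp u v w p q = M.opp u p (M.opp v q w) := rfl

theorem isContSnd_oppOpp (u v : V) (w : W) : IsContSnd (M.oppOpp u v w) := by
  obtain ⟨N, hN⟩ := M.exists_opp_eq_zero v w
  exact ⟨N, fun p q hq => by rw [M.oppOpp_apply, hN q hq, map_zero]⟩

theorem isCont_oppOpp_flip (u v : V) (w : W) (q : Lau) : IsCont ((M.oppOpp u v w).flip q) :=
  isCont_opp M u (M.opp v q w)

theorem isCont_oppOpp (u v : V) (w : W) (p : Lau) : IsCont (M.oppOpp u v w p) := by
  obtain ⟨N, hN⟩ := isContSnd_oppOpp M u v w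
  exact ⟨N, hN p⟩

/-- The bilinear map `(p, q) ↦ ∑_{i<I} Res (1/i!) p^(i)(x) q(x) Yᵒ(a_i,x)w`. -/
def WeakModule.oppHasse (a : ℕ → V) (I : ℕ) (w : W) : Lau →ₗ[ℂ] Lau →ₗ[ℂ] W :=
  LinearMap.mk₂ ℂ (fun p q => ∑ i ∈ Finset.range I, M.opp (a i) (hasse i p * q) w)
    (fun p p' q => by simp [add_mul, Finset.sum_add_distrib])
    (fun c p q => by simp [Finset.smul_sum])
    (fun p q q' => by simp [mul_add, Finset.sum_add_distrib])
    (fun c p q => by simp [Finset.smul_sum])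

theorem WeakModule.oppHasse_apply (a : ℕ → V) (I : ℕ) (w : W) (p q : Lau) :
    M.oppHasse a I w p q = ∑ i ∈ Finset.range I, M.opp (a i) (hasse i p * q) w := rfl

theorem isCont_oppHasse (a : ℕ → V) (I : ℕ) (w : W) (p : Lau) : IsCont (M.oppHasse a I w p) := by
  have : M.oppHasse a I w p = ∑ i ∈ Finset.range I,
      (M.opp (a i)).flip w ∘ₗ LinearMap.mulLeft ℂ (hasse i p) :=
    LinearMap.ext fun q => by simp [M.oppHasse_apply]
  rw [this]
  exact IsCont.sum _ fun i _ => (isCont_opp M (a i) w).comp_mul _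

theorem isCont_oppHasse_flip (a : ℕ → V) (I : ℕ) (w : W) (q : Lau) :
    IsCont ((M.oppHasse a I w).flip q) := by
  have : (M.oppHasse a I w).flip q = ∑ i ∈ Finset.range I,
      ((M.opp (a i)).flip w ∘ₗ LinearMap.mulLeft ℂ q) ∘ₗ hasse i :=
    LinearMap.ext fun p => by simp [M.oppHasse_apply, mul_comm q]
  rw [this]
  exact IsCont.sum _ fun i _ => ((isCont_opp M (a i) w).comp_mul _).comp_hasse i

/-- Separately continuous bilinear maps that agree on the powers of `x` are equal. -/
theorem eq_of_isCont {X : Type u₂} [AddCommGroup X] [Module ℂ X] {β γ : Lau →ₗ[ℂ] Lau →ₗ[ℂ] X}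
    (hβ : ∀ p, IsCont (β p)) (hβ' : ∀ q, IsCont (β.flip q)) (hγ : ∀ p, IsCont (γ p))
    (hγ' : ∀ q, IsCont (γ.flip q)) (h : ∀ m n : ℤ, β (lin 0 ^ m) (lin 0 ^ n) =
      γ (lin 0 ^ m) (lin 0 ^ n)) (p q : Lau) : β p q = γ p q := by
  have e : ∀ n : ℤ, Lau.single n 1 = lin 0 ^ (-n) := fun n => by rw [lin_zero_zpow, neg_neg]
  have h1 : ∀ (m : ℤ) (q : Lau), β (lin 0 ^ m) q = γ (lin 0 ^ m) q := fun m q =>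
    LinearMap.congr_fun (IsCont.ext (hβ _) (hγ _) fun n => by rw [e, h]) q
  exact LinearMap.congr_fun (IsCont.ext (hβ' q) (hγ' q) fun n => by
    rw [LinearMap.flip_apply, LinearMap.flip_apply, e, h1]) p

theorem opp_hasse_lin_zpow (v : V) (m n : ℤ) (i : ℕ) (w : W) :
    M.opp v (hasse i (lin 0 ^ m) * lin 0 ^ n) w =
      binom m i • oppositeCoeff M v (-(m + n - i) - 1) w := by
  rw [hasse_lin_zpow, smul_mul_assoc, ← zpow_add₀ (lin_ne_zero 0), map_smul, LinearMap.smul_apply,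
    M.opp_lin_zero_zpow, show m - i + n = m + n - i by ring]

/-- The commutator formula for the opposite operators. -/
theorem opp_commutator {u v : V} {I : ℕ} (hI : ∀ i : ℕ, I ≤ i → B.Y u i v = 0) (p q : Lau)
    (w : W) : M.opp v q (M.opp u p w) - M.opp u p (M.opp v q w) =
      ∑ i ∈ Finset.range I, M.opp (B.Y u i v) (hasse i p * q) w := by
  refine eq_of_isCont (β := (M.oppOpp v u w).flip - M.oppOpp u v w)
    (γ := M.oppHasse (fun i => B.Y u i v) I w)
    (fun p => ?_) (fun q => ?_) (isCont_oppHasse M _ _ _) (isCont_oppHasse_flip M _ _ _) ?_ p q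
  · exact (isCont_oppOpp_flip M v u w p).sub (isCont_oppOpp M u v w p)
  · exact (isCont_oppOpp M v u w q).sub (isCont_oppOpp_flip M u v w q)
  · intro m n
    have h := oppJacobi M u v 0 m n w
    rw [oppJacobiLHS, oppJacobiRHS, finsum_eq_sum_of_support_subset (s := Finset.range I),
      finsum_eq_single _ 0] at h
    · simp only [LinearMap.sub_apply, LinearMap.flip_apply, M.oppOpp_apply, M.oppHasse_apply,
        M.opp_lin_zero_zpow, opp_hasse_lin_zpow]
      simpa [binom_zero_right] using h.symm
    · intro i hi
      simp [binom_zero_left, hi]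
    · intro i hi
      rw [Finset.coe_range, Set.mem_Iio]
      by_contra hlt
      exact hi (by
        dsimp only
        rw [zero_add, hI i (by omega), oppositeCoeff_zero_left, smul_zero])

/-- The formula for the opposite operators of `u_{-1}v`. -/
theorem opp_normal {u v : V} {I : ℕ} (hI : ∀ i : ℕ, I ≤ i → B.Y u (-1 + i) v = 0) (c : ℂ)
    (p q : Lau) (w : W) : ∑ i ∈ Finset.range I, M.opp (B.Y u (-1 + i) v) (hasse i p * q) w =
      geomSum c (M.oppOpp v u w) q p + geomSum c (M.oppOpp u v w) p q := by
  rw [geomSum_eq (isContSnd_oppOpp M v u w) c 0, geomSum_eq (isContSnd_oppOpp M u v w) c 0]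
  refine eq_of_isCont (β := M.oppHasse (fun i => B.Y u (-1 + i) v) I w)
    (γ := (geomSumHom 0 (isContSnd_oppOpp M v u w)).flip + geomSumHom 0 (isContSnd_oppOpp M u v w))
    (isCont_oppHasse M _ _ _) (isCont_oppHasse_flip M _ _ _) (fun p => ?_) (fun q => ?_) ?_ p q
  · exact (isCont_geomSumHom_flip 0 (isContSnd_oppOpp M v u w) (isCont_oppOpp_flip M v u w) p).add
      (isCont_geomSumHom 0 (isContSnd_oppOpp M u v w) p)
  · exact (isCont_geomSumHom 0 (isContSnd_oppOpp M v u w) q).add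
      (isCont_geomSumHom_flip 0 (isContSnd_oppOpp M u v w) (isCont_oppOpp_flip M u v w) q)
  · intro m n
    have h := oppJacobi M u v (-1) m n w
    rw [oppJacobiLHS, oppJacobiRHS, finsum_eq_sum_of_support_subset (s := Finset.range I)] at h
    · simp only [LinearMap.add_apply, LinearMap.flip_apply, M.oppHasse_apply,
        opp_hasse_lin_zpow, geomSumHom_apply]
      rw [h]
      unfold geomSum
      rw [← finsum_add_distrib (geomSum_support (isContSnd_oppOpp M v u w) _ _ _)
        (geomSum_support (isContSnd_oppOpp M u v w) _ _ _)]
      refine finsum_congr fun i => ?_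
      have e : ((-1 : ℂ) ^ i * binom (-1) i) = 1 := by
        rw [binom_neg_one, ← mul_pow]; simp
      rw [e, one_smul, ← zpow_natCast]
      simp only [← zpow_add₀ (lin_ne_zero 0), M.oppOpp_apply, M.opp_lin_zero_zpow]
      rw [show m + (-1 - (i : ℤ)) = m + -1 - i by ring, show n + (-1 - (i : ℤ)) = n + -1 - i by ring]
      simp
    · intro i hi
      rw [Finset.coe_range, Set.mem_Iio]
      by_contra hlt
      exact hi (by
        dsimp only
        rw [hI i (by omega), oppositeCoeff_zero_left, smul_zero])

theorem oppositeCoeff_vac (e : ℤ) (w : W) :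
    oppositeCoeff M B.vac e w = if e = 0 then w else 0 := by
  have h2 : B.Y B.conf 2 B.vac = 0 := (B.creation B.conf).2 2 (by norm_num)
  rw [oppositeCoeff_of_mem M B.vac_mem (K := 1), Finset.sum_range_one, B.divRaise_zero, M.vacuum]
  · simp only [Nat.cast_zero, sub_zero, mul_zero, add_zero, zpow_zero, one_smul]
    exact if_congr (by omega) rfl rfl
  · intro a ha
    obtain ⟨b, rfl⟩ : ∃ b, a = b + 1 := ⟨a - 1, by omega⟩
    rw [VertexOperatorAlgebra.divRaise, LinearMap.smul_apply, pow_succ, Module.End.mul_apply, h2,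
      map_zero, smul_zero]

/-- The creation property in the form `L(-1)u = u_{-2} 1`. -/
theorem VertexOperatorAlgebra.translation_eq (u : V) : B.Y B.conf 0 u = B.Y u (-2) B.vac := by
  have h := B.deriv u (-1) B.vac
  rw [(B.creation _).1] at h
  rw [h]
  norm_num

/-- The property `Yᵒ(L(-1)v,x) = (d/dx) Yᵒ(v,x)`. -/
theorem oppositeCoeff_translation (v : V) (e : ℤ) (w : W) :
    oppositeCoeff M (B.Y B.conf 0 v) e w = ((e : ℂ) + 1) • oppositeCoeff M v (e + 1) w := by
  have h := oppJacobi M v B.vac (-2) 0 (-e - 1) w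
  rw [oppJacobiLHS, finsum_eq_single _ 0, oppJacobiRHS] at h
  swap
  · intro i hi
    rw [binom_zero_left, if_neg hi, zero_smul]
  have hb : ∀ i : ℕ, (-1 : ℂ) ^ i * binom (-2) i = i + 1 := fun i => by
    rw [binom_neg, ← mul_assoc, ← mul_pow, show (2 : ℤ) + i - 1 = ((i + 1 : ℕ) : ℤ) by
      push_cast; ring, binom_natCast]
    simp
  simp only [hb, oppositeCoeff_vac, binom_zero_right, one_smul, Nat.cast_zero, add_zero,
    ← B.translation_eq, sub_zero] at h
  rw [show -(0 + (-e - 1)) - 1 = e by ring] at h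
  rw [h]
  rcases lt_or_ge e 0 with he | he
  · obtain ⟨k, rfl⟩ : ∃ k : ℕ, e = -1 - k := ⟨(-1 - e).toNat, by omega⟩
    rcases k with _ | k
    · rw [finsum_eq_zero_of_forall_eq_zero]
      · simp
      · intro i
        rw [if_neg (by push_cast; omega), if_neg (by push_cast; omega), oppositeCoeff_zero_right]
        simp
    · rw [finsum_eq_single _ k]
      · rw [if_neg (by push_cast; omega), if_pos (by push_cast; omega),
          show -(0 + (k : ℤ)) - 1 = -1 - ((k + 1 : ℕ) : ℤ) + 1 by push_cast; ring, zero_sub,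
          show (-1 : ℂ) ^ (-2 : ℤ) = 1 by norm_num, one_smul, smul_neg, ← neg_smul]
        congr 1
        push_cast
        ring
      · intro i hi
        rw [if_neg (by push_cast; omega), if_neg (by push_cast; omega), oppositeCoeff_zero_right]
        simp
  · obtain ⟨k, rfl⟩ : ∃ k : ℕ, e = k := ⟨e.toNat, by omega⟩
    rw [finsum_eq_single _ k]
    · rw [if_pos (by omega), if_neg (by omega), oppositeCoeff_zero_right, smul_zero, sub_zero,
        show -(0 + -2 - (k : ℤ)) - 1 = k + 1 by ring]
      simp
    · intro i hi
      rw [if_neg (by omega), if_neg (by omega), oppositeCoeff_zero_right]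
      simp

theorem opp_translation (v : V) (p : Lau) (w : W) :
    M.opp (B.Y B.conf 0 v) p w = -M.opp v (dx p) w := by
  refine LinearMap.congr_fun (IsCont.ext (ψ := (-1 : ℂ) • ((M.opp v).flip w ∘ₗ dxLin))
    (isCont_opp M (B.Y B.conf 0 v) w) (((isCont_opp M v w).comp_dxLin).smul _) fun n => ?_) p |>.trans ?_
  · rw [LinearMap.flip_apply, LinearMap.smul_apply, LinearMap.comp_apply, LinearMap.flip_apply,
      M.opp_single, oppositeCoeff_translation, dxLin_single, M.opp_apply, pairing_single, smul_smul]
    rw [show n + 1 - 1 = n - 1 + 1 by ring]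
    congr 1
    push_cast
    ring
  · rw [LinearMap.smul_apply, neg_one_smul]
    rfl

theorem opp_vac (p : Lau) (w : W) : M.opp B.vac p w = p.coeff 1 • w := by
  rw [M.opp_apply, pairing, finsum_eq_single _ 1]
  · simp [oppositeCoeff_vac]
  · intro n hn
    rw [oppositeCoeff_vac, if_neg (by omega), smul_zero]

end OppTest

/-! ### Rational functions with poles at two points -/

/-- The polynomials in `x`, as elements of `ℂ((x⁻¹))`. -/
def polys : Subalgebra ℂ Lau := Algebra.adjoin ℂ {lin 0}

theorem lin_mem_polys (c : ℂ) : lin c ∈ polys := by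
  rw [lin_eq_sub 0 c]
  exact sub_mem (Algebra.subset_adjoin rfl) (polys.smul_mem polys.one_mem _)

theorem dx_mem_polys {p : Lau} (hp : p ∈ polys) : dx p ∈ polys := by
  induction hp using Algebra.adjoin_induction with
  | mem x hx =>
    rw [Set.mem_singleton_iff.1 hx, dx_lin]
    exact polys.one_mem
  | algebraMap r => rw [Derivation.map_algebraMap]; exact polys.zero_mem
  | add p q _ _ hp hq => rw [map_add]; exact add_mem hp hq
  | mul p q hp' hq' hp hq =>
    rw [Derivation.leibniz]
    exact add_mem (mul_mem hp' hq) (mul_mem hq' hp)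

theorem coeff_of_mem_polys {p : Lau} (hp : p ∈ polys) {n : ℤ} (hn : 0 < n) : p.coeff n = 0 := by
  have h : p ∈ Submodule.span ℂ (Submonoid.closure {lin 0} : Set Lau) := by
    rw [← Algebra.adjoin_eq_span]
    exact hp
  have hle : Submodule.span ℂ (Submonoid.closure {lin 0} : Set Lau) ≤
      LinearMap.ker (Lau.coeffLin n) := by
    refine Submodule.span_le.2 fun x hx => ?_
    obtain ⟨k, rfl⟩ := Submonoid.mem_closure_singleton.1 hx
    change (lin 0 ^ k).coeff n = 0
    rw [← zpow_natCast, lin_zero_zpow, Lau.coeff_single_of_ne (by omega)]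
  exact hle h

/-- The space `(x-c)^N (x-c')^N ℂ[x]`. -/
def zeros (c c' : ℂ) (N : ℤ) : Submodule ℂ Lau :=
  polys.toSubmodule.map (LinearMap.mulLeft ℂ (lin c ^ N * lin c' ^ N))

variable {c c' : ℂ}

theorem mem_zeros {N : ℤ} {p : Lau} :
    p ∈ zeros c c' N ↔ ∃ q ∈ polys, lin c ^ N * lin c' ^ N * q = p := Iff.rfl

theorem mul_mem_zeros_of_le {N a b : ℤ} (ha : N ≤ a) (hb : N ≤ b) {q : Lau} (hq : q ∈ polys) :
    lin c ^ a * lin c' ^ b * q ∈ zeros c c' N := by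
  obtain ⟨k, rfl⟩ : ∃ k : ℕ, a = N + k := ⟨(a - N).toNat, by omega⟩
  obtain ⟨l, rfl⟩ : ∃ l : ℕ, b = N + l := ⟨(b - N).toNat, by omega⟩
  refine mem_zeros.2 ⟨lin c ^ k * lin c' ^ l * q, mul_mem (mul_mem (pow_mem (lin_mem_polys c) k)
    (pow_mem (lin_mem_polys c') l)) hq, ?_⟩
  rw [zpow_add₀ (lin_ne_zero c), zpow_add₀ (lin_ne_zero c'), zpow_natCast, zpow_natCast]
  ring

theorem zeros_comm (c c' : ℂ) (N : ℤ) : zeros c c' N = zeros c' c N := by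
  rw [zeros, zeros, mul_comm]

theorem zeros_antitone {N N' : ℤ} (h : N ≤ N') : zeros c c' N' ≤ zeros c c' N := by
  rintro _ ⟨q, hq, rfl⟩
  exact mul_mem_zeros_of_le h h hq

theorem mul_mem_zeros {N N' : ℤ} {p q : Lau} (hp : p ∈ zeros c c' N) (hq : q ∈ zeros c c' N') :
    p * q ∈ zeros c c' (N + N') := by
  obtain ⟨p', hp', rfl⟩ := mem_zeros.1 hp
  obtain ⟨q', hq', rfl⟩ := mem_zeros.1 hq
  refine mem_zeros.2 ⟨p' * q', mul_mem hp' hq', ?_⟩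
  rw [zpow_add₀ (lin_ne_zero c), zpow_add₀ (lin_ne_zero c')]
  ring

theorem mem_zeros_zero {p : Lau} : p ∈ zeros c c' 0 ↔ p ∈ polys := by
  simp [mem_zeros]

theorem lin_zpow_mem_zeros (c c' : ℂ) (n : ℤ) : lin c ^ n ∈ zeros c c' (-|n|) := by
  have := mul_mem_zeros_of_le (c := c) (c' := c') (neg_abs_le n) (neg_nonpos.2 (abs_nonneg n))
    polys.one_mem
  simpa using this

theorem dx_mem_zeros {N : ℤ} {p : Lau} (hp : p ∈ zeros c c' N) : dx p ∈ zeros c c' (N - 1) := by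
  obtain ⟨q, hq, rfl⟩ := mem_zeros.1 hp
  rw [Derivation.leibniz, Derivation.leibniz, dx_lin_zpow, dx_lin_zpow]
  simp only [smul_eq_mul, mul_smul_comm, mul_add]
  refine add_mem ?_ (add_mem ?_ ?_)
  · exact mul_mem_zeros_of_le (by omega) (by omega) (dx_mem_polys hq)
  · have := mul_mem_zeros_of_le (c := c) (c' := c') (show N - 1 ≤ N by omega) le_rfl hq
    refine Submodule.smul_mem _ _ ?_
    rwa [mul_comm]
  · have := mul_mem_zeros_of_le (c := c) (c' := c') (le_refl (N - 1)) (show N - 1 ≤ N by omega) hq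
    refine Submodule.smul_mem _ _ ?_
    rwa [mul_comm, mul_comm (lin c' ^ N)]

theorem hasse_mem_zeros {N : ℤ} {p : Lau} (hp : p ∈ zeros c c' N) (i : ℕ) :
    hasse i p ∈ zeros c c' (N - i) := by
  induction i with
  | zero => simpa [hasse_zero] using hp
  | succ i ih =>
    rw [hasse_succ, Nat.cast_succ, ← sub_sub]
    exact Submodule.smul_mem _ _ (dx_mem_zeros ih)

/-- A sequence is negligible if it eventually vanishes to any given order at `c` and `c'`. -/
def Negligible (c c' : ℂ) (p : ℕ → Lau) : Prop :=
  ∀ K : ℤ, ∀ᶠ N in Filter.atTop, p N ∈ zeros c c' K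

theorem Negligible.of_mem {p : ℕ → Lau} (k : ℤ) (h : ∀ N : ℕ, p N ∈ zeros c c' (N - k)) :
    Negligible c c' p := fun K => by
  filter_upwards [Filter.eventually_ge_atTop (K + k).toNat] with N hN
  exact zeros_antitone (by omega) (h N)

theorem Negligible.add {p q : ℕ → Lau} (hp : Negligible c c' p) (hq : Negligible c c' q) :
    Negligible c c' fun N => p N + q N := fun K => by
  filter_upwards [hp K, hq K] with N h h'
  exact add_mem h h'

theorem Negligible.smul {p : ℕ → Lau} (hp : Negligible c c' p) (a : ℂ) :
    Negligible c c' fun N => a • p N := fun K => by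
  filter_upwards [hp K] with N h
  exact Submodule.smul_mem _ _ h

theorem Negligible.mul {p q : ℕ → Lau} (hp : Negligible c c' p) {b : ℤ}
    (hq : ∀ N, q N ∈ zeros c c' b) : Negligible c c' fun N => p N * q N := fun K => by
  filter_upwards [hp (K - b)] with N h
  have := mul_mem_zeros h (hq N)
  rwa [sub_add_cancel] at this

theorem Negligible.dx {p : ℕ → Lau} (hp : Negligible c c' p) :
    Negligible c c' fun N => dx (p N) := fun K => by
  filter_upwards [hp (K + 1)] with N h
  have := dx_mem_zeros h
  rwa [add_sub_cancel_right] at this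

/-- A sequence of polynomials `e_N` with `e_N ≡ 1` modulo `(x-c)^N` and `e_N ≡ 0` modulo
`(x-c')^N`. Multiplication by `e_N` isolates the singularity at `c`. -/
structure IsIdem (c c' : ℂ) (e : ℕ → Lau) : Prop where
  mem : ∀ N, e N ∈ polys
  near : ∀ N, ∃ q ∈ polys, e N = 1 + lin c ^ N * q
  far : ∀ N, ∃ q ∈ polys, e N = lin c' ^ N * q

/-- The existence of `e_N` is the coprimality of `(x-c)^N` and `(x-c')^N`. -/
theorem exists_isIdem (h : c ≠ c') : ∃ e, IsIdem c c' e := by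
  have h0 : c' - c ≠ 0 := sub_ne_zero.2 h.symm
  have hcop : ∀ N : ℕ, IsCoprime ((⟨lin c, lin_mem_polys c⟩ : polys) ^ N)
      ((⟨lin c', lin_mem_polys c'⟩ : polys) ^ N) := fun N => by
    refine IsCoprime.pow ⟨algebraMap ℂ polys (c' - c)⁻¹, -algebraMap ℂ polys (c' - c)⁻¹, ?_⟩
    refine Subtype.ext ?_
    have : algebraMap ℂ Lau (c' - c)⁻¹ * algebraMap ℂ Lau (c' - c) = 1 := by
      rw [← map_mul, inv_mul_cancel₀ h0, map_one]
    change algebraMap ℂ Lau (c' - c)⁻¹ * lin c + -algebraMap ℂ Lau (c' - c)⁻¹ * lin c' = 1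
    rw [lin_eq_sub c c', Algebra.smul_def, mul_one]
    linear_combination this
  choose a b hab using hcop
  refine ⟨fun N => lin c' ^ N * b N, fun N => mul_mem (pow_mem (lin_mem_polys c') N) (b N).2,
    fun N => ⟨-a N, neg_mem (a N).2, ?_⟩, fun N => ⟨b N, (b N).2, rfl⟩⟩
  have := congrArg (Subtype.val) (hab N)
  change (a N : Lau) * lin c ^ N + b N * lin c' ^ N = 1 at this
  linear_combination this

namespace IsIdem

variable {e e' : ℕ → Lau}

theorem mul_one_sub_mem (he : IsIdem c c' e) (he' : IsIdem c c' e') {K N N' : ℕ} (hN : K ≤ N)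
    (hN' : K ≤ N') : e N * (1 - e' N') ∈ zeros c c' K := by
  obtain ⟨q, hq, h⟩ := he.far N
  obtain ⟨q', hq', h'⟩ := he'.near N'
  have := mul_mem_zeros_of_le (c := c) (c' := c') (show (K : ℤ) ≤ (N' : ℤ) by omega)
    (show (K : ℤ) ≤ (N : ℤ) by omega) (neg_mem (mul_mem hq hq'))
  rw [zpow_natCast, zpow_natCast] at this
  rw [h, h']
  convert this using 1
  ring

theorem sub_mem (he : IsIdem c c' e) (he' : IsIdem c c' e') {K N N' : ℕ} (hN : K ≤ N)
    (hN' : K ≤ N') : e N - e' N' ∈ zeros c c' K := by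
  have := _root_.sub_mem (he.mul_one_sub_mem he' hN hN') (he'.mul_one_sub_mem he hN' hN)
  convert this using 1
  ring

theorem negligible_mul_one_sub (he : IsIdem c c' e) :
    Negligible c c' fun N => e N * (1 - e N) :=
  Negligible.of_mem 0 fun N => by simpa using he.mul_one_sub_mem he (le_refl N) (le_refl N)

theorem negligible_mul (he : IsIdem c c' e) (he' : IsIdem c' c e') :
    Negligible c c' fun N => e N * e' N := Negligible.of_mem 0 fun N => by
  obtain ⟨q, hq, h⟩ := he.far N
  obtain ⟨q', hq', h'⟩ := he'.far N
  have := mul_mem_zeros_of_le (c := c) (c' := c') (le_refl (N : ℤ)) (le_refl (N : ℤ))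
    (mul_mem hq hq')
  rw [zpow_natCast, zpow_natCast] at this
  rw [h, h', sub_zero]
  convert this using 1
  ring

theorem mem_zeros (he : IsIdem c c' e) (N : ℕ) : e N ∈ zeros c c' 0 := mem_zeros_zero.2 (he.mem N)

theorem negligible_dx (he : IsIdem c c' e) : Negligible c c' fun N => dx (e N) := by
  -- With `r = e (1 - e)`, the derivative satisfies `e' = 4 r e' + (1 - 2e) r'`.
  have h : ∀ N, dx (e N) = (4 : ℂ) • (e N * (1 - e N) * dx (e N)) +
      dx (e N * (1 - e N)) * (1 - (2 : ℂ) • e N) := fun N => by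
    rw [Derivation.leibniz, map_sub, Derivation.map_one_eq_zero]
    simp only [smul_eq_mul, Algebra.smul_def, map_ofNat]
    ring
  have h1 := (he.negligible_mul_one_sub.mul (b := 0) fun N =>
    mem_zeros_zero.2 (dx_mem_polys (he.mem N))).smul 4
  have h2 := he.negligible_mul_one_sub.dx.mul (b := 0) (q := fun N => 1 - (2 : ℂ) • e N) fun N =>
    mem_zeros_zero.2 (_root_.sub_mem polys.one_mem (polys.smul_mem (he.mem N) 2))
  have h3 := h1.add h2
  simp only [← h] at h3
  exact h3

theorem negligible_hasse (he : IsIdem c c' e) {b : ℤ} {p : Lau} (hp : p ∈ zeros c c' b) (i : ℕ) :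
    Negligible c c' fun N => hasse i (p * e N) - hasse i p * e N := by
  induction i with
  | zero =>
    simp only [hasse_zero, sub_self]
    exact fun K => Filter.Eventually.of_forall fun _ => zero_mem _
  | succ i ih =>
    have h := (ih.dx.add (he.negligible_dx.mul (q := fun _ => hasse i p)
      fun _ => hasse_mem_zeros hp i)).smul (((i : ℂ) + 1)⁻¹)
    refine fun K => (h K).mono fun N hN => ?_
    dsimp only at hN
    convert hN using 1
    dsimp only
    rw [hasse_succ, hasse_succ, map_sub, Derivation.leibniz, smul_eq_mul, smul_eq_mul,
      smul_mul_assoc, ← smul_sub]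
    congr 1
    ring

theorem negligible_hasse_succ (he : IsIdem c c' e) (i : ℕ) :
    Negligible c c' fun N => hasse (i + 1) (e N) := by
  induction i with
  | zero =>
    simp only [hasse_succ, hasse_zero]
    exact he.negligible_dx.smul _
  | succ i ih =>
    simp only [hasse_succ (i + 1)]
    exact ih.dx.smul _

/-- The residue at infinity of `(x-c)^n e_N` is the coefficient of `(x-c)⁻¹` at `c`. -/
theorem coeff_lin_zpow_mul (he : IsIdem c c' e) (n : ℤ) :
    ∀ᶠ N in Filter.atTop, (lin c ^ n * e N).coeff 1 = if n = -1 then 1 else 0 := by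
  filter_upwards [Filter.eventually_ge_atTop (-n).toNat] with N hN
  rcases lt_or_ge n 0 with hn | hn
  · obtain ⟨q, hq, h⟩ := he.near N
    obtain ⟨k, hk⟩ : ∃ k : ℕ, n + N = k := ⟨(n + N).toNat, by omega⟩
    rw [h, mul_add, mul_one, ← mul_assoc, ← zpow_natCast, ← zpow_add₀ (lin_ne_zero c), hk,
      zpow_natCast, Lau.coeff_add,
      coeff_of_mem_polys (mul_mem (pow_mem (lin_mem_polys c) k) hq) one_pos, add_zero]
    split_ifs with h1
    · have := lin_zpow_sub_sum_mem_deep 0 c n 1 1 (by push_cast; omega)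
      rw [Lau.coeff_sub, Finset.sum_range_one, pow_zero, binom_zero_right, mul_one, one_smul,
        lin_zero_zpow, Nat.cast_zero, sub_zero, h1, neg_neg, Lau.coeff_single_same,
        sub_eq_zero] at this
      rw [h1, this]
    · exact lin_zpow_mem_deep c n 1 (by omega)
  · obtain ⟨k, rfl⟩ : ∃ k : ℕ, n = k := ⟨n.toNat, by omega⟩
    rw [zpow_natCast, coeff_of_mem_polys (mul_mem (pow_mem (lin_mem_polys c) k) (he.mem N)) one_pos,
      if_neg (by omega)]

end IsIdem

/-! ### The action attached to a point -/

/-- The eventual value of an eventually constant sequence. -/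
def evLim {X : Type*} [Zero X] (s : ℕ → X) : X :=
  open scoped Classical in
  if h : ∃ x, ∀ᶠ N in Filter.atTop, s N = x then h.choose else 0

theorem evLim_eq {X : Type*} [Zero X] {s : ℕ → X} {x : X}
    (h : ∀ᶠ N in Filter.atTop, s N = x) : evLim s = x := by
  have hex : ∃ x, ∀ᶠ N in Filter.atTop, s N = x := ⟨x, h⟩
  rw [evLim, dif_pos hex]
  obtain ⟨N, h1, h2⟩ := (hex.choose_spec.and h).exists
  exact h1.symm.trans h2

section Action

variable {V : Type u₁} [AddCommGroup V] [Module ℂ V] {B : VertexOperatorAlgebra V}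
  {W : Type u₂} [AddCommGroup W] [Module ℂ W] (M : WeakModule B.toVertexData W)
  {U : Type u₃} [AddCommGroup U] [Module ℂ U] {c c' : ℂ} {e : ℕ → Lau}

/-- The functional `p ↦ Res p(x) f(Yᵒ(v,x) ·)` vanishes on the functions with zeros of high order
at `c` and `c'`. This is the defining condition of `D_{P(z)}(W,U)` for `{c, c'} = {0, z}`. -/
def IsKilled (c c' : ℂ) (f : W →ₗ[ℂ] U) : Prop :=
  ∀ v : V, ∃ K : ℤ, ∀ p ∈ zeros c c' K, f ∘ₗ M.opp v p = 0

/-- The eventual value of `Res (x-c)^n e_N(x) f(Yᵒ(v,x) ·)`: the mode `v_n f` of the action of `V`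
that is attached to the point `c`. -/
def localAct (c : ℂ) (e : ℕ → Lau) (v : V) (n : ℤ) (f : W →ₗ[ℂ] U) : W →ₗ[ℂ] U :=
  evLim fun N => f ∘ₗ M.opp v (lin c ^ n * e N)

variable {M} {f : W →ₗ[ℂ] U}

theorem IsKilled.negligible (hf : IsKilled M c c' f) {p : ℕ → Lau} (hp : Negligible c c' p)
    (v : V) : ∀ᶠ N in Filter.atTop, f ∘ₗ M.opp v (p N) = 0 := by
  obtain ⟨K, hK⟩ := hf v
  exact (hp K).mono fun N hN => hK _ hN

/-- Test functions that differ by a negligible sequence give the same operators eventually. -/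
theorem IsKilled.congr (hf : IsKilled M c c' f) {p q : ℕ → Lau}
    (hp : Negligible c c' fun N => p N - q N) (v : V) :
    ∀ᶠ N in Filter.atTop, f ∘ₗ M.opp v (p N) = f ∘ₗ M.opp v (q N) :=
  (hf.negligible hp v).mono fun N hN => by
    rwa [map_sub, LinearMap.comp_sub, sub_eq_zero] at hN

/-- The sequence that defines `localAct` is eventually constant. -/
theorem IsKilled.eventually_localAct (hf : IsKilled M c c' f) (he : IsIdem c c' e) (v : V)
    (n : ℤ) : ∀ᶠ N in Filter.atTop, f ∘ₗ M.opp v (lin c ^ n * e N) = localAct M c e v n f := by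
  have h : ∃ x, ∀ᶠ N in Filter.atTop, f ∘ₗ M.opp v (lin c ^ n * e N) = x := by
    obtain ⟨K, hK⟩ := hf v
    refine ⟨f ∘ₗ M.opp v (lin c ^ n * e (K + |n|).toNat), ?_⟩
    filter_upwards [Filter.eventually_ge_atTop (K + |n|).toNat] with N hN
    rw [← sub_eq_zero, ← LinearMap.comp_sub, ← map_sub, ← mul_sub]
    refine hK _ (zeros_antitone ?_ (mul_mem_zeros (lin_zpow_mem_zeros c c' n)
      (he.sub_mem he hN le_rfl)))
    have := abs_nonneg n
    omega
  obtain ⟨x, hx⟩ := h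
  rwa [localAct, evLim_eq hx]

theorem localAct_add_right {g : W →ₗ[ℂ] U} (hf : IsKilled M c c' f) (hg : IsKilled M c c' g)
    (he : IsIdem c c' e) (v : V) (n : ℤ) :
    localAct M c e v n (f + g) = localAct M c e v n f + localAct M c e v n g := by
  refine evLim_eq ?_
  filter_upwards [hf.eventually_localAct he v n, hg.eventually_localAct he v n] with N h h'
  rw [LinearMap.add_comp, h, h']

theorem localAct_smul_right (hf : IsKilled M c c' f) (he : IsIdem c c' e) (v : V) (n : ℤ) (a : ℂ) :
    localAct M c e v n (a • f) = a • localAct M c e v n f := by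
  refine evLim_eq ?_
  filter_upwards [hf.eventually_localAct he v n] with N h
  rw [LinearMap.smul_comp, h]

theorem localAct_add_left (hf : IsKilled M c c' f) (he : IsIdem c c' e) (u v : V) (n : ℤ) :
    localAct M c e (u + v) n f = localAct M c e u n f + localAct M c e v n f := by
  refine evLim_eq ?_
  filter_upwards [hf.eventually_localAct he u n, hf.eventually_localAct he v n] with N h h'
  rw [map_add, LinearMap.add_apply, LinearMap.comp_add, h, h']

theorem localAct_smul_left (hf : IsKilled M c c' f) (he : IsIdem c c' e) (v : V) (n : ℤ) (a : ℂ) :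
    localAct M c e (a • v) n f = a • localAct M c e v n f := by
  refine evLim_eq ?_
  filter_upwards [hf.eventually_localAct he v n] with N h
  rw [map_smul, LinearMap.smul_apply, LinearMap.comp_smul, h]

theorem comp_opp_commutator (f : W →ₗ[ℂ] U) {u v : V} {I : ℕ}
    (hI : ∀ i : ℕ, I ≤ i → B.Y u i v = 0) (p q : Lau) :
    (f ∘ₗ M.opp v q) ∘ₗ M.opp u p - (f ∘ₗ M.opp u p) ∘ₗ M.opp v q =
      ∑ i ∈ Finset.range I, f ∘ₗ M.opp (B.Y u i v) (hasse i p * q) := by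
  refine LinearMap.ext fun w => ?_
  have h := congrArg f (opp_commutator M hI p q w)
  rw [map_sub, map_sum] at h
  simpa [LinearMap.sum_apply] using h

theorem exists_modes_eq_zero (u v : V) (l : ℤ) : ∃ I : ℕ, ∀ i : ℕ, I ≤ i → B.Y u (l + i) v = 0 := by
  obtain ⟨N, hN⟩ := B.trunc u v
  exact ⟨(N - l).toNat, fun i hi => hN _ (by omega)⟩

/-- The space defined by `IsKilled` is stable under the operators `Res p(x) Yᵒ(u,x)`: by the commutator
formula the defect is a combination of functionals attached to the products `u_i v`. -/
theorem IsKilled.comp (hf : IsKilled M c c' f) (u : V) {p : Lau} {b : ℤ} (hp : p ∈ zeros c c' b) :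
    IsKilled M c c' (f ∘ₗ M.opp u p) := fun v => by
  obtain ⟨I, hI⟩ := exists_modes_eq_zero (B := B) u v 0
  simp only [zero_add] at hI
  obtain ⟨K, hK⟩ := hf v
  choose K' hK' using fun i : ℕ => hf (B.Y u i v)
  refine ⟨max K (∑ i ∈ Finset.range I, |K' i| + I - b), fun q hq => ?_⟩
  have h := comp_opp_commutator (M := M) f hI p q
  rw [hK q (zeros_antitone (le_max_left _ _) hq), LinearMap.zero_comp, zero_sub,
    Finset.sum_eq_zero, neg_eq_zero] at h
  · exact h
  · intro i hi
    refine hK' i _ (zeros_antitone ?_ (mul_mem_zeros (hasse_mem_zeros hp i) hq))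
    have h1 := Finset.single_le_sum (f := fun i : ℕ => |K' i|) (fun _ _ => abs_nonneg _) hi
    have h2 := le_abs_self (K' i)
    have h3 := le_max_right K (∑ i ∈ Finset.range I, |K' i| + I - b)
    have h4 := Finset.mem_range.1 hi
    omega

theorem IsKilled.localAct (hf : IsKilled M c c' f) (he : IsIdem c c' e) (v : V) (n : ℤ) :
    IsKilled M c c' (localAct M c e v n f) := by
  obtain ⟨N, hN⟩ := (hf.eventually_localAct he v n).exists
  rw [← hN]
  exact hf.comp v (mul_mem_zeros (lin_zpow_mem_zeros c c' n) (he.mem_zeros N))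

/-- A product of two modes, for actions attached to points `a` and `c`. -/
theorem IsKilled.eventually_localAct_localAct {a a' : ℂ} {e' : ℕ → Lau} (hf : IsKilled M c c' f)
    (hf' : ∀ g : W →ₗ[ℂ] U, IsKilled M c c' g → IsKilled M a a' g)
    (he : IsIdem c c' e) (he' : IsIdem a a' e') (u v : V) (m n : ℤ) :
    ∀ᶠ N in Filter.atTop, (f ∘ₗ M.opp v (lin c ^ n * e N)) ∘ₗ M.opp u (lin a ^ m * e' N) =
      RegularRep.localAct M a e' u m (RegularRep.localAct M c e v n f) := by
  filter_upwards [hf.eventually_localAct he v n,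
    (hf' _ (hf.localAct he v n)).eventually_localAct he' u m] with N h h'
  rw [h, h']

/-- Up to negligible sequences, `(x-c)^n e_N` behaves in the commutator formula like `(x-c)^n`. -/
theorem IsIdem.negligible_hasse_mul (he : IsIdem c c' e) (m n : ℤ) (i : ℕ) :
    Negligible c c' fun N => hasse i (lin c ^ m * e N) * (lin c ^ n * e N) -
      binom m i • (lin c ^ (m + n - i) * e N) := by
  have h := ((he.negligible_hasse (lin_zpow_mem_zeros c c' m) i).mul
    (q := fun N => lin c ^ n * e N) fun N =>
      mul_mem_zeros (lin_zpow_mem_zeros c c' n) (he.mem_zeros N)).add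
    ((he.negligible_mul_one_sub.mul (q := fun _ => lin c ^ (m + n - i))
      fun _ => lin_zpow_mem_zeros c c' _).smul (-binom m i))
  refine fun K => (h K).mono fun N hN => ?_
  dsimp only at hN ⊢
  convert hN using 1
  rw [hasse_lin_zpow, show m + n - (i : ℤ) = m - i + n by ring, zpow_add₀ (lin_ne_zero c)]
  simp only [Algebra.smul_def, map_neg]
  ring

variable (M) {S : Submodule ℂ (W →ₗ[ℂ] U)}

/-- The modes of the action attached to `c`, on a space `S` of linear maps that satisfy
`IsKilled`. -/
def localModes (hS : ∀ f, f ∈ S ↔ IsKilled M c c' f) (he : IsIdem c c' e) :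
    V →ₗ[ℂ] ℤ → Module.End ℂ S where
  toFun v n :=
    { toFun := fun f => ⟨localAct M c e v n f.1, (hS _).2 (((hS _).1 f.2).localAct he v n)⟩
      map_add' := fun f g =>
        Subtype.ext (localAct_add_right ((hS _).1 f.2) ((hS _).1 g.2) he v n)
      map_smul' := fun a f => Subtype.ext (localAct_smul_right ((hS _).1 f.2) he v n a) }
  map_add' u v := funext fun n => LinearMap.ext fun f =>
    Subtype.ext (localAct_add_left ((hS _).1 f.2) he u v n)
  map_smul' a v := funext fun n => LinearMap.ext fun f =>
    Subtype.ext (localAct_smul_left ((hS _).1 f.2) he v n a)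

theorem coe_localModes (hS : ∀ f, f ∈ S ↔ IsKilled M c c' f) (he : IsIdem c c' e) (v : V) (n : ℤ)
    (f : S) : (localModes M hS he v n f).1 = localAct M c e v n f.1 := rfl

end Action

/-! ### The weak modules attached to the two points -/

section Virasoro

variable {V : Type u₁} [AddCommGroup V] [Module ℂ V] {B : VertexOperatorAlgebra V}
  {D : Type u₂} [AddCommGroup D] [Module ℂ D]

/-- The products `ω_i ω` for `i ≥ 2`: only `ω_3 ω = (rank/2) 1` can be
nonzero. -/
theorem conf_mode_conf (i : ℕ) : B.Y B.conf ((i + 2 : ℕ) : ℤ) B.conf =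
    (if i = 1 then B.rank / 2 else 0) • B.vac := by
  have h := B.virasoro ((i + 1 : ℕ) : ℤ) (-2) B.vac
  have h0 : ∀ n : ℤ, 0 ≤ n → B.Y B.conf n B.vac = 0 := (B.creation B.conf).2
  rw [show (-2 : ℤ) + 1 = -1 by ring, (B.creation B.conf).1, h0 _ (by push_cast; omega), map_zero,
    sub_zero, h0 (_ + -2 + 1) (by push_cast; omega), smul_zero, zero_add] at h
  rw [show ((i + 2 : ℕ) : ℤ) = ((i + 1 : ℕ) : ℤ) + 1 by push_cast; ring, h]
  congr 1
  by_cases hi : i = 1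
  · subst hi
    norm_num
    ring
  · rw [if_neg (by push_cast; omega), if_neg hi]

/-- The Virasoro relations follow from the commutator formula. -/
theorem virasoro_of_commutator {Y : V →ₗ[ℂ] ℤ → Module.End ℂ D} (hY : TruncModes Y)
    (hvac : ∀ (n : ℤ) (w : D), Y B.vac n w = if n = -1 then w else 0)
    (hd : ∀ (v : V) (n : ℤ) (w : D), Y (B.Y B.conf 0 v) n w = (-(n : ℂ)) • Y v (n - 1) w)
    (hc : ∀ (u v : V) (m n : ℤ) (w : D),
      jacobiLHS B.toVertexData Y u v 0 m n w = jacobiRHS Y u v 0 m n w) (m n : ℤ) (w : D) :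
    Y B.conf (m + 1) (Y B.conf (n + 1) w) - Y B.conf (n + 1) (Y B.conf (m + 1) w) =
      ((m : ℂ) - n) • Y B.conf (m + n + 1) w +
        (if m + n = 0 then ((m : ℂ) ^ 3 - m) / 12 * B.rank else 0) • w := by
  have hN : ∀ k : ℤ, 4 ≤ k → B.Y B.conf k B.conf = 0 := fun k hk => by
    obtain ⟨i, rfl⟩ : ∃ i : ℕ, k = ((i + 2 : ℕ) : ℤ) := ⟨(k - 2).toNat, by omega⟩
    rw [conf_mode_conf, if_neg (by push_cast at hk; omega), zero_smul]
  have h2 : B.Y B.conf 2 B.conf = 0 := by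
    have := conf_mode_conf (B := B) 0
    simpa using this
  have h3 : B.Y B.conf 3 B.conf = (B.rank / 2) • B.vac := by
    have := conf_mode_conf (B := B) 1
    simpa using this
  have h1 : B.Y B.conf 1 B.conf = (2 : ℂ) • B.conf := by
    simpa using B.weight 2 B.conf B.conf_mem
  have hb3 : binom (m + 1) 3 = ((m : ℂ) ^ 3 - m) / 6 := by
    have e1 := succ_mul_binom_succ (m + 1) 1
    have e2 := succ_mul_binom_succ (m + 1) 2
    rw [binom_one_right] at e1
    push_cast at e1 e2
    linear_combination (1 / 3 : ℂ) * e2 + ((m : ℂ) - 1) / 6 * e1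
  rw [← jacobiRHS_zero hY, ← hc, jacobiLHS_eq_sum Y hN 0 _ _ w (K := 4) (by norm_num),
    Finset.sum_range_succ, Finset.sum_range_succ, Finset.sum_range_succ, Finset.sum_range_one]
  norm_num only [zero_add, Nat.cast_zero, Nat.cast_one, Nat.cast_ofNat, sub_zero]
  rw [h1, h2, h3, hd, map_zero, Pi.zero_apply, LinearMap.zero_apply, smul_zero, add_zero, map_smul,
    map_smul, Pi.smul_apply, Pi.smul_apply, LinearMap.smul_apply, LinearMap.smul_apply, hvac, hb3,
    binom_zero_right, binom_one_right, show m + 1 + (n + 1) - 1 = m + n + 1 by ring]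
  by_cases h : m + n = 0
  · rw [if_pos h, if_pos (by omega)]
    push_cast
    module
  · rw [if_neg h, if_neg (by omega)]
    push_cast
    module

end Virasoro

section Action

variable {V : Type u₁} [AddCommGroup V] [Module ℂ V] {B : VertexOperatorAlgebra V}
  {W : Type u₂} [AddCommGroup W] [Module ℂ W] {M : WeakModule B.toVertexData W}
  {U : Type u₃} [AddCommGroup U] [Module ℂ U] {c c' : ℂ} {e : ℕ → Lau} {f : W →ₗ[ℂ] U}

theorem IsKilled.exists_comp_opp_eq_zero (hf : IsKilled M c c' f) (he : IsIdem c c' e) (v : V) :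
    ∃ K : ℤ, ∀ n, K ≤ n → ∀ N : ℕ, K ≤ N → f ∘ₗ M.opp v (lin c ^ n * e N) = 0 := by
  obtain ⟨K, hK⟩ := hf v
  refine ⟨K, fun n hn N hN => hK _ ?_⟩
  obtain ⟨q, hq, h⟩ := he.far N
  rw [h, ← zpow_natCast, ← mul_assoc]
  exact mul_mem_zeros_of_le hn hN hq

theorem IsKilled.localAct_trunc (hf : IsKilled M c c' f) (he : IsIdem c c' e) (v : V) :
    ∃ K : ℤ, ∀ n, K ≤ n → RegularRep.localAct M c e v n f = 0 := by
  obtain ⟨K, hK⟩ := hf.exists_comp_opp_eq_zero he v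
  refine ⟨K, fun n hn => evLim_eq ?_⟩
  filter_upwards [Filter.eventually_ge_atTop K.toNat] with N hN
  exact hK n hn N (by omega)

theorem localAct_vac (he : IsIdem c c' e) (n : ℤ) (f : W →ₗ[ℂ] U) :
    RegularRep.localAct M c e B.vac n f = if n = -1 then f else 0 := by
  refine evLim_eq ?_
  filter_upwards [he.coeff_lin_zpow_mul n] with N hN
  refine LinearMap.ext fun w => ?_
  rw [LinearMap.comp_apply, opp_vac, hN]
  split_ifs <;> simp

theorem IsKilled.localAct_translation (hf : IsKilled M c c' f) (he : IsIdem c c' e) (v : V)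
    (n : ℤ) : RegularRep.localAct M c e (B.Y B.conf 0 v) n f =
      (-(n : ℂ)) • RegularRep.localAct M c e v (n - 1) f := by
  refine evLim_eq ?_
  filter_upwards [hf.eventually_localAct he v (n - 1), hf.negligible
    (he.negligible_dx.mul fun _ => lin_zpow_mem_zeros c c' n) v] with N h h'
  refine LinearMap.ext fun w => ?_
  have h1 := LinearMap.congr_fun h w
  have h2 := LinearMap.congr_fun h' w
  rw [LinearMap.comp_apply] at h1 h2
  rw [LinearMap.comp_apply, opp_translation, Derivation.leibniz, dx_lin_zpow, smul_eq_mul,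
    smul_eq_mul, mul_smul_comm, mul_comm (e N), mul_comm (lin c ^ n), map_add, LinearMap.add_apply,
    map_neg, map_add, h2, map_smul, LinearMap.smul_apply, map_smul, h1, LinearMap.smul_apply,
    LinearMap.zero_apply, zero_add, neg_smul]

variable {S : Submodule ℂ (W →ₗ[ℂ] U)}

theorem truncModes_localModes (hS : ∀ f, f ∈ S ↔ IsKilled M c c' f) (he : IsIdem c c' e) :
    TruncModes (localModes M hS he) := fun v f => by
  obtain ⟨K, hK⟩ := ((hS _).1 f.2).localAct_trunc he v
  exact ⟨K, fun n hn => Subtype.ext (hK n hn)⟩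

/-- The commutator formula for the action attached to `c`. -/
theorem localModes_commutator (hS : ∀ f, f ∈ S ↔ IsKilled M c c' f) (he : IsIdem c c' e) (u v : V)
    (m n : ℤ) (f : S) : jacobiLHS B.toVertexData (localModes M hS he) u v 0 m n f =
      jacobiRHS (localModes M hS he) u v 0 m n f := by
  obtain ⟨N, hN⟩ := B.trunc u v
  obtain ⟨I, hI⟩ : ∃ I : ℕ, N ≤ I := ⟨N.toNat, by omega⟩
  have hf := (hS _).1 f.2
  rw [jacobiLHS_eq_sum _ hN 0 m n f (K := I) (by omega),
    jacobiRHS_zero (truncModes_localModes hS he)]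
  refine Subtype.ext ?_
  simp only [zero_add, Submodule.coe_sub, Submodule.coe_sum, Submodule.coe_smul, coe_localModes]
  obtain ⟨k, h1, h2, h3, h4⟩ :=
    ((hf.eventually_localAct_localAct (fun _ hg => hg) he he u v m n).and
    ((hf.eventually_localAct_localAct (fun _ hg => hg) he he v u n m).and
    (((Finset.range I).eventually_all.2 fun i _ => hf.eventually_localAct he (B.Y u i v)
      (m + n - i)).and ((Finset.range I).eventually_all.2 fun i _ =>
      hf.congr (he.negligible_hasse_mul m n i) (B.Y u i v))))).exists
  rw [← h1, ← h2, comp_opp_commutator f.1 (I := I) fun i hi => hN _ (by omega)]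
  refine Finset.sum_congr rfl fun i hi => ?_
  rw [h4 i hi, ← h3 i hi, map_smul, LinearMap.comp_smul]

/-- The formula for the modes of `u_{-1}v` in the action attached to `c`. -/
theorem localModes_normal (hS : ∀ f, f ∈ S ↔ IsKilled M c c' f) (he : IsIdem c c' e) (u v : V)
    (n : ℤ) (f : S) : jacobiLHS B.toVertexData (localModes M hS he) u v (-1) 0 n f =
      jacobiRHS (localModes M hS he) u v (-1) 0 n f := by
  have hf := (hS _).1 f.2
  obtain ⟨I, hI⟩ := exists_modes_eq_zero (B := B) u v (-1)
  obtain ⟨Ku, hKu⟩ := hf.exists_comp_opp_eq_zero he u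
  obtain ⟨Kv, hKv⟩ := hf.exists_comp_opp_eq_zero he v
  obtain ⟨J, hJu, hJv⟩ : ∃ J : ℕ, Ku ≤ J ∧ Kv - n ≤ J := ⟨(max Ku (Kv - n)).toNat, by omega, by omega⟩
  have hu : ∀ i : ℕ, J ≤ i → localAct M c e u i f.1 = 0 := fun i hi => evLim_eq <| by
    filter_upwards [Filter.eventually_ge_atTop Ku.toNat] with N hN
    exact hKu _ (by omega) N (by omega)
  have hv : ∀ i : ℕ, J ≤ i → localAct M c e v (n + i) f.1 = 0 := fun i hi => evLim_eq <| by
    filter_upwards [Filter.eventually_ge_atTop Kv.toNat] with N hN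
    exact hKv _ (by omega) N (by omega)
  have hrhs : (jacobiRHS (localModes M hS he) u v (-1) 0 n f).1 = ∑ i ∈ Finset.range J,
      (localAct M c e u (-1 - (i : ℤ)) (localAct M c e v (n + i) f.1) +
        localAct M c e v (n + (-1 - (i : ℤ))) (localAct M c e u i f.1)) := by
    unfold jacobiRHS
    rw [finsum_eq_sum_of_support_subset (s := Finset.range J), Submodule.coe_sum]
    · refine Finset.sum_congr rfl fun i _ => ?_
      have e1 : (-1 : ℂ) ^ i * binom (-1) i = 1 := by
        rw [binom_neg_one, ← mul_pow]; simp
      rw [e1, one_smul, zero_add, zero_add, show (-1 : ℂ) ^ (-1 : ℤ) = -1 by norm_num, neg_one_smul,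
        sub_neg_eq_add, show n + -1 - (i : ℤ) = n + (-1 - i) by ring]
      rfl
    · intro i hi
      rw [Finset.coe_range, Set.mem_Iio]
      by_contra hlt
      have z1 : localModes M hS he v (n + i) f = 0 := Subtype.ext (hv i (by omega))
      have z2 : localModes M hS he u i f = 0 := Subtype.ext (hu i (by omega))
      exact hi (by
        dsimp only
        rw [z1, zero_add (i : ℤ), z2, map_zero, map_zero, smul_zero, sub_zero, smul_zero])
  refine Subtype.ext ?_
  rw [hrhs, jacobiLHS_zero, coe_localModes]
  -- For large `k` all modes that occur below are given by the test functions with `e_k`, and the terms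
  -- of `opp_normal` with derivatives of `e_k` vanish.
  obtain ⟨k, h1, h2, h3, h4, h5, h6⟩ :=
    ((((Finset.range J).eventually_all.2 fun i _ => hf.eventually_localAct_localAct
      (fun _ hg => hg) he he u v (-1 - (i : ℤ)) (n + i)).and
    (((Finset.range J).eventually_all.2 fun i _ => hf.eventually_localAct_localAct
      (fun _ hg => hg) he he v u (n + (-1 - (i : ℤ))) i).and
    ((hf.eventually_localAct he (B.Y u (-1) v) n).and
    ((hf.congr (he.negligible_hasse_mul 0 n 0) (B.Y u (-1) v)).and
    (((Finset.range I).eventually_all.2 fun i _ => hf.negligible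
      ((he.negligible_hasse_succ i).mul (q := fun N => lin c ^ n * e N) fun N =>
        mul_mem_zeros (lin_zpow_mem_zeros c c' n) (he.mem_zeros N)) (B.Y u (-1 + (i + 1 : ℕ)) v)).and
    (Filter.eventually_ge_atTop (max Ku Kv).toNat))))))).exists
  refine LinearMap.ext fun w => ?_
  have h := congrArg f.1 (opp_normal M (I := I + 1) (fun i hi => hI i (by omega)) c (e k)
    (lin c ^ n * e k) w)
  rw [map_sum, Finset.sum_range_succ', Finset.sum_eq_zero, zero_add] at h
  swap
  · intro i hi
    exact LinearMap.congr_fun (h5 i hi) w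
  have hk : max Ku Kv ≤ k := by omega
  have g1 : f.1 (geomSum c (M.oppOpp v u w) (lin c ^ n * e k) (e k)) = ∑ i ∈ Finset.range J,
      localAct M c e u (-1 - (i : ℤ)) (localAct M c e v (n + i) f.1) w := by
    unfold geomSum
    rw [map_finsum _ (geomSum_support (isContSnd_oppOpp M v u w) _ _ _),
      finsum_eq_sum_of_support_subset (s := Finset.range J)]
    · refine Finset.sum_congr rfl fun i hi => ?_
      rw [← h1 i hi, M.oppOpp_apply, mul_right_comm, ← zpow_natCast, ← zpow_add₀ (lin_ne_zero c),
        mul_comm (e k)]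
      rfl
    · intro i hi
      rw [Finset.coe_range, Set.mem_Iio]
      by_contra hlt
      refine hi ?_
      have := LinearMap.congr_fun (hKv (n + i) (by omega) k (by omega))
        (M.opp u (e k * lin c ^ (-1 - (i : ℤ))) w)
      dsimp only
      rw [M.oppOpp_apply, mul_right_comm, ← zpow_natCast, ← zpow_add₀ (lin_ne_zero c)]
      exact this
  have g2 : f.1 (geomSum c (M.oppOpp u v w) (e k) (lin c ^ n * e k)) = ∑ i ∈ Finset.range J,
      localAct M c e v (n + (-1 - (i : ℤ))) (localAct M c e u i f.1) w := by
    unfold geomSum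
    rw [map_finsum _ (geomSum_support (isContSnd_oppOpp M u v w) _ _ _),
      finsum_eq_sum_of_support_subset (s := Finset.range J)]
    · refine Finset.sum_congr rfl fun i hi => ?_
      rw [← h2 i hi, M.oppOpp_apply, mul_right_comm (lin c ^ n), ← zpow_add₀ (lin_ne_zero c),
        mul_comm (e k), zpow_natCast]
      rfl
    · intro i hi
      rw [Finset.coe_range, Set.mem_Iio]
      by_contra hlt
      refine hi ?_
      have := LinearMap.congr_fun (hKu i (by omega) k (by omega))
        (M.opp v (lin c ^ n * e k * lin c ^ (-1 - (i : ℤ))) w)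
      dsimp only
      rw [M.oppOpp_apply, mul_comm (e k), ← zpow_natCast]
      exact this
  rw [map_add, g1, g2] at h
  rw [LinearMap.sum_apply]
  simp only [LinearMap.add_apply]
  rw [Finset.sum_add_distrib, ← h, ← h3]
  have h4' := LinearMap.congr_fun h4 w
  simp only [binom_zero_right, one_smul, Nat.cast_zero, zero_add, sub_zero, zpow_zero, one_mul] at h4'
  simp only [Nat.cast_zero, add_zero]
  exact h4'.symm

/-- The weak module structure attached to the point `c`. -/
def localModule (hS : ∀ f, f ∈ S ↔ IsKilled M c c' f) (he : IsIdem c c' e) :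
    WeakModule B.toVertexData S where
  Y := localModes M hS he
  trunc := truncModes_localModes hS he
  vacuum n f := Subtype.ext <| by
    rw [coe_localModes, localAct_vac he]
    split_ifs <;> rfl
  jacobi := jacobi_of_comm_of_normal (truncModes_localModes hS he) B.deriv
    (fun v n f => Subtype.ext (((hS _).1 f.2).localAct_translation he v n))
    (localModes_commutator hS he) (localModes_normal hS he)
  virasoro := virasoro_of_commutator (truncModes_localModes hS he)
    (fun n f => Subtype.ext <| by
      rw [coe_localModes, localAct_vac he]
      split_ifs <;> rfl)
    (fun v n f => Subtype.ext (((hS _).1 f.2).localAct_translation he v n))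
    (localModes_commutator hS he)
  deriv v n f := Subtype.ext (((hS _).1 f.2).localAct_translation he v n)

/-- The actions attached to two different points commute. -/
theorem actionsCommute_localModule {e' : ℕ → Lau} (hS : ∀ f, f ∈ S ↔ IsKilled M c c' f)
    (hS' : ∀ f, f ∈ S ↔ IsKilled M c' c f) (he : IsIdem c c' e) (he' : IsIdem c' c e') :
    ActionsCommute (localModule hS he).Y (localModule hS' he').Y := fun u v m n f => by
  have hf := (hS _).1 f.2
  have hf' := (hS' _).1 f.2
  obtain ⟨I, hI⟩ := exists_modes_eq_zero (B := B) u v 0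
  simp only [zero_add] at hI
  -- The commutator of the two modes is a combination of residues with these test functions.
  have hneg : ∀ i : ℕ, Negligible c c' fun N =>
      hasse i (lin c ^ m * e N) * (lin c' ^ n * e' N) := fun i => by
    have hc : ∀ n : ℤ, lin c' ^ n ∈ zeros c c' (-|n|) := fun n => by
      rw [zeros_comm]
      exact lin_zpow_mem_zeros c' c n
    have hm : ∀ N, e' N ∈ zeros c c' 0 := fun N => mem_zeros_zero.2 (he'.mem N)
    have h := ((he.negligible_hasse (lin_zpow_mem_zeros c c' m) i).mul
      (q := fun N => lin c' ^ n * e' N) fun N => mul_mem_zeros (hc n) (hm N)).add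
      ((he.negligible_mul he').mul (q := fun _ => hasse i (lin c ^ m) * lin c' ^ n)
      fun _ => mul_mem_zeros (hasse_mem_zeros (lin_zpow_mem_zeros c c' m) i) (hc n))
    refine fun K => (h K).mono fun N hN => ?_
    dsimp only at hN ⊢
    convert hN using 1
    ring
  refine Subtype.ext ?_
  change localAct M c e u m (localAct M c' e' v n f.1) =
    localAct M c' e' v n (localAct M c e u m f.1)
  obtain ⟨k, h1, h2, h3⟩ :=
    ((hf'.eventually_localAct_localAct (fun g hg => (hS g).1 ((hS' g).2 hg)) he' he u v m n).and
    ((hf.eventually_localAct_localAct (fun g hg => (hS' g).1 ((hS g).2 hg)) he he' v u n m).and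
    ((Finset.range I).eventually_all.2 fun i _ => hf.negligible (hneg i) (B.Y u i v)))).exists
  rw [← h1, ← h2, ← sub_eq_zero, comp_opp_commutator f.1 hI]
  exact Finset.sum_eq_zero h3

end Action

/-! ### Expansions of rational functions -/

section Expansion

variable {X : Type u₂} [AddCommGroup X] [Module ℂ X] {Φ : Lau →ₗ[ℂ] X}

/-- Multiplication of a series in `y = x - c` by `(y-a)^k` is multiplication of the test functions by
the expansion of `(x-c-a)^k` at infinity. -/
theorem mulAtInfty_apply (hΦ : IsCont Φ) (c a : ℂ) (k e : ℤ) :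
    mulAtInfty a k (fun e => Φ (lin c ^ (-e - 1))) e = Φ (lin c ^ (-e - 1) * lin (c + a) ^ k) := by
  obtain ⟨N, hN⟩ := hΦ
  obtain ⟨I, hI⟩ : ∃ I : ℕ, N - e - 1 + k ≤ I := ⟨(N - e - 1 + k).toNat, by omega⟩
  have h := hN _ (deep_antitone (by omega) (mul_mem_deep (lin_zpow_mem_deep c (-e - 1))
    (lin_zpow_sub_sum_mem_deep c (c + a) k I)))
  rw [mul_sub, map_sub, sub_eq_zero] at h
  rw [h, Finset.mul_sum, map_sum, mulAtInfty, finsum_eq_sum_of_support_subset (s := Finset.range I)]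
  · refine Finset.sum_congr rfl fun i _ => ?_
    rw [mul_smul_comm, map_smul, ← zpow_add₀ (lin_ne_zero c), add_sub_cancel_left,
      show -e - 1 + (k - (i : ℤ)) = -(e - k + i) - 1 by ring]
  · intro i hi
    rw [Finset.coe_range, Set.mem_Iio]
    by_contra hlt
    refine hi ?_
    dsimp only
    rw [hN _ (deep_antitone (by omega) (lin_zpow_mem_deep c _)), smul_zero]

/-- The substitution `x ↦ x + z` moves the test functions from powers of `x` to powers of `x - z`. -/
theorem translate_apply (hΦ : IsCont Φ) (z : ℂ) (e : ℤ) :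
    translate z (fun e => Φ (lin 0 ^ (-e - 1))) e = Φ (lin z ^ (-e - 1)) := by
  obtain ⟨N, hN⟩ := hΦ
  obtain ⟨I, hI⟩ : ∃ I : ℕ, N - e - 1 ≤ I := ⟨(N - e - 1).toNat, by omega⟩
  have h := hN _ (deep_antitone (by omega) (lin_zpow_sub_sum_mem_deep 0 z (-e - 1) I))
  rw [map_sub, sub_eq_zero] at h
  rw [h, map_sum, translate, finsum_eq_sum_of_support_subset (s := Finset.range I)]
  · refine Finset.sum_congr rfl fun i _ => ?_
    rw [map_smul, sub_zero, show -e - 1 = -(e + 1) by ring, binom_neg,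
      show e + 1 + (i : ℤ) - 1 = e + i by ring, show -(e + 1) - (i : ℤ) = -(e + i) - 1 by ring]
    congr 1
    have : (-1 : ℂ) ^ i * (-1) ^ i = 1 := by rw [← mul_pow]; simp
    rw [neg_pow z]
    linear_combination (-binom (e + i) i * z ^ i) * this
  · intro i hi
    rw [Finset.coe_range, Set.mem_Iio]
    by_contra hlt
    refine hi ?_
    dsimp only
    rw [hN _ (deep_antitone (by omega) (lin_zpow_mem_deep 0 _)), smul_zero]

theorem polys_le_of_lin_zero_pow {p : Submodule ℂ Lau} (h : ∀ k : ℕ, lin 0 ^ k ∈ p) :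
    polys.toSubmodule ≤ p := by
  rw [polys, Algebra.adjoin_eq_span]
  refine Submodule.span_le.2 fun x hx => ?_
  obtain ⟨k, rfl⟩ := Submonoid.mem_closure_singleton.1 hx
  exact h k

/-- A series `G(x) = ∑ Φ(x^(-e-1)) x^e` satisfies `(x-z)^k x^l G(x) ∈ X[x]` if and only if `Φ` vanishes
on `x^l (x-z)^k ℂ[x]`: the negative coefficients of the product are the values there, and the large
coefficients vanish by continuity. -/
theorem isPolynomial_iff (hΦ : IsCont Φ) (z : ℂ) (k l : ℤ) :
    IsPolynomial (mulX l (mulAtInfty z k fun e => Φ (lin 0 ^ (-e - 1)))) ↔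
      ∀ q ∈ polys, Φ (lin 0 ^ l * lin z ^ k * q) = 0 := by
  have hval : ∀ e, mulX l (mulAtInfty z k fun e => Φ (lin 0 ^ (-e - 1))) e =
      Φ (lin 0 ^ (l - e - 1) * lin z ^ k) := fun e => by
    rw [mulX, mulAtInfty_apply hΦ, zero_add, show -(e - l) - 1 = l - e - 1 by ring]
  constructor
  · intro h q hq
    have hle : polys.toSubmodule ≤
        LinearMap.ker (Φ ∘ₗ LinearMap.mulLeft ℂ (lin 0 ^ l * lin z ^ k)) := by
      refine polys_le_of_lin_zero_pow fun j => ?_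
      have := h.1 (-1 - j) (by omega)
      rw [hval, show l - (-1 - (j : ℤ)) - 1 = l + j by ring, zpow_add₀ (lin_ne_zero 0),
        zpow_natCast] at this
      change Φ (lin 0 ^ l * lin z ^ k * lin 0 ^ j) = 0
      rwa [mul_right_comm]
    exact hle hq
  · intro h
    refine ⟨fun e he => ?_, ?_⟩
    · obtain ⟨j, rfl⟩ : ∃ j : ℕ, e = -1 - j := ⟨(-1 - e).toNat, by omega⟩
      rw [hval, show l - (-1 - (j : ℤ)) - 1 = l + j by ring, zpow_add₀ (lin_ne_zero 0),
        zpow_natCast, mul_right_comm]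
      exact h _ (pow_mem (lin_mem_polys 0) j)
    · obtain ⟨N, hN⟩ := hΦ
      refine (Set.finite_Ico 0 (N + l + k)).subset fun e he => ?_
      rw [Function.mem_support, hval] at he
      refine ⟨?_, ?_⟩
      · by_contra hlt
        obtain ⟨j, rfl⟩ : ∃ j : ℕ, e = -1 - j := ⟨(-1 - e).toNat, by omega⟩
        refine he ?_
        rw [show l - (-1 - (j : ℤ)) - 1 = l + j by ring, zpow_add₀ (lin_ne_zero 0),
          zpow_natCast, mul_right_comm]
        exact h _ (pow_mem (lin_mem_polys 0) j)
      · by_contra hlt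
        exact he (hN _ (deep_antitone (by omega) (mul_mem_deep (lin_zpow_mem_deep 0 _)
          (lin_zpow_mem_deep z _))))

/-- The Taylor polynomial of `(x-c')^j` at `c`, of degree less than `I`. -/
def taylor (c c' : ℂ) (j : ℤ) (I : ℕ) : Lau :=
  ∑ i ∈ Finset.range I, (binom j i * (-(c' - c)) ^ (j - i)) • lin c ^ i

variable {c c' : ℂ}

theorem taylor_mem_polys (j : ℤ) (I : ℕ) : taylor c c' j I ∈ polys :=
  sum_mem fun i _ => polys.smul_mem (pow_mem (lin_mem_polys c) i) _

/-- Multiplication by `x - c'` raises the exponent in the Taylor polynomial, up to the truncation error in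
degree `I`. -/
theorem lin_mul_taylor (h : c ≠ c') (j : ℤ) (I : ℕ) :
    ∃ s : ℂ, lin c' * taylor c c' j I = taylor c c' (j + 1) I + s • lin c ^ I := by
  rcases I with _ | I
  · exact ⟨0, by simp [taylor]⟩
  have h0 : -(c' - c) ≠ 0 := neg_ne_zero.2 (sub_ne_zero.2 h.symm)
  refine ⟨binom j I * (-(c' - c)) ^ (j - I), ?_⟩
  have e : ∀ i : ℕ, lin c' * lin c ^ i = lin c ^ (i + 1) + (-(c' - c)) • lin c ^ i := fun i => by
    rw [lin_eq_sub c c', sub_mul, pow_succ', smul_mul_assoc, one_mul, neg_smul, sub_eq_add_neg]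
  simp only [taylor, Finset.mul_sum, mul_smul_comm, e, smul_add, Finset.sum_add_distrib]
  rw [Finset.sum_range_succ' (fun i => _ • (-(c' - c)) • _), Finset.sum_range_succ
    (fun i => _ • lin c ^ (i + 1)), Finset.sum_range_succ' _ I]
  have e2 : ∑ i ∈ Finset.range I, (binom (j + 1) (i + 1) *
      (-(c' - c)) ^ (j + 1 - ((i + 1 : ℕ) : ℤ))) • lin c ^ (i + 1) =
      ∑ i ∈ Finset.range I, (binom j i * (-(c' - c)) ^ (j - i)) • lin c ^ (i + 1) +
      ∑ i ∈ Finset.range I, (binom j (i + 1) * (-(c' - c)) ^ (j - ((i + 1 : ℕ) : ℤ))) •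
        (-(c' - c)) • lin c ^ (i + 1) := by
    rw [← Finset.sum_add_distrib]
    refine Finset.sum_congr rfl fun i _ => ?_
    rw [binom_succ_succ, show j + 1 - ((i + 1 : ℕ) : ℤ) = j - i by push_cast; ring,
      show j - (i : ℤ) = j - ((i + 1 : ℕ) : ℤ) + 1 by push_cast; ring, zpow_add_one₀ h0]
    module
  rw [e2, binom_zero_right, binom_zero_right, Nat.cast_zero, sub_zero, sub_zero, zpow_add_one₀ h0]
  module

/-- The Taylor polynomials of `(x-c')^(-k)` at `c` approximate this function. -/
theorem exists_lin_zpow_mul_taylor (h : c ≠ c') (k : ℤ) {I : ℕ} (hI : I ≠ 0) : ∃ r ∈ polys,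
    lin c' ^ k * taylor c c' (-k) I = 1 + lin c ^ I * lin c' ^ min k 0 * r := by
  have h0 : taylor c c' 0 I = 1 := by
    rw [taylor, Finset.sum_eq_single_of_mem 0 (Finset.mem_range.2 (Nat.pos_of_ne_zero hI))]
    · simp [binom_zero_right]
    · intro i _ hi
      rw [binom_zero_left, if_neg hi, zero_mul, zero_smul]
  have hp : lin c ^ I ∈ polys := pow_mem (lin_mem_polys c) I
  rcases le_total 0 k with hk | hk
  · obtain ⟨n, rfl⟩ := Int.eq_ofNat_of_zero_le hk
    rw [min_eq_right hk]
    clear hk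
    induction n with
    | zero => exact ⟨0, polys.zero_mem, by simp [h0]⟩
    | succ n ih =>
      obtain ⟨r, hr, e⟩ := ih
      obtain ⟨s, hs⟩ := lin_mul_taylor h (-((n + 1 : ℕ) : ℤ)) I
      rw [show -((n + 1 : ℕ) : ℤ) + 1 = -(n : ℤ) by push_cast; ring] at hs
      refine ⟨r + s • lin c' ^ n, add_mem hr (polys.smul_mem (pow_mem (lin_mem_polys c') n) s), ?_⟩
      rw [zpow_natCast, zpow_zero, mul_one] at e ⊢
      rw [pow_succ, mul_assoc, hs, mul_add, e, mul_add, mul_smul_comm, mul_smul_comm]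
      ring_nf
  · obtain ⟨n, rfl⟩ : ∃ n : ℕ, k = -n := ⟨(-k).toNat, by omega⟩
    rw [min_eq_left hk, neg_neg]
    clear hk
    have key : ∃ r ∈ polys, taylor c c' n I = lin c' ^ n + lin c ^ I * r := by
      induction n with
      | zero => exact ⟨0, polys.zero_mem, by simp [h0]⟩
      | succ n ih =>
        obtain ⟨r, hr, e⟩ := ih
        obtain ⟨s, hs⟩ := lin_mul_taylor h n I
        refine ⟨lin c' * r - s • (1 : Lau), sub_mem (mul_mem (lin_mem_polys c') hr)
          (polys.smul_mem polys.one_mem s), ?_⟩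
        rw [Nat.cast_succ, ← sub_eq_iff_eq_add.2 hs, e, pow_succ, mul_sub, mul_smul_comm, mul_one]
        ring
    obtain ⟨r, hr, e⟩ := key
    refine ⟨r, hr, ?_⟩
    rw [e, mul_add, ← zpow_natCast (lin c') n, ← zpow_add₀ (lin_ne_zero c'), neg_add_cancel,
      zpow_zero]
    ring

/-- The mode at `c` of a functional that vanishes on `(x-c)^l (x-c')^k ℂ[x]`, computed by the
expansion of `(x-c')^(-k)` at `c`. -/
theorem mulAtZero_apply {e : ℕ → Lau} (he : IsIdem c c' e) (h : c ≠ c') {k l : ℤ}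
    (hΦ : ∀ q ∈ polys, Φ (lin c ^ l * lin c' ^ k * q) = 0) (n : ℤ) : ∀ᶠ N in Filter.atTop,
    mulAtZero (c' - c) (-k) (fun e => Φ (lin c ^ (-e - 1) * lin c' ^ k)) (-n - 1) =
      Φ (lin c ^ n * e N) := by
  have hle : ∀ {a b : ℤ}, l ≤ a → k ≤ b → ∀ q ∈ polys, Φ (lin c ^ a * lin c' ^ b * q) = 0 := by
    intro a b ha hb q hq
    obtain ⟨i, rfl⟩ : ∃ i : ℕ, a = l + i := ⟨(a - l).toNat, by omega⟩
    obtain ⟨j, rfl⟩ : ∃ j : ℕ, b = k + j := ⟨(b - k).toNat, by omega⟩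
    have := hΦ _ (mul_mem (mul_mem (pow_mem (lin_mem_polys c) i) (pow_mem (lin_mem_polys c') j)) hq)
    rw [zpow_add₀ (lin_ne_zero c), zpow_add₀ (lin_ne_zero c'), zpow_natCast, zpow_natCast]
    rw [← this]
    congr 1
    ring
  obtain ⟨I, hI0, hI⟩ : ∃ I : ℕ, I ≠ 0 ∧ l - n ≤ I := ⟨(l - n).toNat + 1, by omega, by omega⟩
  have hsum : mulAtZero (c' - c) (-k) (fun e => Φ (lin c ^ (-e - 1) * lin c' ^ k)) (-n - 1) =
      Φ (lin c ^ n * (lin c' ^ k * taylor c c' (-k) I)) := by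
    unfold mulAtZero
    rw [taylor, Finset.mul_sum, Finset.mul_sum, map_sum,
      finsum_eq_sum_of_support_subset (s := Finset.range I)]
    · refine Finset.sum_congr rfl fun i _ => ?_
      dsimp only
      rw [show -(-n - 1 - (i : ℤ)) - 1 = n + i by ring, zpow_add₀ (lin_ne_zero c), zpow_natCast,
        mul_smul_comm, mul_smul_comm, map_smul]
      congr 2
      ring
    · intro i hi
      rw [Finset.coe_range, Set.mem_Iio]
      by_contra hlt
      refine hi ?_
      have := hle (show l ≤ n + i by omega) le_rfl 1 polys.one_mem
      rw [mul_one] at this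
      dsimp only
      rw [show -(-n - 1 - (i : ℤ)) - 1 = n + i by ring, this, smul_zero]
  obtain ⟨r, hr, hr'⟩ := exists_lin_zpow_mul_taylor h k hI0
  filter_upwards [Filter.eventually_ge_atTop (max (l - n) (max k (k - min k 0))).toNat] with N hN
  obtain ⟨q, hq, hnear⟩ := he.near N
  obtain ⟨q', hq', hfar⟩ := he.far N
  rw [hsum, ← sub_eq_zero, ← map_sub]
  -- With `g = (x-c')^k taylor`, the difference `g - e_N` is `g (1 - e_N) + (g - 1) e_N`; here
  -- `1 - e_N` and `g - 1` vanish to high order at `c`, and `e_N` vanishes to high order at `c'`.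
  have d1 : lin c ^ n * (lin c' ^ k * taylor c c' (-k) I) - lin c ^ n * e N =
      lin c ^ (n + N) * lin c' ^ k * (-q * taylor c c' (-k) I) +
      lin c ^ (n + I) * lin c' ^ (min k 0 + N) * (r * q') := by
    have a1 : lin c ^ (n + N) * -q = lin c ^ n * (1 - e N) := by
      rw [hnear, zpow_add₀ (lin_ne_zero c), zpow_natCast]
      ring
    have a2 : lin c ^ (n + I) * lin c' ^ (min k 0 + N) * (r * q') =
        lin c ^ n * (lin c' ^ k * taylor c c' (-k) I - 1) * e N := by
      rw [hr', hfar, zpow_add₀ (lin_ne_zero c), zpow_add₀ (lin_ne_zero c'), zpow_natCast,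
        zpow_natCast]
      ring
    rw [a2]
    linear_combination (-lin c' ^ k * taylor c c' (-k) I) * a1
  rw [d1, map_add, hle (by omega) le_rfl _ (mul_mem (neg_mem hq) (taylor_mem_polys _ _)),
    hle (by omega) (by omega) _ (mul_mem hr hq'), add_zero]

end Expansion

section Regular

variable {V : Type u₁} [AddCommGroup V] [Module ℂ V] {B : VertexOperatorAlgebra V}
  {W : Type u₂} [AddCommGroup W] [Module ℂ W] (M : WeakModule B.toVertexData W)
  {U : Type u₃} [AddCommGroup U] [Module ℂ U] (z : ℂ)

theorem isCont_comp_opp (v : V) (f : W →ₗ[ℂ] U) (w : W) : IsCont (f ∘ₗ (M.opp v).flip w) := by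
  obtain ⟨N, hN⟩ := M.exists_opp_eq_zero v w
  exact ⟨N, fun p hp => (congrArg f (hN p hp)).trans (map_zero f)⟩

/-- The coefficients of `f(Yᵒ(v,x)w)` are the values of a continuous functional on the powers of `x`. -/
theorem coeff_eq_comp_opp (v : V) (f : W →ₗ[ℂ] U) (w : W) :
    (fun e => f (oppositeCoeff M v e w)) =
      fun e => (f ∘ₗ (M.opp v).flip w) (lin 0 ^ (-e - 1)) := funext fun e => by
  rw [LinearMap.comp_apply, LinearMap.flip_apply, M.opp_lin_zero_zpow, show -(-e - 1) - 1 = e by ring]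

theorem admissible_iff (v : V) (f : W →ₗ[ℂ] U) (k l : ℤ) : Admissible M z v f k l ↔
    ∀ w, ∀ q ∈ polys, (f ∘ₗ (M.opp v).flip w) (lin 0 ^ l * lin z ^ k * q) = 0 := by
  refine forall_congr' fun w => ?_
  rw [coeff_eq_comp_opp, isPolynomial_iff (isCont_comp_opp M v f w)]

/-- Membership in `D_{P(z)}(W,U)` in terms of test functions. The functionals `u*` disappear, because
they separate the vectors of `U`. -/
theorem mem_regularSpace_iff (f : W →ₗ[ℂ] U) : f ∈ regularSpace M z U ↔ IsKilled M 0 z f := by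
  refine forall_congr' fun v => ?_
  have key : ∀ k l : ℕ, (∀ (φ : Module.Dual ℂ U) (w : W), IsPolynomial
      (mulX (l : ℤ) (mulAtInfty z k fun e => φ (f (oppositeCoeff M v e w))))) ↔
      ∀ w, ∀ q ∈ polys, f (M.opp v (lin 0 ^ (l : ℤ) * lin z ^ (k : ℤ) * q) w) = 0 := by
    intro k l
    have h : ∀ (φ : Module.Dual ℂ U) (w : W), IsPolynomial
      (mulX (l : ℤ) (mulAtInfty z k fun e => φ (f (oppositeCoeff M v e w)))) ↔
      ∀ q ∈ polys, φ (f (M.opp v (lin 0 ^ (l : ℤ) * lin z ^ (k : ℤ) * q) w)) = 0 := fun φ w => by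
      have := coeff_eq_comp_opp M v (φ ∘ₗ f) w
      simp only [LinearMap.comp_apply] at this
      rw [this]
      exact isPolynomial_iff (isCont_comp_opp M v (φ ∘ₗ f) w) z k l
    simp only [h]
    constructor
    · intro h w q hq
      exact (Module.forall_dual_apply_eq_zero_iff ℂ _).1 fun φ => h φ w q hq
    · intro h φ w q hq
      rw [h w q hq, map_zero]
  simp only [key]
  constructor
  · rintro ⟨k, l, h⟩
    refine ⟨max k l, fun p hp => LinearMap.ext fun w => ?_⟩
    obtain ⟨q, hq, rfl⟩ := mem_zeros.1 hp
    obtain ⟨i, hi⟩ : ∃ i : ℕ, (max k l : ℤ) = k + i := ⟨(max k l : ℤ).toNat - k, by omega⟩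
    obtain ⟨j, hj⟩ : ∃ j : ℕ, (max k l : ℤ) = l + j := ⟨(max k l : ℤ).toNat - l, by omega⟩
    have := h w _ (mul_mem (mul_mem (pow_mem (lin_mem_polys 0) j) (pow_mem (lin_mem_polys z) i)) hq)
    rw [LinearMap.comp_apply, LinearMap.zero_apply, ← this]
    congr 3
    nth_rw 1 [hj]
    rw [hi, zpow_add₀ (lin_ne_zero _), zpow_add₀ (lin_ne_zero _), zpow_natCast _ j,
      zpow_natCast _ i]
    ring
  · rintro ⟨K, hK⟩
    refine ⟨K.toNat, K.toNat, fun w q hq => LinearMap.congr_fun (hK _ ?_) w⟩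
    exact mul_mem_zeros_of_le (by omega) (by omega) hq

theorem mem_regularSpace_iff' (f : W →ₗ[ℂ] U) : f ∈ regularSpace M z U ↔ IsKilled M z 0 f := by
  rw [mem_regularSpace_iff]
  simp only [IsKilled, zeros_comm 0 z]

theorem exists_admissible (v : V) (f : regularSpace M z U) :
    ∃ k l : ℤ, Admissible M z v f.1 k l := by
  obtain ⟨K, hK⟩ := (mem_regularSpace_iff M z f.1).1 f.2 v
  refine ⟨K, K, (admissible_iff M z v f.1 K K).2 fun w q hq => ?_⟩
  exact LinearMap.congr_fun (hK _ (mul_mem_zeros_of_le le_rfl le_rfl hq)) w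

variable {z} {e : ℕ → Lau}

/-- The action attached to `0` is `Y^R_{P(z)}`. -/
theorem isRightAction_localModule (hz : z ≠ 0) (he : IsIdem 0 z e) :
    IsRightAction M z (localModule (mem_regularSpace_iff (U := U) M z) he).Y := fun v f => by
  refine ⟨exists_admissible M z v f, fun k l hkl n w => ?_⟩
  rw [admissible_iff] at hkl
  obtain ⟨N, h1, h2⟩ := ((((mem_regularSpace_iff M z f.1).1 f.2).eventually_localAct he v n).and
    (mulAtZero_apply he hz.symm (hkl w) n)).exists
  have hG : (mulAtInfty z k fun e => f.1 (oppositeCoeff M v e w)) =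
      fun e => (f.1 ∘ₗ (M.opp v).flip w) (lin 0 ^ (-e - 1) * lin z ^ k) := funext fun e => by
    rw [coeff_eq_comp_opp, mulAtInfty_apply (isCont_comp_opp M v f.1 w), zero_add]
  rw [sub_zero] at h2
  rw [hG, h2]
  exact (LinearMap.congr_fun h1 w).symm

/-- The action attached to `z` is `Y^L_{P(z)}`. -/
theorem isLeftAction_localModule (hz : z ≠ 0) (he : IsIdem z 0 e) :
    IsLeftAction M z (localModule (mem_regularSpace_iff' (U := U) M z) he).Y := fun v f => by
  refine ⟨exists_admissible M z v f, fun k l hkl n w => ?_⟩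
  rw [admissible_iff] at hkl
  obtain ⟨N, h1, h2⟩ := ((((mem_regularSpace_iff' M z f.1).1 f.2).eventually_localAct he v n).and
    (mulAtZero_apply he hz (k := l) (l := k) (Φ := f.1 ∘ₗ (M.opp v).flip w) (fun q hq => by
      rw [mul_comm (lin z ^ k)]
      exact hkl w q hq) n)).exists
  have hG : (mulAtInfty (-z) l (translate z fun e => f.1 (oppositeCoeff M v e w))) =
      fun e => (f.1 ∘ₗ (M.opp v).flip w) (lin z ^ (-e - 1) * lin 0 ^ l) := funext fun e => by
    have : (translate z fun e => f.1 (oppositeCoeff M v e w)) =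
        fun e => (f.1 ∘ₗ (M.opp v).flip w) (lin z ^ (-e - 1)) := funext fun e => by
      rw [coeff_eq_comp_opp, translate_apply (isCont_comp_opp M v f.1 w)]
    rw [this, mulAtInfty_apply (isCont_comp_opp M v f.1 w), add_neg_cancel]
  rw [zero_sub] at h2
  rw [hG, h2]
  exact (LinearMap.congr_fun h1 w).symm

end Regular

/-! ### Locality and the Jacobi identity -/

section Delta

variable {X : Type*} [AddCommGroup X]

/-- Multiplication of `∑ a(m,n) x₁^(-m-1) x₂^(-n-1)` by `x₁ - x₂`. -/
def delta (a : ℤ → ℤ → X) (m n : ℤ) : X := a (m + 1) n - a m (n + 1)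

theorem delta_iterate_induction {P : (ℤ → ℤ → X) → Prop} (hP : ∀ a, P a → P (delta a))
    {a : ℤ → ℤ → X} (ha : P a) (k : ℕ) : P (delta^[k] a) := by
  induction k with
  | zero => exact ha
  | succ k ih =>
    rw [Function.iterate_succ_apply']
    exact hP _ ih

theorem delta_iterate_comp {X' : Type*} [AddCommGroup X'] (φ : X →+ X') (a : ℤ → ℤ → X) (k : ℕ)
    (m n : ℤ) : delta^[k] (fun p q => φ (a p q)) m n = φ (delta^[k] a m n) := by
  induction k generalizing m n with
  | zero => rfl
  | succ k ih =>
    rw [Function.iterate_succ_apply', Function.iterate_succ_apply', delta, delta, ih, ih, map_sub]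

theorem TruncSnd.delta {N : ℤ} {a : ℤ → ℤ → X} (ha : TruncSnd N a) : TruncSnd N (delta a) :=
  fun m n hn => by rw [RegularRep.delta, ha _ _ hn, ha _ _ (by omega), sub_zero]

theorem TruncSnd.delta_iterate {N : ℤ} {a : ℤ → ℤ → X} (ha : TruncSnd N a) (k : ℕ) :
    TruncSnd N (RegularRep.delta^[k] a) :=
  delta_iterate_induction (P := TruncSnd N) (fun _ => TruncSnd.delta) ha k

variable [Module ℂ X]

theorem halfSum_add_one {N : ℤ} {a : ℤ → ℤ → X} (ha : TruncSnd N a) (l m n : ℤ) :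
    halfSum a (l + 1) m n = halfSum (delta a) l m n := by
  obtain ⟨K, hK⟩ : ∃ K : ℕ, N ≤ n + K := ⟨(N - n).toNat, by omega⟩
  rw [halfSum_succ ha, halfSum_eq_sum ha.delta l m n hK,
    halfSum_eq_sum ha l (m + 1) n hK, halfSum_eq_sum ha l m (n + 1) (K := K) (by omega),
    ← Finset.sum_sub_distrib]
  refine Finset.sum_congr rfl fun i _ => ?_
  rw [← smul_sub, delta, show m + 1 + l - (i : ℤ) = m + l - i + 1 by ring,
    show n + 1 + (i : ℤ) = n + i + 1 by ring]

theorem halfSum_add_natCast {N : ℤ} {a : ℤ → ℤ → X} (ha : TruncSnd N a) (l : ℤ) (k : ℕ)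
    (m n : ℤ) : halfSum a (l + k) m n = halfSum (delta^[k] a) l m n := by
  induction k generalizing a with
  | zero => simp
  | succ k ih =>
    rw [Function.iterate_succ_apply, ← ih ha.delta, Nat.cast_succ, ← add_assoc,
      halfSum_add_one ha]

theorem halfSum_natCast {N : ℤ} {a : ℤ → ℤ → X} (ha : TruncSnd N a) (k : ℕ) (m n : ℤ) :
    halfSum a k m n = delta^[k] a m n := by
  rw [← zero_add (k : ℤ), halfSum_add_natCast ha, halfSum_zero]

theorem binom_neg_one_sub (J i : ℕ) :
    (-1 : ℂ) ^ i * binom (-1 - J) i = ((J + i).choose J : ℂ) := by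
  rw [show (-1 : ℤ) - J = -(1 + J) by ring, binom_neg, ← mul_assoc, ← mul_pow,
    show (1 : ℤ) + J + i - 1 = ((J + i : ℕ) : ℤ) by push_cast; ring, binom_natCast,
    Nat.choose_symm_add]
  simp

/-- Two families `a(m,n)`, `b(n,m)` that become equal after multiplication by
`(x₁ - x₂)^N` define, after this multiplication, a series `G(x₁,x₂)` with finitely many negative
powers of both variables. The two expansions of `(x₁ - x₂)^(-1-J) G(x₁,x₂)` differ by
a delta function, whose coefficient is `(1/J!) (∂/∂x₁)^J G` on the diagonal. -/
theorem halfSum_sub_halfSum {a b : ℤ → ℤ → X} {Na Nb : ℤ} (ha : TruncSnd Na a)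
    (hb : TruncSnd Nb b) {N : ℕ}
    (hloc : ∀ m n, delta^[N] a m n = (-1 : ℂ) ^ N • delta^[N] b n m) (J : ℕ) (n : ℤ) :
    halfSum a (N - 1 - J) 0 n - (-1 : ℂ) ^ ((N : ℤ) - 1 - J) • halfSum b (N - 1 - J) n 0 =
      ∑ᶠ k : ℤ, binom (-k - 1) J • delta^[N] a k (n - 1 - J - k) := by
  -- The terms with `k ≥ 0` on the right come from the expansion in powers of `x₁`, those with
  -- `k < -J` from the expansion in powers of `x₂`, and the coefficient vanishes for `-J ≤ k < 0`.
  obtain ⟨g, hg⟩ : ∃ g, g = delta^[N] a := ⟨_, rfl⟩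
  have hga := ha.delta_iterate N
  have hgb := hb.delta_iterate N
  have hsq : (-1 : ℂ) ^ N * (-1) ^ N = 1 := by rw [← mul_pow]; simp
  have hloc' : ∀ m n, delta^[N] b n m = (-1 : ℂ) ^ N • g m n := fun m n => by
    rw [hg, hloc, smul_smul, hsq, one_smul]
  have hg2 : ∀ k n, Nb ≤ k → g k n = 0 := fun k n hk => by
    rw [hg, hloc, hgb _ _ hk, smul_zero]
  rw [← hg] at hga ⊢
  obtain ⟨K, hK1, hK2⟩ : ∃ K : ℕ, Na ≤ n + K ∧ Nb ≤ K :=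
    ⟨(max (Na - n) Nb).toNat, by omega, by omega⟩
  rw [show (N : ℤ) - 1 - J = -1 - J + N by ring, halfSum_add_natCast ha, halfSum_add_natCast hb,
    ← hg, halfSum_eq_sum hga _ _ _ hK1, halfSum_eq_sum hgb (-1 - J) n 0 (K := K) (by omega),
    finsum_eq_sum_of_support_subset (s := (Finset.range K).image (fun i : ℕ => (i : ℤ)) ∪
      (Finset.range (J + K)).image (fun i : ℕ => (-1 - i : ℤ))), Finset.sum_union,
    Finset.sum_image fun i _ j _ h => by simpa using h,
    Finset.sum_image fun i _ j _ h => by simpa using h, Finset.sum_range_add,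
    Finset.sum_eq_zero (s := Finset.range J), zero_add, sub_eq_add_neg, add_comm, Finset.smul_sum,
    ← Finset.sum_neg_distrib]
  · congr 1
    · refine Finset.sum_congr rfl fun i _ => ?_
      rw [hloc', smul_smul, smul_smul, ← neg_smul, zero_add, binom_neg_one_sub,
        show -(i : ℤ) - 1 = -(i + 1) by ring, binom_neg,
        show (i : ℤ) + 1 + J - 1 = ((J + i : ℕ) : ℤ) by push_cast; ring, binom_natCast,
        show n + (-1 - J) - (i : ℤ) = n - 1 - J - i by ring, zpow_add₀ (by norm_num), zpow_natCast]
      congr 1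
      have h1 : (-1 : ℂ) ^ (-1 - (J : ℤ)) = -(-1) ^ J := by
        rw [zpow_sub₀ (by norm_num), zpow_natCast, div_eq_mul_inv, ← inv_pow]
        norm_num
      rw [h1]
      linear_combination ((-1 : ℂ) ^ J * (J + i).choose J) * hsq
    · rw [zero_add]
      refine Finset.sum_congr rfl fun i _ => ?_
      rw [binom_neg_one_sub, show -(-1 - ((J + i : ℕ) : ℤ)) - 1 = ((J + i : ℕ) : ℤ) by ring,
        binom_natCast, show -1 - (J : ℤ) - i = -1 - ((J + i : ℕ) : ℤ) by push_cast; ring,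
        show n - 1 - J - (-1 - ((J + i : ℕ) : ℤ)) = n + i by push_cast; ring]
  · intro i hi
    rw [show -(-1 - (i : ℤ)) - 1 = (i : ℤ) by ring, binom_natCast,
      Nat.choose_eq_zero_of_lt (Finset.mem_range.1 hi), Nat.cast_zero, zero_smul]
  · refine Finset.disjoint_left.2 fun k h1 h2 => ?_
    obtain ⟨i, _, rfl⟩ := Finset.mem_image.1 h1
    obtain ⟨j, _, h⟩ := Finset.mem_image.1 h2
    omega
  · intro k hk
    rw [Finset.coe_union, Set.mem_union, Finset.mem_coe, Finset.mem_coe, Finset.mem_image,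
      Finset.mem_image]
    by_contra hcon
    rw [not_or] at hcon
    refine hk ?_
    dsimp only
    rcases lt_or_ge k 0 with h0 | h0
    · rw [hga, smul_zero]
      by_contra hlt
      exact hcon.2 ⟨(-1 - k).toNat, Finset.mem_range.2 (by omega), by omega⟩
    · rw [hg2, smul_zero]
      by_contra hlt
      exact hcon.1 ⟨k.toNat, Finset.mem_range.2 (by omega), by omega⟩

end Delta

section Locality

variable {V : Type u₁} [AddCommGroup V] [Module ℂ V] {A : VertexData V}
  {D : Type u₂} [AddCommGroup D] [Module ℂ D]

/-- The family `u_p v_q w`. -/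
def modePair (Y : V →ₗ[ℂ] ℤ → Module.End ℂ D) (u v : V) (w : D) (p q : ℤ) : D :=
  Y u p (Y v q w)

/-- Locality: the commutator of two vertex operators is annihilated by a power of `x₁ - x₂`. -/
theorem WeakModule.locality (T : WeakModule A D) {u v : V} {N : ℕ}
    (hN : ∀ n : ℤ, N ≤ n → A.Y u n v = 0) (w : D) (m n : ℤ) :
    delta^[N] (modePair T.Y u v w) m n = (-1 : ℂ) ^ N • delta^[N] (modePair T.Y v u w) n m := by
  obtain ⟨N₁, h1⟩ := T.truncModes.exists_truncSnd u v w
  obtain ⟨N₂, h2⟩ := T.truncModes.exists_truncSnd v u w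
  have h := T.jacobi u v N m n w
  rw [jacobiLHS_eq_sum T.Y hN N m n w (K := 0) (by simp), Finset.sum_range_zero,
    jacobiRHS_eq_halfSum T.truncModes, halfSum_natCast h1, halfSum_natCast h2, zpow_natCast] at h
  exact sub_eq_zero.1 h.symm

/-- The modes of `u_{N-1-J}v`, as residues of derivatives of `(x₁ - x₂)^N Y(u,x₁) Y(v,x₂)w`. -/
theorem WeakModule.mode_eq_finsum (T : WeakModule A D) {u v : V} {N : ℕ}
    (hN : ∀ n : ℤ, N ≤ n → A.Y u n v = 0) (J : ℕ) (n : ℤ) (w : D) :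
    T.Y (A.Y u (N - 1 - J) v) n w =
      ∑ᶠ k : ℤ, binom (-k - 1) J • delta^[N] (modePair T.Y u v w) k (n - 1 - J - k) := by
  obtain ⟨N₁, h1⟩ := T.truncModes.exists_truncSnd u v w
  obtain ⟨N₂, h2⟩ := T.truncModes.exists_truncSnd v u w
  rw [← jacobiLHS_zero, T.jacobi, jacobiRHS_eq_halfSum T.truncModes]
  exact halfSum_sub_halfSum h1 h2 (T.locality hN w) J n

/-- The Jacobi identity follows from locality and the formula for the modes of `u_l v`. -/
theorem jacobi_of_locality {Y : V →ₗ[ℂ] ℤ → Module.End ℂ D} (hY : TruncModes Y) {u v : V} {N : ℕ}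
    (hN : ∀ n : ℤ, N ≤ n → A.Y u n v = 0) {w : D} (hloc : ∀ m n, delta^[N] (modePair Y u v w) m n =
      (-1 : ℂ) ^ N • delta^[N] (modePair Y v u w) n m)
    (hmode : ∀ (J : ℕ) (n : ℤ), Y (A.Y u (N - 1 - J) v) n w =
      ∑ᶠ k : ℤ, binom (-k - 1) J • delta^[N] (modePair Y u v w) k (n - 1 - J - k)) (l m n : ℤ) :
    jacobiLHS A Y u v l m n w = jacobiRHS Y u v l m n w := by
  obtain ⟨N₁, h1⟩ := hY.exists_truncSnd u v w
  obtain ⟨N₂, h2⟩ := hY.exists_truncSnd v u w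
  have h0 : ∀ m n, jacobiLHS A Y u v N m n w = jacobiRHS Y u v N m n w := fun m n => by
    rw [jacobiLHS_eq_sum Y hN N m n w (K := 0) (by simp), Finset.sum_range_zero,
      jacobiRHS_eq_halfSum hY, halfSum_natCast h1, halfSum_natCast h2, zpow_natCast]
    exact (sub_eq_zero.2 (hloc m n)).symm
  rcases le_or_gt (N : ℤ) l with hl | hl
  · obtain ⟨k, rfl⟩ : ∃ k : ℕ, l = N + k := ⟨(l - N).toNat, by omega⟩
    exact jacobi_of_nonneg hY h0 k m n
  · obtain ⟨J, rfl⟩ : ∃ J : ℕ, l = N - 1 - J := ⟨(N - 1 - l).toNat, by omega⟩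
    clear hl
    have hstep : ∀ (J : ℕ) (n : ℤ), jacobiLHS A Y u v (N - 1 - J) 0 n w =
        jacobiRHS Y u v (N - 1 - J) 0 n w := fun J n => by
      rw [jacobiLHS_zero, hmode, jacobiRHS_eq_halfSum hY]
      exact (halfSum_sub_halfSum h1 h2 hloc J n).symm
    induction J generalizing m n with
    | zero =>
      refine jacobi_of_zero hY (hstep 0) (fun m n => ?_) m n
      simpa using h0 m n
    | succ J ih =>
      refine jacobi_of_zero hY (hstep (J + 1)) (fun m n => ?_) m n
      rw [show (N : ℤ) - 1 - ((J + 1 : ℕ) : ℤ) + 1 = N - 1 - J by push_cast; ring]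
      exact ih m n

end Locality

/-! ### Products of commuting vertex operators -/

section Conv

variable {X : Type*} [AddCommGroup X]

/-- The condition on a family `E(p,q,r,s)` that makes the sums in `conv` finite. -/
def FourTrunc (E : ℤ → ℤ → ℤ → ℤ → X) : Prop :=
  (∃ Q, ∀ p q r s, Q ≤ q ∨ Q ≤ s → E p q r s = 0) ∧
    ∀ q s, ∃ P, ∀ p r, P ≤ p ∨ P ≤ r → E p q r s = 0

/-- The family of coefficients of the restriction of `∑ E(p,q,r,s) x₁^(-p-1) x₂^(-q-1) y₁^(-r-1)
y₂^(-s-1)` to `y₁ = x₁`, `y₂ = x₂`. -/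
def conv (E : ℤ → ℤ → ℤ → ℤ → X) (m n : ℤ) : X :=
  ∑ᶠ x : ℤ × ℤ, E x.1 x.2 (m - 1 - x.1) (n - 1 - x.2)

variable {E : ℤ → ℤ → ℤ → ℤ → X}

theorem FourTrunc.support (hE : FourTrunc E) (m n : ℤ) :
    (Function.support fun x : ℤ × ℤ => E x.1 x.2 (m - 1 - x.1) (n - 1 - x.2)).Finite := by
  obtain ⟨⟨Q, hQ⟩, h2⟩ := hE
  choose P hP using h2
  refine ((Set.finite_Ioo (n - 1 - Q) Q).biUnion fun q _ =>
    (Set.finite_Ioo (m - 1 - P q (n - 1 - q)) (P q (n - 1 - q))).image fun p => (p, q)).subset ?_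
  rintro ⟨p, q⟩ hx
  rw [Function.mem_support] at hx
  have h1 : ¬ (Q ≤ q ∨ Q ≤ n - 1 - q) := fun h => hx (hQ _ _ _ _ h)
  have h2 : ¬ (P q (n - 1 - q) ≤ p ∨ P q (n - 1 - q) ≤ m - 1 - p) := fun h =>
    hx (hP _ _ _ _ h)
  exact Set.mem_biUnion (x := q) ⟨by omega, by omega⟩ ⟨p, ⟨by omega, by omega⟩, rfl⟩

theorem FourTrunc.delta_fst (hE : FourTrunc E) : FourTrunc (delta E) := by
  obtain ⟨⟨Q, hQ⟩, h2⟩ := hE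
  refine ⟨⟨Q, fun p q r s h => ?_⟩, fun q s => ?_⟩
  · change E (p + 1) q r s - E p (q + 1) r s = 0
    rw [hQ _ _ _ _ h, hQ _ _ _ _ (by omega), sub_zero]
  · obtain ⟨P, hP⟩ := h2 q s
    obtain ⟨P', hP'⟩ := h2 (q + 1) s
    refine ⟨max P P', fun p r h => ?_⟩
    change E (p + 1) q r s - E p (q + 1) r s = 0
    rw [hP _ _ (by omega), hP' _ _ (by omega), sub_zero]

theorem FourTrunc.delta_snd (hE : FourTrunc E) : FourTrunc fun p q => delta (E p q) := by
  obtain ⟨⟨Q, hQ⟩, h2⟩ := hE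
  refine ⟨⟨Q, fun p q r s h => ?_⟩, fun q s => ?_⟩
  · change E p q (r + 1) s - E p q r (s + 1) = 0
    rw [hQ _ _ _ _ (by omega), hQ _ _ _ _ (by omega), sub_zero]
  · obtain ⟨P, hP⟩ := h2 q s
    obtain ⟨P', hP'⟩ := h2 q (s + 1)
    refine ⟨max P P', fun p r h => ?_⟩
    change E p q (r + 1) s - E p q r (s + 1) = 0
    rw [hP _ _ (by omega), hP' _ _ (by omega), sub_zero]

theorem conv_delta_fst (hE : FourTrunc E) : conv (delta E) = delta (conv E) := by
  funext m n
  have e1 : ∀ x : ℤ × ℤ, E (x.1 + 1) x.2 (m - 1 - x.1) (n - 1 - x.2) =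
      (fun x : ℤ × ℤ => E x.1 x.2 (m + 1 - 1 - x.1) (n - 1 - x.2))
        (((Equiv.addRight (1 : ℤ)).prodCongr (Equiv.refl ℤ)) x) := fun x => by
    simp only [Equiv.prodCongr_apply, Prod.map_fst, Prod.map_snd, Equiv.coe_addRight,
      Equiv.refl_apply]
    rw [show m + 1 - 1 - (x.1 + 1) = m - 1 - x.1 by ring]
  have e2 : ∀ x : ℤ × ℤ, E x.1 (x.2 + 1) (m - 1 - x.1) (n - 1 - x.2) =
      (fun x : ℤ × ℤ => E x.1 x.2 (m - 1 - x.1) (n + 1 - 1 - x.2))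
        (((Equiv.refl ℤ).prodCongr (Equiv.addRight (1 : ℤ))) x) := fun x => by
    simp only [Equiv.prodCongr_apply, Prod.map_fst, Prod.map_snd, Equiv.coe_addRight,
      Equiv.refl_apply]
    rw [show n + 1 - 1 - (x.2 + 1) = n - 1 - x.2 by ring]
  change ∑ᶠ x : ℤ × ℤ, (E (x.1 + 1) x.2 (m - 1 - x.1) (n - 1 - x.2) -
    E x.1 (x.2 + 1) (m - 1 - x.1) (n - 1 - x.2)) = conv E (m + 1) n - conv E m (n + 1)
  simp only [e1, e2]
  rw [finsum_sub_distrib ((hE.support (m + 1) n).preimage (Equiv.injective _).injOn)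
    ((hE.support m (n + 1)).preimage (Equiv.injective _).injOn)]
  exact congrArg₂ (· - ·)
    (finsum_comp_equiv (f := fun x : ℤ × ℤ => E x.1 x.2 (m + 1 - 1 - x.1) (n - 1 - x.2)) _)
    (finsum_comp_equiv (f := fun x : ℤ × ℤ => E x.1 x.2 (m - 1 - x.1) (n + 1 - 1 - x.2)) _)

theorem conv_delta_snd (hE : FourTrunc E) : conv (fun p q => delta (E p q)) = delta (conv E) := by
  funext m n
  rw [delta, conv, conv, conv, ← finsum_sub_distrib (hE.support (m + 1) n) (hE.support m (n + 1))]
  refine finsum_congr fun x => ?_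
  rw [delta, show m - 1 - x.1 + 1 = m + 1 - 1 - x.1 by ring,
    show n - 1 - x.2 + 1 = n + 1 - 1 - x.2 by ring]

end Conv

section ProdFam

variable {D : Type u₂} [AddCommGroup D] [Module ℂ D]

/-- The family `a(p,q) b(r,s) w`. -/
def prodFam (a b : ℤ → ℤ → Module.End ℂ D) (w : D) (p q r s : ℤ) : D := a p q (b r s w)

theorem conv_prodFam {a b : ℤ → ℤ → Module.End ℂ D} {w : D} (h : FourTrunc (prodFam a b w))
    (N N' : ℕ) :
    conv (prodFam (delta^[N] a) (delta^[N'] b) w) = delta^[N + N'] (conv (prodFam a b w)) := by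
  have h1 : ∀ k, FourTrunc (prodFam a (delta^[k] b) w) ∧
      conv (prodFam a (delta^[k] b) w) = delta^[k] (conv (prodFam a b w)) := fun k => by
    induction k with
    | zero => exact ⟨h, rfl⟩
    | succ k ih =>
      have e : prodFam a (delta^[k + 1] b) w =
          fun p q => delta (prodFam a (delta^[k] b) w p q) := by
        funext p q r s
        rw [Function.iterate_succ_apply']
        simp [prodFam, delta]
      rw [e, Function.iterate_succ_apply', ← ih.2]
      exact ⟨ih.1.delta_snd, conv_delta_snd ih.1⟩
  have h2 : ∀ k, FourTrunc (prodFam (delta^[k] a) (delta^[N'] b) w) ∧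
      conv (prodFam (delta^[k] a) (delta^[N'] b) w) =
        delta^[k] (conv (prodFam a (delta^[N'] b) w)) := fun k => by
    induction k with
    | zero => exact ⟨(h1 N').1, rfl⟩
    | succ k ih =>
      have e : prodFam (delta^[k + 1] a) (delta^[N'] b) w =
          delta (prodFam (delta^[k] a) (delta^[N'] b) w) := by
        funext p q r s
        rw [Function.iterate_succ_apply']
        rfl
      rw [e, Function.iterate_succ_apply', ← ih.2]
      exact ⟨ih.1.delta_fst, conv_delta_fst ih.1⟩
  rw [(h2 N).2, (h1 N').2, ← Function.iterate_add_apply]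

/-- The family of operators `u_p v_q`. -/
def opPair {V : Type u₁} [AddCommGroup V] [Module ℂ V] (Y : V →ₗ[ℂ] ℤ → Module.End ℂ D) (u v : V)
    (p q : ℤ) : Module.End ℂ D := Y u p * Y v q

theorem delta_iterate_opPair {V : Type u₁} [AddCommGroup V] [Module ℂ V]
    (Y : V →ₗ[ℂ] ℤ → Module.End ℂ D) (u v : V) (k : ℕ) (p q : ℤ) (w : D) :
    delta^[k] (opPair Y u v) p q w = delta^[k] (modePair Y u v w) p q :=
  (delta_iterate_comp (LinearMap.applyₗ w : Module.End ℂ D →ₗ[ℂ] D).toAddMonoidHom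
    (opPair Y u v) k p q).symm

theorem commute_delta_iterate {a : ℤ → ℤ → Module.End ℂ D} {T : Module.End ℂ D}
    (h : ∀ p q, Commute (a p q) T) (k : ℕ) (p q : ℤ) : Commute (delta^[k] a p q) T :=
  delta_iterate_induction (P := fun a => ∀ p q, Commute (a p q) T)
    (fun _ ha p q => (ha (p + 1) q).sub_left (ha p (q + 1))) h k p q

theorem WeakModule.exists_trunc_delta {V : Type u₁} [AddCommGroup V] [Module ℂ V]
    {A : VertexData V} (T : WeakModule A D) {u v : V} {N : ℕ}
    (hN : ∀ n : ℤ, N ≤ n → A.Y u n v = 0) (w : D) :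
    ∃ P, ∀ p q, P ≤ p ∨ P ≤ q → delta^[N] (opPair T.Y u v) p q w = 0 := by
  obtain ⟨P, h1⟩ := T.truncModes.exists_truncSnd u v w
  obtain ⟨P', h2⟩ : ∃ P', TruncSnd P' (modePair T.Y v u w) := T.truncModes.exists_truncSnd v u w
  refine ⟨max P P', fun p q h => ?_⟩
  rw [delta_iterate_opPair]
  rcases h with h | h
  · rw [T.locality hN, h2.delta_iterate N q p (by omega), smul_zero]
  · exact TruncSnd.delta_iterate h1 N p q (by omega)

end ProdFam

section TensorAct

variable {V₁ : Type u₁} [AddCommGroup V₁] [Module ℂ V₁] {V₂ : Type u₂} [AddCommGroup V₂]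
  [Module ℂ V₂] {A : VertexData V₁} {B : VertexData V₂}
  {D : Type u₃} [AddCommGroup D] [Module ℂ D] {L : WeakModule A D} {R : WeakModule B D}

/-- The actions of two vertex algebras on `D` commute. -/
def CommutingModes (L : WeakModule A D) (R : WeakModule B D) : Prop :=
  ∀ (u : V₁) (v : V₂) (m n : ℤ), Commute (L.Y u m) (R.Y v n)

theorem CommutingModes.apply (h : CommutingModes L R) (u : V₁) (v : V₂) (m n : ℤ) (f : D) :
    L.Y u m (R.Y v n f) = R.Y v n (L.Y u m f) := LinearMap.congr_fun (h u v m n).eq f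

theorem tensorAct_support (h : CommutingModes L R) (u : V₁) (v : V₂) (n : ℤ) (f : D) :
    (Function.support fun i : ℤ => L.Y u i (R.Y v (n - 1 - i) f)).Finite := by
  obtain ⟨P, hP⟩ := L.trunc u f
  obtain ⟨Q, hQ⟩ := R.trunc v f
  refine (Set.finite_Icc (n - 1 - Q) P).subset fun i hi => ?_
  rw [Function.mem_support] at hi
  refine ⟨?_, ?_⟩
  · by_contra hlt
    exact hi (by rw [hQ _ (by omega), map_zero])
  · by_contra hlt
    exact hi (by rw [h.apply, hP _ (by omega), map_zero])

/-- The operators `(u ⊗ v)_n = ∑_i u_i v_{n-1-i}` on a space with commuting actions. -/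
def tensorActHom (h : CommutingModes L R) (n : ℤ) : V₁ ⊗[ℂ] V₂ →ₗ[ℂ] Module.End ℂ D :=
  TensorProduct.lift <| LinearMap.mk₂ ℂ
    (fun u v =>
      { toFun := fun f => ∑ᶠ i : ℤ, L.Y u i (R.Y v (n - 1 - i) f)
        map_add' := fun f g => by
          rw [← finsum_add_distrib (tensorAct_support h u v n f) (tensorAct_support h u v n g)]
          simp only [map_add]
        map_smul' := fun c f => by
          rw [RingHom.id_apply, smul_finsum' c (tensorAct_support h u v n f)]
          simp only [map_smul] })
    (fun u u' v => LinearMap.ext fun f => by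
      refine Eq.trans ?_ (finsum_add_distrib (tensorAct_support h u v n f)
        (tensorAct_support h u' v n f))
      refine finsum_congr fun i => ?_
      rw [map_add, Pi.add_apply, LinearMap.add_apply])
    (fun c u v => LinearMap.ext fun f => by
      refine Eq.trans ?_ (smul_finsum' c (tensorAct_support h u v n f)).symm
      refine finsum_congr fun i => ?_
      rw [map_smul, Pi.smul_apply, LinearMap.smul_apply])
    (fun u v v' => LinearMap.ext fun f => by
      refine Eq.trans ?_ (finsum_add_distrib (tensorAct_support h u v n f)
        (tensorAct_support h u v' n f))
      refine finsum_congr fun i => ?_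
      rw [map_add, Pi.add_apply, LinearMap.add_apply, map_add])
    (fun c u v => LinearMap.ext fun f => by
      refine Eq.trans ?_ (smul_finsum' c (tensorAct_support h u v n f)).symm
      refine finsum_congr fun i => ?_
      rw [map_smul, Pi.smul_apply, LinearMap.smul_apply, map_smul])

/-- The modes of `Y^L ⊗ Y^R`. -/
def tensorAct (h : CommutingModes L R) : V₁ ⊗[ℂ] V₂ →ₗ[ℂ] ℤ → Module.End ℂ D :=
  LinearMap.pi fun n => tensorActHom h n

theorem tensorAct_tmul (h : CommutingModes L R) (u : V₁) (v : V₂) (n : ℤ) (f : D) :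
    tensorAct h (u ⊗ₜ v) n f = ∑ᶠ i : ℤ, L.Y u i (R.Y v (n - 1 - i) f) := rfl

theorem truncModes_tensorAct (h : CommutingModes L R) : TruncModes (tensorAct h) := fun t f => by
  induction t using TensorProduct.induction_on with
  | zero => exact ⟨0, fun n _ => by simp⟩
  | add t t' ht ht' =>
    obtain ⟨N, hN⟩ := ht
    obtain ⟨N', hN'⟩ := ht'
    refine ⟨max N N', fun n hn => ?_⟩
    rw [map_add, Pi.add_apply, LinearMap.add_apply, hN n (by omega), hN' n (by omega), add_zero]
  | tmul u v =>
    obtain ⟨P, hP⟩ := L.trunc u f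
    obtain ⟨Q, hQ⟩ := R.trunc v f
    refine ⟨P + Q + 1, fun n hn => ?_⟩
    rw [tensorAct_tmul]
    refine finsum_eq_zero_of_forall_eq_zero fun i => ?_
    rcases le_or_gt P i with hi | hi
    · rw [h.apply, hP i hi, map_zero]
    · rw [hQ _ (by omega), map_zero]

theorem fourTrunc_prodFam (h : CommutingModes L R) (u u' : V₁) (v v' : V₂) (w : D) :
    FourTrunc (prodFam (opPair L.Y u u') (opPair R.Y v v') w) := by
  refine ⟨?_, fun q s => ?_⟩
  · obtain ⟨P, hP⟩ := L.trunc u' w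
    obtain ⟨Q, hQ⟩ := R.trunc v' w
    refine ⟨max P Q, fun p q r s hqs => ?_⟩
    change L.Y u p (L.Y u' q (R.Y v r (R.Y v' s w))) = 0
    rcases hqs with hq | hs
    · rw [h.apply u' v, h.apply u' v', hP q (by omega), map_zero, map_zero, map_zero]
    · rw [hQ s (by omega), map_zero, map_zero, map_zero]
  · obtain ⟨P, hP⟩ := L.trunc u (L.Y u' q (R.Y v' s w))
    obtain ⟨Q, hQ⟩ := R.trunc v (R.Y v' s w)
    refine ⟨max P Q, fun p r hpr => ?_⟩
    change L.Y u p (L.Y u' q (R.Y v r (R.Y v' s w))) = 0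
    rcases hpr with hp | hr
    · rw [h.apply, h.apply, hP p (by omega), map_zero]
    · rw [hQ r (by omega), map_zero, map_zero]

/-- The product of two modes of `Y^L ⊗ Y^R`. -/
theorem modePair_tensorAct (h : CommutingModes L R) (u u' : V₁) (v v' : V₂) (w : D) :
    modePair (tensorAct h) (u ⊗ₜ v) (u' ⊗ₜ v') w =
      conv (prodFam (opPair L.Y u u') (opPair R.Y v v') w) := by
  funext m n
  rw [modePair, conv, finsum_curry _ ((fourTrunc_prodFam h u u' v v' w).support m n),
    tensorAct_tmul, tensorAct_tmul]
  refine finsum_congr fun p => ?_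
  rw [map_finsum _ (tensorAct_support h u' v' n w), map_finsum]
  · refine finsum_congr fun q => ?_
    rw [← h.apply]
    rfl
  · refine (tensorAct_support h u' v' n w).subset fun q hq hz => hq ?_
    dsimp only at hz ⊢
    rw [hz, map_zero]

section Pair

variable {u u' : V₁} {v v' : V₂} {N N' : ℕ}

/-- Locality in both factors: the product family is symmetric, up to a sign, under the exchange of
`(u, v)` and `(u', v')`. -/
theorem prodFam_symm (hN : ∀ n : ℤ, N ≤ n → A.Y u n u' = 0)
    (hN' : ∀ n : ℤ, N' ≤ n → B.Y v n v' = 0) (w : D) (p q r s : ℤ) :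
    prodFam (delta^[N] (opPair L.Y u u')) (delta^[N'] (opPair R.Y v v')) w p q r s =
      (-1 : ℂ) ^ (N + N') •
        prodFam (delta^[N] (opPair L.Y u' u)) (delta^[N'] (opPair R.Y v' v)) w q p s r := by
  rw [prodFam, prodFam, delta_iterate_opPair, L.locality hN, ← delta_iterate_opPair,
    delta_iterate_opPair R.Y, R.locality hN', ← delta_iterate_opPair, map_smul, smul_smul, pow_add]

/-- After multiplication by powers of `x₁ - x₂` and `y₁ - y₂` the product family is truncated in all
four indices. -/
theorem exists_prodFam_eq_zero (h : CommutingModes L R) (hN : ∀ n : ℤ, N ≤ n → A.Y u n u' = 0)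
    (hN' : ∀ n : ℤ, N' ≤ n → B.Y v n v' = 0) (w : D) :
    ∃ P : ℤ, ∀ p q r s, P ≤ p ∨ P ≤ q ∨ P ≤ r ∨ P ≤ s →
      prodFam (delta^[N] (opPair L.Y u u')) (delta^[N'] (opPair R.Y v v')) w p q r s = 0 := by
  obtain ⟨P, hP⟩ := L.exists_trunc_delta hN w
  obtain ⟨Q, hQ⟩ := R.exists_trunc_delta hN' w
  refine ⟨max P Q, fun p q r s hpq => ?_⟩
  rw [← or_assoc] at hpq
  rcases hpq with h1 | h1
  · have hc : Commute (delta^[N] (opPair L.Y u u') p q) (delta^[N'] (opPair R.Y v v') r s) :=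
      commute_delta_iterate (fun p q => (commute_delta_iterate (fun r s =>
        (((h u v p r).symm.mul_right (h u' v q r).symm).mul_left
          ((h u v' p s).symm.mul_right (h u' v' q s).symm))) N' r s).symm) N p q
    have := LinearMap.congr_fun hc.eq w
    rw [Module.End.mul_apply, Module.End.mul_apply, hP p q (by omega), map_zero] at this
    exact this
  · rw [prodFam, hQ r s (by omega), map_zero]

/-- Locality for `Y^L ⊗ Y^R`, with the sum of the exponents of the factors. -/
theorem tensorAct_locality (h : CommutingModes L R) (hN : ∀ n : ℤ, N ≤ n → A.Y u n u' = 0)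
    (hN' : ∀ n : ℤ, N' ≤ n → B.Y v n v' = 0) (w : D) (m n : ℤ) :
    delta^[N + N'] (modePair (tensorAct h) (u ⊗ₜ v) (u' ⊗ₜ v') w) m n =
      (-1 : ℂ) ^ (N + N') •
        delta^[N + N'] (modePair (tensorAct h) (u' ⊗ₜ v') (u ⊗ₜ v) w) n m := by
  rw [modePair_tensorAct, modePair_tensorAct, ← conv_prodFam (fourTrunc_prodFam h u u' v v' w),
    ← conv_prodFam (fourTrunc_prodFam h u' u v' v w), conv, conv]
  obtain ⟨P, hP⟩ := exists_prodFam_eq_zero h hN hN' w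
  rw [← finsum_comp_equiv (Equiv.prodComm ℤ ℤ), smul_finsum']
  · refine finsum_congr fun x => ?_
    rw [prodFam_symm hN hN']
    rfl
  · refine (Set.finite_Icc ((n - 1 - P, m - 1 - P) : ℤ × ℤ) (P, P)).subset ?_
    rintro ⟨q, p⟩ hx
    have h1 := mt (hP p q (m - 1 - p) (n - 1 - q)) fun hz => by
      rw [prodFam_symm hN hN', smul_eq_zero] at hz
      exact hx (hz.resolve_left (pow_ne_zero _ (neg_ne_zero.2 one_ne_zero)))
    exact ⟨⟨show n - 1 - P ≤ q by omega, show m - 1 - P ≤ p by omega⟩,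
      ⟨show q ≤ P by omega, show p ≤ P by omega⟩⟩

end Pair

end TensorAct

/-! ### The Jacobi identity for the product of two actions -/

section TensorAct

variable {V₁ : Type u₁} [AddCommGroup V₁] [Module ℂ V₁] {V₂ : Type u₂} [AddCommGroup V₂]
  [Module ℂ V₂] {A : VertexData V₁} {B : VertexData V₂}
  {D : Type u₃} [AddCommGroup D] [Module ℂ D] {L : WeakModule A D} {R : WeakModule B D}
  {u u' : V₁} {v v' : V₂} {N N' : ℕ}

theorem tensor_mode_eq_zero (hN : ∀ n : ℤ, N ≤ n → A.Y u n u' = 0)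
    (hN' : ∀ n : ℤ, N' ≤ n → B.Y v n v' = 0) (n : ℤ) (hn : ((N + N' : ℕ) : ℤ) ≤ n) :
    (A.tensor B).Y (u ⊗ₜ v) n (u' ⊗ₜ v') = 0 := by
  change tensorModeHom A B n (u ⊗ₜ v) (u' ⊗ₜ v') = 0
  rw [tensorModeHom_tmul]
  refine finsum_eq_zero_of_forall_eq_zero fun i => ?_
  push_cast at hn
  rcases le_or_gt (N : ℤ) i with h | h
  · rw [hN i h, TensorProduct.zero_tmul]
  · rw [hN' _ (by omega), TensorProduct.tmul_zero]

/-- The products `(u ⊗ v)_l (u' ⊗ v')`, with indices counted from the first one that can be nonzero. -/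
theorem tensor_mode_eq_sum (hN : ∀ n : ℤ, N ≤ n → A.Y u n u' = 0)
    (hN' : ∀ n : ℤ, N' ≤ n → B.Y v n v' = 0) (J : ℕ) :
    (A.tensor B).Y (u ⊗ₜ v) (((N + N' : ℕ) : ℤ) - 1 - J) (u' ⊗ₜ v') =
      ∑ x ∈ Finset.HasAntidiagonal.antidiagonal J,
        A.Y u (N - 1 - x.1) u' ⊗ₜ[ℂ] B.Y v (N' - 1 - x.2) v' := by
  change tensorModeHom A B _ (u ⊗ₜ v) (u' ⊗ₜ v') = _
  rw [tensorModeHom_tmul, finsum_eq_sum_of_support_subset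
    (s := (Finset.HasAntidiagonal.antidiagonal J).image fun x => (N : ℤ) - 1 - x.1),
    Finset.sum_image]
  · refine Finset.sum_congr rfl fun x hx => ?_
    have h := Finset.HasAntidiagonal.mem_antidiagonal.1 hx
    rw [show ((N + N' : ℕ) : ℤ) - 1 - J - 1 - (N - 1 - x.1) = N' - 1 - x.2 by
      rw [← h]; push_cast; ring]
  · intro x hx y hy hxy
    have h1 := Finset.HasAntidiagonal.mem_antidiagonal.1 hx
    have h2 := Finset.HasAntidiagonal.mem_antidiagonal.1 hy
    dsimp only at hxy
    exact Prod.ext (by omega) (by omega)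
  · intro i hi
    rw [Function.mem_support] at hi
    have h1 : i < N := by
      by_contra h
      exact hi (by rw [hN i (by omega), TensorProduct.zero_tmul])
    have h2 : ((N + N' : ℕ) : ℤ) - 1 - J - 1 - i < N' := by
      by_contra h
      exact hi (by rw [hN' _ (by omega), TensorProduct.tmul_zero])
    push_cast at h2
    rw [Finset.mem_coe, Finset.mem_image]
    exact ⟨((N - 1 - i).toNat, (J - (N - 1 - i)).toNat),
      Finset.HasAntidiagonal.mem_antidiagonal.2 (by dsimp only; omega), by dsimp only; omega⟩

/-- The series `(x₁ - x₂)^(N+N') (u ⊗ v)(x₁) (u' ⊗ v')(x₂) w`, before the identification of the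
variables of the two factors. -/
def fourFam (L : WeakModule A D) (R : WeakModule B D) (u u' : V₁) (v v' : V₂) (N N' : ℕ) (w : D) :
    ℤ → ℤ → ℤ → ℤ → D :=
  prodFam (delta^[N] (opPair L.Y u u')) (delta^[N'] (opPair R.Y v v')) w

theorem exists_fourFam_eq_zero (h : CommutingModes L R) (hN : ∀ n : ℤ, N ≤ n → A.Y u n u' = 0)
    (hN' : ∀ n : ℤ, N' ≤ n → B.Y v n v' = 0) (w : D) :
    ∃ P : ℤ, ∀ p q r s, P ≤ p ∨ P ≤ q ∨ P ≤ r ∨ P ≤ s →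
      fourFam L R u u' v v' N N' w p q r s = 0 := exists_prodFam_eq_zero h hN hN' w

theorem finite_support_diagonal {X : Type*} [AddCommGroup X] [Module ℂ X]
    {G : ℤ → ℤ → ℤ → ℤ → X} {P : ℤ}
    (hP : ∀ p q r s, P ≤ p ∨ P ≤ q ∨ P ≤ r ∨ P ≤ s → G p q r s = 0) (c : ℤ → ℤ → ℂ) (C : ℤ) :
    (Function.support fun t : ℤ × ℤ × ℤ =>
      c t.1 t.2.1 • G t.2.1 t.2.2 (t.1 - 1 - t.2.1) (C - t.1 - t.2.2)).Finite := by
  refine (Set.finite_Icc ((C - 2 * P, C - 3 * P, C - 3 * P) : ℤ × ℤ × ℤ)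
    (2 * P, P, P)).subset ?_
  rintro ⟨k, p, q⟩ ht
  have h1 := mt (hP p q (k - 1 - p) (C - k - q)) fun hz => ht (by
    dsimp only
    rw [hz, smul_zero])
  refine ⟨⟨?_, ?_, ?_⟩, ⟨?_, ?_, ?_⟩⟩
  · show C - 2 * P ≤ k
    omega
  · show C - 3 * P ≤ p
    omega
  · show C - 3 * P ≤ q
    omega
  · show k ≤ 2 * P
    omega
  · show p ≤ P
    omega
  · show q ≤ P
    omega

/-- The modes of `a ⊗ b`, where `a`, `b` are modes of `u`, `v` applied to `u'`, `v'`. -/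
theorem tensorAct_mode (h : CommutingModes L R) (hN : ∀ n : ℤ, N ≤ n → A.Y u n u' = 0)
    (hN' : ∀ n : ℤ, N' ≤ n → B.Y v n v' = 0) (j k : ℕ) (n : ℤ) (w : D) :
    tensorAct h (A.Y u (N - 1 - j) u' ⊗ₜ B.Y v (N' - 1 - k) v') n w =
      ∑ᶠ t : ℤ × ℤ × ℤ, (binom (-t.2.1 - 1) j * binom (-(t.1 - 1 - t.2.1) - 1) k) •
        fourFam L R u u' v v' N N' w t.2.1 t.2.2 (t.1 - 1 - t.2.1)
          (n - 2 - (j + k : ℕ) - t.1 - t.2.2) := by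
  obtain ⟨P, hP⟩ := exists_fourFam_eq_zero h hN hN' w
  -- The index `i` belongs to the first factor, `p` and `r` to the expansions of the modes of the two
  -- factors. The new first index `p + r + 1` is the index of `x₁` after `y₁ = x₁`.
  obtain ⟨e, he⟩ : ∃ e : (ℤ × ℤ × ℤ) ≃ (ℤ × ℤ × ℤ), ∀ i r p : ℤ, e (i, r, p) =
      (p + r + 1, p, i - 1 - j - p) :=
    ⟨{ toFun := fun x => (x.2.2 + x.2.1 + 1, x.2.2, x.1 - 1 - j - x.2.2)
       invFun := fun t => (t.2.2 + 1 + j + t.2.1, t.1 - 1 - t.2.1, t.2.1)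
       left_inv := fun x => by
         refine Prod.ext ?_ (Prod.ext ?_ ?_) <;> dsimp only <;> ring
       right_inv := fun t => by
         refine Prod.ext ?_ (Prod.ext ?_ ?_) <;> dsimp only <;> ring }, fun _ _ _ => rfl⟩
  have hfin := finite_support_diagonal hP (fun k' p => binom (-p - 1) j *
    binom (-(k' - 1 - p) - 1) k) (n - 2 - (j + k : ℕ))
  rw [← finsum_comp_equiv e, finsum_curry₃ _ (hfin.preimage e.injective.injOn), tensorAct_tmul]
  refine finsum_congr fun i => ?_
  obtain ⟨P', hP'⟩ := R.exists_trunc_delta hN' w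
  have hr : R.Y (B.Y v (N' - 1 - k) v') (n - 1 - i) w = ∑ᶠ r : ℤ, binom (-r - 1) k •
      delta^[N'] (opPair R.Y v v') r (n - 1 - i - 1 - k - r) w := by
    simp only [delta_iterate_opPair]
    exact R.mode_eq_finsum hN' k (n - 1 - i) w
  rw [hr, map_finsum]
  · refine finsum_congr fun r => ?_
    rw [map_smul, L.mode_eq_finsum hN, smul_finsum']
    · refine finsum_congr fun p => ?_
      rw [he, ← delta_iterate_opPair, smul_smul, mul_comm]
      dsimp only
      rw [show p + r + 1 - 1 - p = r by ring, show n - 2 - ((j + k : ℕ) : ℤ) - (p + r + 1) -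
        (i - 1 - j - p) = n - 1 - i - 1 - k - r by push_cast; ring]
      rfl
    · obtain ⟨Q, hQ⟩ := L.exists_trunc_delta hN
        (delta^[N'] (opPair R.Y v v') r (n - 1 - i - 1 - k - r) w)
      refine (Set.finite_Icc (i - 1 - j - Q) Q).subset fun p hp => ?_
      have h1 := mt (hQ p (i - 1 - j - p)) fun hz => hp (by
        dsimp only
        rw [← delta_iterate_opPair, hz, smul_zero])
      exact ⟨by omega, by omega⟩
  · refine (Set.finite_Icc (n - 1 - i - 1 - k - P') P').subset fun r hr => ?_
    have h1 := mt (hP' r (n - 1 - i - 1 - k - r)) fun hz => hr (by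
      dsimp only
      rw [hz, smul_zero])
    exact ⟨by omega, by omega⟩

/-- The formula for the modes of `(u ⊗ v)_l (u' ⊗ v')`: the Leibniz rule for the divided
derivatives of a product. -/
theorem tensorAct_mode_eq_finsum (h : CommutingModes L R) (hN : ∀ n : ℤ, N ≤ n → A.Y u n u' = 0)
    (hN' : ∀ n : ℤ, N' ≤ n → B.Y v n v' = 0) (J : ℕ) (n : ℤ) (w : D) :
    tensorAct h ((A.tensor B).Y (u ⊗ₜ v) (((N + N' : ℕ) : ℤ) - 1 - J) (u' ⊗ₜ v')) n w =
      ∑ᶠ k : ℤ, binom (-k - 1) J • delta^[N + N'] (modePair (tensorAct h) (u ⊗ₜ v) (u' ⊗ₜ v') w) k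
        (n - 1 - J - k) := by
  obtain ⟨P, hP⟩ := exists_fourFam_eq_zero h hN hN' w
  rw [tensor_mode_eq_sum hN hN', map_sum, Finset.sum_apply, LinearMap.sum_apply]
  have hterm : ∀ x ∈ Finset.HasAntidiagonal.antidiagonal J,
      tensorAct h (A.Y u (N - 1 - x.1) u' ⊗ₜ B.Y v (N' - 1 - x.2) v') n w =
      ∑ᶠ t : ℤ × ℤ × ℤ, (binom (-t.2.1 - 1) x.1 * binom (-(t.1 - 1 - t.2.1) - 1) x.2) •
        fourFam L R u u' v v' N N' w t.2.1 t.2.2 (t.1 - 1 - t.2.1) (n - 2 - J - t.1 - t.2.2) :=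
    fun x hx => by
      rw [tensorAct_mode h hN hN', Finset.HasAntidiagonal.mem_antidiagonal.1 hx]
  rw [Finset.sum_congr rfl hterm, ← finsum_sum_comm _
    (fun (t : ℤ × ℤ × ℤ) (x : ℕ × ℕ) => (binom (-t.2.1 - 1) x.1 *
      binom (-(t.1 - 1 - t.2.1) - 1) x.2) •
        fourFam L R u u' v v' N N' w t.2.1 t.2.2 (t.1 - 1 - t.2.1) (n - 2 - J - t.1 - t.2.2))
    fun x _ => finite_support_diagonal hP
      (fun k' p => binom (-p - 1) x.1 * binom (-(k' - 1 - p) - 1) x.2) (n - 2 - J)]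
  have hv : ∀ k p : ℤ, ∑ x ∈ Finset.HasAntidiagonal.antidiagonal J,
      binom (-p - 1) x.1 * binom (-(k - 1 - p) - 1) x.2 = binom (-k - 1) J := fun k p => by
    rw [← binom_add, show -p - 1 + (-(k - 1 - p) - 1) = -k - 1 by ring]
  simp only [← Finset.sum_smul, hv]
  rw [finsum_curry _ (finite_support_diagonal hP (fun k _ => binom (-k - 1) J) (n - 2 - J))]
  refine finsum_congr fun k => ?_
  rw [modePair_tensorAct, ← conv_prodFam (fourTrunc_prodFam h u u' v v' w), conv, smul_finsum']
  · refine finsum_congr fun x => ?_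
    rw [show n - 1 - J - k - 1 - x.2 = n - 2 - J - k - x.2 by ring]
    rfl
  · refine (Set.finite_Icc ((k - 1 - P, n - 2 - J - k - P) : ℤ × ℤ) (P, P)).subset ?_
    rintro ⟨p, q⟩ hx
    have h1 := mt (hP p q (k - 1 - p) (n - 1 - J - k - 1 - q)) hx
    exact ⟨⟨show k - 1 - P ≤ p by omega, show n - 2 - J - k - P ≤ q by omega⟩,
      ⟨show p ≤ P by omega, show q ≤ P by omega⟩⟩

end TensorAct

section JacobiAdd

variable {V : Type u₁} [AddCommGroup V] [Module ℂ V] {A : VertexData V}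
  {D : Type u₂} [AddCommGroup D] [Module ℂ D]

theorem jacobiLHS_add_left (Y : V →ₗ[ℂ] ℤ → Module.End ℂ D) (u u' v : V) (l m n : ℤ) (w : D) :
    jacobiLHS A Y (u + u') v l m n w = jacobiLHS A Y u v l m n w + jacobiLHS A Y u' v l m n w := by
  unfold jacobiLHS
  rw [← finsum_add_distrib (jacobiLHS_support A Y u v l m n w) (jacobiLHS_support A Y u' v l m n w)]
  simp only [map_add, Pi.add_apply, LinearMap.add_apply, smul_add]

theorem jacobiLHS_add_right (Y : V →ₗ[ℂ] ℤ → Module.End ℂ D) (u v v' : V) (l m n : ℤ) (w : D) :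
    jacobiLHS A Y u (v + v') l m n w = jacobiLHS A Y u v l m n w + jacobiLHS A Y u v' l m n w := by
  unfold jacobiLHS
  rw [← finsum_add_distrib (jacobiLHS_support A Y u v l m n w) (jacobiLHS_support A Y u v' l m n w)]
  simp only [map_add, Pi.add_apply, LinearMap.add_apply, smul_add]

theorem jacobiRHS_add_left {Y : V →ₗ[ℂ] ℤ → Module.End ℂ D} (hY : TruncModes Y) (u u' v : V)
    (l m n : ℤ) (w : D) :
    jacobiRHS Y (u + u') v l m n w = jacobiRHS Y u v l m n w + jacobiRHS Y u' v l m n w := by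
  unfold jacobiRHS
  rw [← finsum_add_distrib (jacobiRHS_support Y hY u v l m n w)
    (jacobiRHS_support Y hY u' v l m n w)]
  refine finsum_congr fun i => ?_
  simp only [map_add, Pi.add_apply, LinearMap.add_apply, ← smul_add]
  congr 1
  rw [smul_add]
  abel

theorem jacobiRHS_add_right {Y : V →ₗ[ℂ] ℤ → Module.End ℂ D} (hY : TruncModes Y) (u v v' : V)
    (l m n : ℤ) (w : D) :
    jacobiRHS Y u (v + v') l m n w = jacobiRHS Y u v l m n w + jacobiRHS Y u v' l m n w := by
  unfold jacobiRHS
  rw [← finsum_add_distrib (jacobiRHS_support Y hY u v l m n w)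
    (jacobiRHS_support Y hY u v' l m n w)]
  refine finsum_congr fun i => ?_
  simp only [map_add, Pi.add_apply, LinearMap.add_apply, ← smul_add]
  congr 1
  rw [smul_add]
  abel

end JacobiAdd

/-! ### The module for the tensor product of two algebras -/

section TensorModule

variable {V₁ : Type u₁} [AddCommGroup V₁] [Module ℂ V₁] {V₂ : Type u₂} [AddCommGroup V₂]
  [Module ℂ V₂] {A : VertexOperatorAlgebra V₁} {B : VertexOperatorAlgebra V₂}
  {D : Type u₃} [AddCommGroup D] [Module ℂ D] {L : WeakModule A.toVertexData D}
  {R : WeakModule B.toVertexData D}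

theorem tensorAct_jacobi {A : VertexData V₁} {B : VertexData V₂} {L : WeakModule A D}
    {R : WeakModule B D} (h : CommutingModes L R) (s t : V₁ ⊗[ℂ] V₂) (l m n : ℤ) (w : D) :
    jacobiLHS (A.tensor B) (tensorAct h) s t l m n w = jacobiRHS (tensorAct h) s t l m n w := by
  have hT := truncModes_tensorAct h
  induction s using TensorProduct.induction_on with
  | zero => simp [jacobiLHS, jacobiRHS]
  | add s s' hs hs' => rw [jacobiLHS_add_left, jacobiRHS_add_left hT, hs, hs']
  | tmul u v =>
    induction t using TensorProduct.induction_on with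
    | zero => simp [jacobiLHS, jacobiRHS]
    | add t t' ht ht' => rw [jacobiLHS_add_right, jacobiRHS_add_right hT, ht, ht']
    | tmul u' v' =>
      obtain ⟨N, hN⟩ := A.trunc u u'
      obtain ⟨N', hN'⟩ := B.trunc v v'
      have hN : ∀ n : ℤ, (N.toNat : ℤ) ≤ n → A.Y u n u' = 0 := fun n hn => hN n (by omega)
      have hN' : ∀ n : ℤ, (N'.toNat : ℤ) ≤ n → B.Y v n v' = 0 := fun n hn => hN' n (by omega)
      exact jacobi_of_locality hT (tensor_mode_eq_zero hN hN')
        (tensorAct_locality h hN hN' w)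
        (fun J n => tensorAct_mode_eq_finsum h hN hN' J n w) l m n

theorem tensorAct_tmul_vac {A : VertexData V₁} {B : VertexData V₂} {L : WeakModule A D}
    {R : WeakModule B D} (h : CommutingModes L R) (u : V₁) (n : ℤ) (w : D) :
    tensorAct h (u ⊗ₜ B.vac) n w = L.Y u n w := by
  rw [tensorAct_tmul, finsum_eq_single _ n]
  · rw [R.vacuum, if_pos (by ring)]
  · intro i hi
    rw [R.vacuum, if_neg (by omega), map_zero]

theorem tensorAct_vac_tmul {A : VertexData V₁} {B : VertexData V₂} {L : WeakModule A D}
    {R : WeakModule B D} (h : CommutingModes L R) (v : V₂) (n : ℤ) (w : D) :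
    tensorAct h (A.vac ⊗ₜ v) n w = R.Y v n w := by
  rw [tensorAct_tmul, finsum_eq_single _ (-1)]
  · rw [L.vacuum, if_pos rfl, show n - 1 - -1 = n by ring]
  · intro i hi
    rw [L.vacuum, if_neg hi]

theorem tensor_conf_zero (u : V₁) (v : V₂) :
    (A.toVertexData.tensor B.toVertexData).Y (A.toVertexData.tensor B.toVertexData).conf 0
      (u ⊗ₜ v) = A.Y A.conf 0 u ⊗ₜ v + u ⊗ₜ B.Y B.conf 0 v := by
  change tensorModeHom _ _ 0 (A.conf ⊗ₜ B.vac + A.vac ⊗ₜ B.conf) _ = _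
  rw [map_add, LinearMap.add_apply, tensorModeHom_tmul, tensorModeHom_tmul,
    finsum_eq_single _ 0, finsum_eq_single _ (-1)]
  · rw [A.vacuum, B.vacuum, if_pos rfl, if_pos (by ring)]
    rfl
  · intro i hi
    rw [A.vacuum, if_neg hi, TensorProduct.zero_tmul]
  · intro i hi
    rw [B.vacuum, if_neg (by omega), TensorProduct.tmul_zero]

/-- The property of `L(-1)` for the product: the Leibniz rule for `Y^L(u,x) Y^R(v,x)`. -/
theorem tensorAct_deriv (h : CommutingModes L R) (t : V₁ ⊗[ℂ] V₂) (n : ℤ) (w : D) :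
    tensorAct h ((A.toVertexData.tensor B.toVertexData).Y
      (A.toVertexData.tensor B.toVertexData).conf 0 t) n w =
      (-(n : ℂ)) • tensorAct h t (n - 1) w := by
  induction t using TensorProduct.induction_on with
  | zero => simp
  | add t t' ht ht' =>
    rw [map_add, map_add, map_add, Pi.add_apply, Pi.add_apply, LinearMap.add_apply,
      LinearMap.add_apply, ht, ht', smul_add]
  | tmul u v =>
    have h1 := tensorAct_support h (A.Y A.conf 0 u) v n w
    rw [tensor_conf_zero, map_add, Pi.add_apply, LinearMap.add_apply, tensorAct_tmul,
      tensorAct_tmul, tensorAct_tmul, smul_finsum' _ (tensorAct_support h u v (n - 1) w),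
      ← finsum_comp_equiv (Equiv.addRight (1 : ℤ)), ← finsum_add_distrib
        (h1.preimage (Equiv.injective _).injOn) (tensorAct_support h u (B.Y B.conf 0 v) n w)]
    refine finsum_congr fun i => ?_
    dsimp only [Equiv.coe_addRight]
    rw [L.deriv, R.deriv, map_smul, show n - 1 - (i + 1) = n - 1 - 1 - i by ring,
      show n - 1 - i - 1 = n - 1 - 1 - i by ring, add_sub_cancel_right, ← add_smul]
    congr 1
    push_cast
    ring

/-- The tensor product `Y^L ⊗ Y^R` of two commuting actions, a module for the tensor product of the
two algebras. -/
def tensorModule (h : CommutingModes L R) :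
    WeakModule (A.toVertexData.tensor B.toVertexData) D where
  Y := tensorAct h
  trunc := truncModes_tensorAct h
  vacuum := fun n w => (tensorAct_tmul_vac h A.vac n w).trans (L.vacuum n w)
  jacobi := tensorAct_jacobi h
  virasoro := fun m n w => by
    have hY : ∀ n w, tensorAct h (A.toVertexData.tensor B.toVertexData).conf n w =
        L.Y A.conf n w + R.Y B.conf n w := fun n w => by
      change tensorAct h (A.conf ⊗ₜ B.vac + A.vac ⊗ₜ B.conf) n w = _
      rw [map_add, Pi.add_apply, LinearMap.add_apply, tensorAct_tmul_vac, tensorAct_vac_tmul]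
    have hL := L.virasoro m n w
    have hR := R.virasoro m n w
    have hr : (A.toVertexData.tensor B.toVertexData).rank = A.rank + B.rank := rfl
    simp only [hY, map_add, h.apply]
    rw [sub_eq_iff_eq_add] at hL hR
    rw [hL, hR, hr]
    split_ifs <;> module
  deriv := tensorAct_deriv h

end TensorModule

/-! ### The map `η` -/

section Eta

variable {V : Type u₁} [AddCommGroup V] [Module ℂ V] {B : VertexOperatorAlgebra V}
  {W : Type u₂} [AddCommGroup W] [Module ℂ W] (M : WeakModule B.toVertexData W)
  {U : Type u₃} [AddCommGroup U] [Module ℂ U] {c c' : ℂ}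

theorem oppositeCoeff_leftTensor {E : Type u₃} [AddCommGroup E] [Module ℂ E] (v : V) (e : ℤ)
    (φ : E) (w : W) :
    oppositeCoeff (M.leftTensor E) v e (φ ⊗ₜ w) = φ ⊗ₜ oppositeCoeff M v e w := by
  change _ = TensorProduct.mk ℂ E W φ (oppositeCoeff M v e w)
  unfold oppositeCoeff
  rw [map_finsum _ (oppositeCoeff_outer_support M v e w)]
  refine finsum_congr fun h => ?_
  rw [map_finsum _ (oppositeCoeff_inner_support M v e h w)]
  refine finsum_congr fun i => ?_
  rw [map_smul]
  rfl

theorem opp_leftTensor {E : Type u₃} [AddCommGroup E] [Module ℂ E] (v : V) (p : Lau)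
    (φ : E) (w : W) : (M.leftTensor E).opp v p (φ ⊗ₜ w) = φ ⊗ₜ M.opp v p w := by
  obtain ⟨N, hN⟩ := oppositeCoeff_shift_trunc M v w
  change _ = TensorProduct.mk ℂ E W φ (pairing _ p)
  rw [WeakModule.opp_apply, pairing, pairing, map_finsum _ (pairing_support hN p)]
  refine finsum_congr fun n => ?_
  rw [map_smul, oppositeCoeff_leftTensor]
  rfl

/-- The map `η` is compatible with the opposite vertex operators of `W` and `U* ⊗ W`. -/
theorem eta_comp_opp (f : W →ₗ[ℂ] U) (v : V) (p : Lau) :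
    eta W U f ∘ₗ (M.leftTensor (Module.Dual ℂ U)).opp v p = eta W U (f ∘ₗ M.opp v p) :=
  TensorProduct.ext' fun φ w => by
    rw [LinearMap.comp_apply, opp_leftTensor]
    rfl

theorem eta_injective : Function.Injective (eta W U) := by
  rw [← LinearMap.ker_eq_bot, LinearMap.ker_eq_bot']
  intro f hf
  refine LinearMap.ext fun w => ?_
  exact (Module.forall_dual_apply_eq_zero_iff ℂ (f w)).1 fun φ => LinearMap.congr_fun hf (φ ⊗ₜ w)

theorem isKilled_eta {f : W →ₗ[ℂ] U} :
    IsKilled (M.leftTensor (Module.Dual ℂ U)) c c' (eta W U f) ↔ IsKilled M c c' f := by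
  unfold IsKilled
  simp only [eta_comp_opp, map_eq_zero_iff _ eta_injective]

theorem eta_mem_regularSpace (z : ℂ) {f : W →ₗ[ℂ] U} :
    eta W U f ∈ regularSpace (M.leftTensor (Module.Dual ℂ U)) z ℂ ↔ f ∈ regularSpace M z U := by
  rw [mem_regularSpace_iff, mem_regularSpace_iff, isKilled_eta]

theorem map_eta_regularSpace (z : ℂ) : (regularSpace M z U).map (eta W U) =
    LinearMap.range (eta W U) ⊓ regularSpace (M.leftTensor (Module.Dual ℂ U)) z ℂ := by
  ext g
  constructor
  · rintro ⟨f, hf, rfl⟩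
    exact ⟨⟨f, rfl⟩, (eta_mem_regularSpace M z).2 hf⟩
  · rintro ⟨⟨f, rfl⟩, hf⟩
    exact ⟨f, (eta_mem_regularSpace M z).1 hf, rfl⟩

variable {M} in
theorem localAct_eta {e : ℕ → Lau} {f : W →ₗ[ℂ] U} (hf : IsKilled M c c' f) (he : IsIdem c c' e)
    (v : V) (n : ℤ) : localAct (M.leftTensor (Module.Dual ℂ U)) c e v n (eta W U f) =
      eta W U (localAct M c e v n f) :=
  evLim_eq ((hf.eventually_localAct he v n).mono fun N hN => by rw [eta_comp_opp, hN])

variable (U) in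
/-- The map `D_{P(z)}(W,U) → D_{P(z)}(U* ⊗ W)` induced by `η`. -/
def regularEta (z : ℂ) : regularSpace M z U →ₗ[ℂ]
    regularSpace (M.leftTensor (Module.Dual ℂ U)) z ℂ :=
  (eta W U).restrict fun _ hf => (eta_mem_regularSpace M z).2 hf

theorem regularEta_injective (z : ℂ) : Function.Injective (regularEta M U z) := fun _ _ h =>
  Subtype.ext (eta_injective (congrArg Subtype.val h))

end Eta

section Intertwine

variable {V₁ : Type u₁} [AddCommGroup V₁] [Module ℂ V₁] {V₂ : Type u₂} [AddCommGroup V₂]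
  [Module ℂ V₂] {A : VertexData V₁} {B : VertexData V₂}
  {D : Type*} [AddCommGroup D] [Module ℂ D] {D' : Type*} [AddCommGroup D'] [Module ℂ D']

theorem tensorAct_intertwine {L : WeakModule A D} {R : WeakModule B D} {L' : WeakModule A D'}
    {R' : WeakModule B D'} (h : CommutingModes L R) (h' : CommutingModes L' R') {j : D →ₗ[ℂ] D'}
    (hL : ∀ v n f, j (L.Y v n f) = L'.Y v n (j f)) (hR : ∀ v n f, j (R.Y v n f) = R'.Y v n (j f))
    (t : V₁ ⊗[ℂ] V₂) (n : ℤ) (f : D) : j (tensorAct h t n f) = tensorAct h' t n (j f) := by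
  induction t using TensorProduct.induction_on with
  | zero => simp
  | add s t hs ht =>
    rw [map_add, map_add, Pi.add_apply, Pi.add_apply, LinearMap.add_apply, LinearMap.add_apply,
      map_add, hs, ht]
  | tmul u v =>
    rw [tensorAct_tmul, tensorAct_tmul, map_finsum _ (tensorAct_support h u v n f)]
    simp only [hL, hR]

end Intertwine

end

end RegularRep

theorem theorem2p17 {V : Type*} [AddCommGroup V] [Module ℂ V]
    (A : RegularRep.VertexOperatorAlgebra V)
    {W : Type*} [AddCommGroup W] [Module ℂ W] (M : RegularRep.WeakModule A.toVertexData W)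
    (U : Type*) [AddCommGroup U] [Module ℂ U] (z : ℂ) (hz : z ≠ 0) :
    ∃ (L R : RegularRep.WeakModule A.toVertexData (RegularRep.regularSpace M z U))
      (T : RegularRep.WeakModule (A.toVertexData.tensor A.toVertexData)
        (RegularRep.regularSpace M z U)),
      RegularRep.IsLeftAction M z L.Y ∧
      RegularRep.IsRightAction M z R.Y ∧
      RegularRep.ActionsCommute L.Y R.Y ∧
      RegularRep.IsTensorAction L.Y R.Y T.Y ∧
      ∃ (L' R' : RegularRep.WeakModule A.toVertexData
            (RegularRep.regularSpace (M.leftTensor (Module.Dual ℂ U)) z ℂ))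
        (T' : RegularRep.WeakModule (A.toVertexData.tensor A.toVertexData)
            (RegularRep.regularSpace (M.leftTensor (Module.Dual ℂ U)) z ℂ))
        (j : RegularRep.regularSpace M z U →ₗ[ℂ]
            RegularRep.regularSpace (M.leftTensor (Module.Dual ℂ U)) z ℂ),
        RegularRep.IsLeftAction (M.leftTensor (Module.Dual ℂ U)) z L'.Y ∧
        RegularRep.IsRightAction (M.leftTensor (Module.Dual ℂ U)) z R'.Y ∧
        RegularRep.ActionsCommute L'.Y R'.Y ∧
        RegularRep.IsTensorAction L'.Y R'.Y T'.Y ∧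
        (∀ f : RegularRep.regularSpace M z U, (j f).1 = RegularRep.eta W U f.1) ∧
        Function.Injective j ∧
        T'.IsSubmodule (LinearMap.range j) ∧
        (RegularRep.regularSpace M z U).map (RegularRep.eta W U) =
          LinearMap.range (RegularRep.eta W U) ⊓
            RegularRep.regularSpace (M.leftTensor (Module.Dual ℂ U)) z ℂ ∧
        (∀ (v : V) (n : ℤ) (f : RegularRep.regularSpace M z U),
          j (L.Y v n f) = L'.Y v n (j f)) ∧
        (∀ (v : V) (n : ℤ) (f : RegularRep.regularSpace M z U),
          j (R.Y v n f) = R'.Y v n (j f)) ∧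
        ∀ (t : V ⊗[ℂ] V) (n : ℤ) (f : RegularRep.regularSpace M z U),
          j (T.Y t n f) = T'.Y t n (j f) := by
  open RegularRep in
  -- The polynomials `e` isolate the point `z` and define `Y^L`; the polynomials `e'` isolate `0` and
  -- define `Y^R`. The same choice serves `W` and `U* ⊗ W`.
  obtain ⟨e, he⟩ := exists_isIdem hz
  obtain ⟨e', he'⟩ := exists_isIdem hz.symm
  set M' := M.leftTensor (Module.Dual ℂ U)
  have hc := actionsCommute_localModule (mem_regularSpace_iff' M z (U := U))
    (mem_regularSpace_iff M z (U := U)) he he'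
  have hc' := actionsCommute_localModule (mem_regularSpace_iff' M' z (U := ℂ))
    (mem_regularSpace_iff M' z (U := ℂ)) he he'
  have h : CommutingModes (localModule (mem_regularSpace_iff' M z (U := U)) he)
      (localModule (mem_regularSpace_iff M z (U := U)) he') :=
    fun u v m n => LinearMap.ext (hc u v m n)
  have h' : CommutingModes (localModule (mem_regularSpace_iff' M' z (U := ℂ)) he)
      (localModule (mem_regularSpace_iff M' z (U := ℂ)) he') :=
    fun u v m n => LinearMap.ext (hc' u v m n)
  have hL : ∀ v n f, regularEta M U z
      ((localModule (mem_regularSpace_iff' M z (U := U)) he).Y v n f) =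
        (localModule (mem_regularSpace_iff' M' z (U := ℂ)) he).Y v n (regularEta M U z f) :=
    fun v n f => Subtype.ext (localAct_eta ((mem_regularSpace_iff' M z f.1).1 f.2) he v n).symm
  have hR : ∀ v n f, regularEta M U z
      ((localModule (mem_regularSpace_iff M z (U := U)) he').Y v n f) =
        (localModule (mem_regularSpace_iff M' z (U := ℂ)) he').Y v n (regularEta M U z f) :=
    fun v n f => Subtype.ext (localAct_eta ((mem_regularSpace_iff M z f.1).1 f.2) he' v n).symm
  have hT := tensorAct_intertwine h h' hL hR
  refine ⟨_, _, tensorModule h, isLeftAction_localModule M hz he, isRightAction_localModule M hz he',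
    hc, fun u v n f => ⟨tensorAct_support h u v n f, rfl⟩, _, _, tensorModule h', regularEta M U z,
    isLeftAction_localModule M' hz he, isRightAction_localModule M' hz he', hc',
    fun u v n f => ⟨tensorAct_support h' u v n f, rfl⟩, fun _ => rfl, regularEta_injective M z, ?_,
    map_eta_regularSpace M z, hL, hR, hT⟩
  rintro t n _ ⟨f, rfl⟩
  exact ⟨tensorAct h t n f, hT t n f⟩
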